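/- Setup. Let $\mathbb F$ be a field of characteristic $0$, $\mathfrak g$ a finite-dimensional reductive Lie algebra over $\mathbb F$ with a non-degenerate symmetric invariant bilinear form $\kappa$, and let $(f,h=2x,e)$ be an $\mathfrak{sl}_2$-triple in $\mathfrak g$ (with $f\neq 0$). Let $\mathfrak g=\bigoplus_{i\in\frac12\mathbb Z}\mathfrak g_i$ be the $\operatorname{ad}x$-eigenspace decomposition; write $\delta_x(a)=i$ for $a\in\mathfrak g_i$, and $\mathfrak g_{\ge1}=\bigoplus_{i\ge1}\mathfrak g_i$, $\mathfrak g_{\le\frac12}=\bigoplus_{i\le\frac12}\mathfrak g_i$. Let $\mathfrak l\subset\mathfrak g_{\frac12}$ be a subspace isotropic for $\omega(a,b)=\kappa(f\mid[a,b])$, let $\mathfrak l^{\perp\omega}=\{a\in\mathfrak g_{\frac12}\mid\omega(a,b)=0\ \forall b\in\mathfrak l\}$, and put $\mathfrak m=\mathfrak l\oplus\mathfrak g_{\ge1}\subset\mathfrak n=\mathfrak l^{\perp\omega}\oplus\mathfrak g_{\ge1}$. Let $\mathfrak p\subset\mathfrak g_{\le\frac12}$ be a subspace with $\mathfrak g=\mathfrak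 m\oplus\mathfrak p$, $\pi_{\mathfrak p}$ the projection onto $\mathfrak p$ with kernel $\mathfrak m$, $\mathfrak m^\perp$ the $\kappa$-orthogonal complement of $\mathfrak m$, $(q_i)_{i\in P}$ a basis of $\mathfrak p$ and $(q^i)_{i\in P}$ the $\kappa$-dual basis of $\mathfrak m^\perp$. Let $V\subset\mathfrak m^\perp$ be a subspace complementary to $[f,\mathfrak n]$ in $\mathfrak m^\perp$ and compatible with the $\operatorname{ad}x$-eigenspace decomposition. Let $s\in\mathfrak g$ with $[s,\mathfrak n]=0$ and $z\in\mathbb F$. For a vector space $U$ let $\mathcal V(U)=S(\mathbb F[\partial]U)$ be the algebra of differential polynomials in a basis of $U$; write $a^{(m)}=\partial^m a$. In the Lie algebra $\mathbb F\partial\ltimes(\mathfrak g\otimes\mathcal V(\mathfrak p))$, where $[a\otimes g,b\otimes h]=[a,b]\otimes gh$ and $[\partial,a\otimes g]=a\otimes\partial g$, let $q=\sum_{i\in P}q^i\otimes q_i$ and, for $A\in\mathfrak n\otimes\mathcal V(\mathfrak p)$, define the gauge transform $q^A$ by $e^{\operatorname{ad}A}(\partial+q+f\otimes1)=\partial+q^A+f\otimes1$.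 On $\mathcal V(\mathfrak g)$ let $\{\cdot_\lambda\cdot\}_z$ be the $\lambda$-bracket given by the Master Formula with $\{a_\lambda b\}_z=[a,b]+\kappa(a\mid b)\lambda+z\kappa(s\mid[a,b])$ for $a,b\in\mathfrak g$, let $\rho:\mathcal V(\mathfrak g)\to\mathcal V(\mathfrak p)$ be the differential algebra homomorphism with $\rho(a)=\pi_{\mathfrak p}(a)+\kappa(f\mid a)$ for $a\in\mathfrak g$, and let the classical $\mathcal W$-algebra be $\mathcal W=\{g\in\mathcal V(\mathfrak p)\mid\rho\{a_\lambda g\}_z=0\text{ for all }a\in\mathfrak n\}$. If $\mathfrak p$ is compatible with the $\operatorname{ad}x$-eigenspace decomposition, the conformal weight of a monomial $a_1^{(m_1)}\cdots a_s^{(m_s)}$ with $a_k\in\mathfrak p$ homogeneous is $\Delta=s-\sum_k\delta_x(a_k)+\sum_k m_k$; $\mathcal V(\mathfrak p)\{i\}$ denotes the span of the monomials with $\Delta=i$, and $(\mathfrak g\otimes\mathcal V(\mathfrak p))\{i\}=\bigoplus_j\mathfrak g_j\otimes\mathcal V(\mathfrak p)\{i+j\}$ is the space of elements of weight $i$. Theorem.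 (a) There exists a unique $X\in\mathfrak n\otimes\mathcal V(\mathfrak p)$ such that $w=q^X$ lies in $V\otimes\mathcal V(\mathfrak p)$. Moreover, if $\mathfrak p$ is compatible with the $\operatorname{ad}x$-eigenspace decomposition (so that weights are defined), then $X$ and $w$ are homogeneous, of weights $0$ and $1$ respectively. (b) Assume that $\mathfrak p$ is compatible with the $\operatorname{ad}x$-eigenspace decomposition. Let $(v^j)_{j\in P}$ be a basis of $\mathfrak m^\perp$ consisting of $\operatorname{ad}x$-eigenvectors such that, for some $J\subset P$, $(v^j)_{j\in J}$ is a basis of $V$ and $(v^j)_{j\in P\setminus J}$ is a basis of $[f,\mathfrak n]$, and let $(v_j)_{j\in P}$ be the $\kappa$-dual basis of $\mathfrak p$. Then $(v_j)_{j\in J}$ is a basis of $\mathfrak g^f=\operatorname{Ker}(\operatorname{ad}f)$ and, writing $w=\sum_{j\in J}v^j\otimes w_j$, each $w_j\in\mathcal V(\mathfrak p)$ is homogeneous of conformal weight $1+\delta_x(v^j)$ and $w_j=v_j+g_j$, where $g_j\in\mathcal V(\mathfrak p)\{1+\delta_x(v^j)\}$ is a linear combination of monomials $b_1^{(m_1)}\cdots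 b_s^{(m_s)}$, $b_k\in\mathfrak p$, with $s+m_1+\dots+m_s>1$. (c) Let $r=\dim\operatorname{Ker}(\operatorname{ad}f)$. Then $\dim V=r$ and, for every basis $b_1,\dots,b_r$ of $V$, writing $w=\sum_{j=1}^r b_j\otimes w_j$ (in particular for the basis and the $w_j$ of (b)), the differential algebra $\mathcal W$ is the algebra of differential polynomials in $w_1,\dots,w_r$: the elements $\partial^n w_j$ ($1\le j\le r$, $n\ge0$) are algebraically independent over $\mathbb F$ and generate $\mathcal W$ as a unital algebra. -/

import Mathlib

open scoped TensorProduct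

namespace ClassicalW

noncomputable section

/-! ### Algebras of differential polynomials -/

section DiffPoly

/-- The algebra of differential polynomials `F[u_i^{(n)} | i ∈ I, n ≥ 0]` over `F`; the variable
`u_i^{(n)}` is `MvPolynomial.X (i, n)`. When the `u_i` are a basis of a vector space `M`, this is
`S(F[∂]M)`. -/
abbrev DP (F I : Type*) [CommSemiring F] : Type _ := MvPolynomial (I × ℕ) F

variable (F : Type*) [Field F] (I : Type*)

/-- The derivation `∂` of the algebra of differential polynomials, `∂ u_i^{(n)} = u_i^{(n+1)}`. -/
def der : Derivation F (DP F I) (DP F I) :=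
  MvPolynomial.mkDerivation F fun k : I × ℕ => MvPolynomial.X (k.1, k.2 + 1)

variable {F I} {J : Type*} {M : Type*} [AddCommGroup M] [Module F M]

/-- The inclusion of `M` as the space of generators of `S(F[∂]M)`, where `u` is a basis of `M`. -/
def gen (u : Module.Basis I F M) : M →ₗ[F] DP F I :=
  u.constr F fun i => (MvPolynomial.X (i, 0) : DP F I)

/-- The differential algebra homomorphism with `u_i^{(n)} ↦ ∂^n (a_i)`. -/
def diffEval (a : I → DP F J) : DP F I →ₐ[F] DP F J :=
  MvPolynomial.aeval fun k : I × ℕ => (der F J)^[k.2] (a k.1)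

/-- The map `V[λ] → V[λ]` acting on coefficients by `∂`. -/
def derCoeff : Polynomial (DP F I) →ₗ[F] Polynomial (DP F I) where
  toFun φ := φ.sum fun n c => Polynomial.monomial n (der F I c)
  map_add' φ ψ := Polynomial.sum_add_index φ ψ _ (by simp) (by simp)
  map_smul' r φ := by
    ext1 k
    have key : ∀ χ : Polynomial (DP F I),
        (χ.sum fun n c => Polynomial.monomial n (der F I c)).coeff k = der F I (χ.coeff k) := by
      intro χ
      rw [Polynomial.sum_def, Polynomial.finsetSum_coeff]
      simp only [Polynomial.coeff_monomial]
      rw [Finset.sum_ite_eq']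
      split_ifs with h
      · rfl
      · rw [Polynomial.notMem_support_iff.mp h, map_zero]
    rw [key, RingHom.id_apply, Polynomial.coeff_smul, Polynomial.coeff_smul, key,
      Derivation.map_smul]

/-- The operator `λ + ∂` on `V[λ]`. -/
def lamDer : Module.End F (Polynomial (DP F I)) :=
  LinearMap.mulLeft F (Polynomial.X : Polynomial (DP F I)) + derCoeff

/-- `H(λ + ∂) φ`, with `∂` acting to the right: if `H(λ) = ∑_k c_k λ^k`, it is
`∑_k c_k (λ + ∂)^k φ`. -/
def applyLamDer (H φ : Polynomial (DP F I)) : Polynomial (DP F I) :=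
  H.sum fun k c => Polynomial.C c * (lamDer ^ k) φ

/-- The `λ`-bracket `{f_λ g}` on `V` given by the Master Formula
`∑ (∂g/∂u_j^{(n)}) (λ+∂)^n H_{ji}(λ+∂) (-λ-∂)^m (∂f/∂u_i^{(m)})`, where `H j i = {u_i _λ u_j}`.
The sums run over the variables which occur in `g` and in `f`; the other terms are zero. -/
def masterBracket (H : I → I → Polynomial (DP F I)) (f g : DP F I) : Polynomial (DP F I) :=
  ∑ y ∈ g.vars, ∑ k ∈ f.vars,
    Polynomial.C (MvPolynomial.pderiv y g) *
      (lamDer ^ y.2) (applyLamDer (H y.1 k.1)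
        (((-lamDer : Module.End F (Polynomial (DP F I))) ^ k.2)
          (Polynomial.C (MvPolynomial.pderiv k f))))

end DiffPoly

section Lie

variable {F : Type*} [Field F] {𝔤 : Type*} [LieRing 𝔤] [LieAlgebra F 𝔤]

/-! ### The grading of the Lie algebra, and the subalgebras `m` and `n` -/

/-- `𝔤_i`, the eigenspace of `ad x` with eigenvalue `i`. -/
def gr (x : 𝔤) (i : ℚ) : Submodule F 𝔤 := Module.End.eigenspace (LieAlgebra.ad F 𝔤 x) (i : F)

/-- `𝔤_{≥ 1}` -/
def grGeOne (x : 𝔤) : Submodule F 𝔤 := ⨆ (i : ℚ) (_ : 1 ≤ i), gr x i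

/-- `𝔤_{≤ 1/2}` -/
def grLeHalf (x : 𝔤) : Submodule F 𝔤 := ⨆ (i : ℚ) (_ : i ≤ 1 / 2), gr x i

/-- A subspace compatible with the `ad x`-eigenspace decomposition: `U = ⨁_i (U ∩ 𝔤_i)`. -/
def IsGraded (x : 𝔤) (U : Submodule F 𝔤) : Prop := U = ⨆ i : ℚ, U ⊓ gr x i

/-- The form `ω(a, b) = κ(f | [a, b])`. -/
def omega (κ : LinearMap.BilinForm F 𝔤) (f a b : 𝔤) : F := κ f ⁅a, b⁆

/-- The symplectic complement `l^{⊥ω}` of `l` in `𝔤_{1/2}`. -/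
def symplCompl (κ : LinearMap.BilinForm F 𝔤) (f x : 𝔤) (l : Submodule F 𝔤) : Submodule F 𝔤 where
  carrier := {a | a ∈ gr (F := F) x (1 / 2) ∧ ∀ b ∈ l, omega κ f a b = 0}
  add_mem' := by
    rintro a b ⟨ha, ha'⟩ ⟨hb, hb'⟩
    refine ⟨add_mem ha hb, fun c hc => ?_⟩
    have h1 := ha' c hc
    have h2 := hb' c hc
    simp only [omega] at h1 h2 ⊢
    rw [add_lie, map_add, h1, h2, add_zero]
  zero_mem' := ⟨zero_mem _, fun c _ => by simp [omega]⟩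
  smul_mem' := by
    rintro r a ⟨ha, ha'⟩
    refine ⟨Submodule.smul_mem _ r ha, fun c hc => ?_⟩
    have h1 := ha' c hc
    simp only [omega] at h1 ⊢
    rw [smul_lie, map_smul, h1, smul_zero]

/-- `m = l ⊕ 𝔤_{≥ 1}` -/
def subM (x : 𝔤) (l : Submodule F 𝔤) : Submodule F 𝔤 := l ⊔ grGeOne x

/-- `n = l^{⊥ω} ⊕ 𝔤_{≥ 1}` -/
def subN (κ : LinearMap.BilinForm F 𝔤) (f x : 𝔤) (l : Submodule F 𝔤) : Submodule F 𝔤 :=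
  symplCompl κ f x l ⊔ grGeOne x

/-- `m^⊥`, the orthogonal complement of `m` with respect to `κ`. -/
def mPerp (κ : LinearMap.BilinForm F 𝔤) (x : 𝔤) (l : Submodule F 𝔤) : Submodule F 𝔤 :=
  κ.orthogonal (subM x l)

/-- `[f, n]` -/
def lieFN (κ : LinearMap.BilinForm F 𝔤) (f x : 𝔤) (l : Submodule F 𝔤) : Submodule F 𝔤 :=
  (subN κ f x l).map (LieAlgebra.ad F 𝔤 f)

/-! ### The affine Poisson vertex algebra and the classical `W`-algebra -/

/-- The affine `λ`-bracket `{· _λ ·}_z` on `V(𝔤) = S(F[∂]𝔤)`, where `u` is a basis of `𝔤`: it is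
determined by `{a_λ b}_z = [a, b] + κ(a | b) λ + z κ(s | [a, b])` for `a, b ∈ 𝔤`. -/
def affineBracket {I : Type*} (κ : LinearMap.BilinForm F 𝔤) (s : 𝔤) (z : F)
    (u : Module.Basis I F 𝔤) : DP F I → DP F I → Polynomial (DP F I) :=
  masterBracket fun j i =>
    Polynomial.C (gen u ⁅u i, u j⁆)
      + Polynomial.C (algebraMap F (DP F I) (κ (u i) (u j))) * Polynomial.X
      + Polynomial.C (algebraMap F (DP F I) (z * κ s ⁅u i, u j⁆))

/-- The inclusion of differential algebras `V(p) ⊆ V(𝔤)`, for a basis `q` of `p` and a basis `u`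
of `𝔤`. -/
def inclV {I P : Type*} {p : Submodule F 𝔤} (u : Module.Basis I F 𝔤) (q : Module.Basis P F p) :
    DP F P →ₐ[F] DP F I :=
  diffEval fun i => gen u (q i : 𝔤)

/-- The differential algebra homomorphism `ρ : V(𝔤) → V(p)` with `ρ(a) = π_p(a) + κ(f | a)` for
`a ∈ 𝔤`, where `π_p` is the projection on `p` with kernel `m`. -/
def rho {I P : Type*} {m p : Submodule F 𝔤} (κ : LinearMap.BilinForm F 𝔤) (f : 𝔤)
    (hmp : IsCompl m p) (u : Module.Basis I F 𝔤) (q : Module.Basis P F p) :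
    DP F I →ₐ[F] DP F P :=
  diffEval fun i => gen q (p.projectionOnto m hmp.symm (u i))
    + algebraMap F (DP F P) (κ f (u i))

/-- The classical `W`-algebra
`W = {g ∈ V(p) | ρ {a_λ g}_z = 0 for all a ∈ n}`, as a subset of the differential algebra `V(p)`. -/
def walg {I P : Type*} {p : Submodule F 𝔤} (κ : LinearMap.BilinForm F 𝔤) (f x : 𝔤)
    (l : Submodule F 𝔤) (s : 𝔤) (z : F) (hmp : IsCompl (subM x l) p)
    (u : Module.Basis I F 𝔤) (q : Module.Basis P F p) : Set (DP F P) :=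
  {g | ∀ a ∈ subN κ f x l,
    (affineBracket κ s z u (gen u a) (inclV u q g)).map (rho κ f hmp u q).toRingHom = 0}

/-! ### The Lie algebra `F∂ ⋉ (𝔤 ⊗ V)` and gauge transformations

The tensor product `𝔤 ⊗ V` is written as `V ⊗ 𝔤`, with Mathlib's bracket
`[g ⊗ a, h ⊗ b] = gh ⊗ [a, b]`. -/

section Gauge

variable (F 𝔤) (P : Type*)

attribute [local instance 100] LieRing.ofAssociativeRing

/-- The derivation `∂ (g ⊗ a) = (∂ g) ⊗ a` of the Lie algebra `V ⊗ 𝔤`. -/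
def derLie : LieDerivation F (DP F P ⊗[F] 𝔤) (DP F P ⊗[F] 𝔤) where
  toLinearMap := LinearMap.rTensor 𝔤 (der F P).toLinearMap
  leibniz' y y' := by
    induction y with
    | zero => simp
    | add a b ha hb =>
      rw [add_lie, map_add, map_add, ha, hb, add_lie, lie_add]
      abel
    | tmul g a =>
      induction y' with
      | zero => simp
      | add c d hc hd =>
        rw [lie_add, map_add, map_add, hc, hd, add_lie, lie_add]
        abel
      | tmul h b =>
        simp only [LieAlgebra.ExtendScalars.bracket_tmul, LinearMap.rTensor_tmul,
          Derivation.coeFn_coe, Derivation.leibniz, smul_eq_mul]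
        rw [← lie_skew b a, TensorProduct.tmul_neg, sub_neg_eq_add, TensorProduct.add_tmul]

/-- The action `c∂ ↦ c • derLie` of the one-dimensional Lie algebra `F∂` on `V ⊗ 𝔤`. -/
def derAction : F →ₗ⁅F⁆ LieDerivation F (DP F P ⊗[F] 𝔤) (DP F P ⊗[F] 𝔤) where
  toFun c := c • derLie F 𝔤 P
  map_add' a b := add_smul a b _
  map_smul' a b := by simp [mul_smul]
  map_lie' {a b} := by
    have h : ⁅a, b⁆ = (0 : F) := by rw [Ring.lie_def, mul_comm, sub_self]
    rw [h, zero_smul, smul_lie, lie_smul, lie_self, smul_zero, smul_zero]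

/-- The semidirect product Lie algebra `F∂ ⋉ (𝔤 ⊗ V)`; the element `c∂ + y` is `⟨y, c⟩`. -/
abbrev SD : Type _ := LieAlgebra.SemiDirectSum (DP F P ⊗[F] 𝔤) F (derAction F 𝔤 P)

variable {F 𝔤 P}

/-- `e^{ad A} Y = ∑_k (1/k!) (ad A)^k Y`, for `ad A` nilpotent. -/
def expAd (A Y : SD F 𝔤 P) : SD F 𝔤 P :=
  ∑ k ∈ Finset.range (nilpotencyClass (LieAlgebra.ad F (SD F 𝔤 P) A)),
    ((k.factorial : F)⁻¹) • ((LieAlgebra.ad F (SD F 𝔤 P) A) ^ k) Y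

/-- The gauge transform `q^A`, defined by `e^{ad A} (∂ + q + f ⊗ 1) = ∂ + q^A + f ⊗ 1`. -/
def gaugeTransform (f : 𝔤) (A q : DP F P ⊗[F] 𝔤) : DP F P ⊗[F] 𝔤 :=
  (expAd (⟨A, 0⟩ : SD F 𝔤 P) ⟨q + 1 ⊗ₜ[F] f, 1⟩).left - 1 ⊗ₜ[F] f

end Gauge

/-! ### Gradings -/

/-- The conformal weight space `V(p){d}`: the span of the monomials `a_1^{(m_1)} ⋯ a_s^{(m_s)}`
with `a_k ∈ p` homogeneous of `ad x`-eigenvalue `ε_k`, and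
`s - ε_1 - ⋯ - ε_s + m_1 + ⋯ + m_s = d`. -/
def confWt {P : Type*} {p : Submodule F 𝔤} (x : 𝔤) (q : Module.Basis P F p) (d : ℚ) :
    Submodule F (DP F P) :=
  Submodule.span F {g | ∃ (s : ℕ) (a : Fin s → p) (ε : Fin s → ℚ) (m : Fin s → ℕ),
    (∀ k, (a k : 𝔤) ∈ gr (F := F) x (ε k)) ∧
    (s : ℚ) - ∑ k, ε k + ∑ k, (m k : ℚ) = d ∧
    g = ∏ k, (der F P)^[m k] (gen q (a k))}

/-- The span of the monomials `b_1^{(m_1)} ⋯ b_s^{(m_s)}` with `b_k ∈ p` and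
`s + m_1 + ⋯ + m_s > 1`. -/
def higherTerms {P : Type*} {p : Submodule F 𝔤} (q : Module.Basis P F p) :
    Submodule F (DP F P) :=
  Submodule.span F {g | ∃ (s : ℕ) (b : Fin s → p) (m : Fin s → ℕ),
    1 < s + ∑ k, m k ∧ g = ∏ k, (der F P)^[m k] (gen q (b k))}

/-- The weight space `(𝔤 ⊗ V(p)){i} = ⨁_j 𝔤_j ⊗ V(p){i + j}`. -/
def wtSpace {P : Type*} {p : Submodule F 𝔤} (x : 𝔤) (q : Module.Basis P F p) (i : ℚ) :
    Submodule F (DP F P ⊗[F] 𝔤) :=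
  ⨆ j : ℚ, Submodule.map₂ (TensorProduct.mk F (DP F P) 𝔤) (confWt x q (i + j)) (gr x j)

end Lie

end

end ClassicalW

/-!
Gauge transformations by `n ⊗ R` are studied over an arbitrary commutative differential algebra `R`;
this is what makes the `W`-algebra accessible, since its elements are exactly the differential
polynomials that do not change under infinitesimal gauge transformations.

*Gauge fixing.* For `𝔤_{≥ k/2}`, with `k` increasing, the gauge transform `q^X` depends on `X` through
`[X, f]` up to terms of higher degree (`GaugeSlice.transform_sub_mem`). As `ad f` is injective on `n`
and `V` is a complement of `[f, n]` in `m^⊥`, the condition `q^X ∈ V ⊗ R` is a fixed point equation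
`X = X + θ(q^X)`, where `θ` inverts `ad f` on `[f, n]` and kills `V`; the right-hand side is a
contraction for this finite filtration. This gives existence and uniqueness
(`GaugeSlice.exists_transform_mem`, `GaugeSlice.eq_of_transform_mem`). Because `X` is obtained from
`0` by iterating one map, it inherits every property which that map preserves: weight `0`, and the
vanishing of the constant terms. Modulo higher terms `w = q + [X, f]`, and the vectors dual to a basis
of `V` are orthogonal to `[f, n]`, whence the linear terms of the `w_j`.

*The centralizer of `f`.* The orthogonal complement of `[f, n]` is `m ⊕ 𝔤^f`
(`Setting.orthogonal_lieFN`), from the semisimplicity of `ad x` and the injectivity of `ad f` on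
`𝔤_{> 0}`, both proved for representations of `sl₂`. It gives `dim V = dim 𝔤^f` and the dual basis.

*The `W`-algebra.* The operator `ρ{a_∂ g} φ` is minus the first variation of `g` at `q` along the
infinitesimal gauge transformation by `φ ⊗ a` (`symb_bracket`), and a differential operator that
vanishes on `V(p)` is zero (`eq_zero_of_symb`).

* The components of `w` belong to `W`: a gauge transformation of `q` moves `w = q^X` by a gauge
  transformation (`GaugeSlice.tensDer_transform`, a flatness argument). As the variation of `w` stays
  in `V ⊗ R`, infinitesimal uniqueness shows that it vanishes.
* They generate `W`: for `g ∈ W`, the derivative in `t` of `g(q^{tX})` vanishes, so that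
  `g(q) = g(q^X) = g(w)` is a differential polynomial in the `w_j` (`eq_diffHom_of_mem_walg`).
* They are independent: restricting differential polynomials from `m^⊥` to `V` sends `q` to an element
  that already lies in `V`; its gauge-fixing `X` is `0` by uniqueness, so that the `w_j` go to the
  coordinates of `V` (`walg_generators`).
-/

namespace ClassicalW

noncomputable section

set_option linter.unusedSectionVars false

/-! ### Gauge transformations in a Lie algebra with a derivation -/

section GaugeLie

variable {F : Type*} [Field F] {L : Type*} [LieRing L] [LieAlgebra F L]

/-- The gauge transform of the connection `δ + W` by `X`: if `(ad X)^N = 0`, then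
`e^{ad X} (δ + W) = δ + gauge N δ X W`. The exponential series is truncated at a fixed order `N`,
so that the expression is visibly natural in `L`. -/
def gauge (N : ℕ) (δ : LieDerivation F L L) (X W : L) : L :=
  W + ∑ k ∈ Finset.range N,
    ((k + 1).factorial : F)⁻¹ • ((LieAlgebra.ad F L X) ^ k) (⁅X, W⁆ - δ X)

variable {K : Type*} [LieRing K] [LieAlgebra F K] (ψ : K →ₗ⁅F⁆ LieDerivation F L L)

lemma ad_pow_succ_semiDirect (X W : L) (c : K) (k : ℕ) :
    ((LieAlgebra.ad F (LieAlgebra.SemiDirectSum L K ψ) ⟨X, 0⟩) ^ (k + 1)) ⟨W, c⟩ =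
      ⟨((LieAlgebra.ad F L X) ^ k) (⁅X, W⁆ - ψ c X), 0⟩ := by
  induction k with
  | zero => simp
  | succ k ih =>
    rw [pow_succ', Module.End.mul_apply, ih, pow_succ', Module.End.mul_apply]
    simp

lemma ad_pow_semiDirect_eq_zero {X : L} {N : ℕ} (hX : (LieAlgebra.ad F L X) ^ N = 0) :
    (LieAlgebra.ad F (LieAlgebra.SemiDirectSum L K ψ) ⟨X, 0⟩) ^ (N + 1) = 0 := by
  ext1 y
  obtain ⟨W, c⟩ := y
  rw [ad_pow_succ_semiDirect, hX]
  simp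

lemma sum_left (ι : Type*) (s : Finset ι) (g : ι → LieAlgebra.SemiDirectSum L K ψ) :
    (∑ i ∈ s, g i).left = ∑ i ∈ s, (g i).left :=
  map_sum (LieAlgebra.SemiDirectSum.projl ψ) g s

lemma sum_right (ι : Type*) (s : Finset ι) (g : ι → LieAlgebra.SemiDirectSum L K ψ) :
    (∑ i ∈ s, g i).right = ∑ i ∈ s, (g i).right :=
  map_sum (LieAlgebra.SemiDirectSum.projr ψ) g s

lemma exp_sum_semiDirect (N : ℕ) (X W : L) (c : K) :
    ∑ k ∈ Finset.range (N + 1), ((k.factorial : F)⁻¹) •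
        ((LieAlgebra.ad F (LieAlgebra.SemiDirectSum L K ψ) ⟨X, 0⟩) ^ k) ⟨W, c⟩ =
      ⟨gauge N (ψ c) X W, c⟩ := by
  rw [Finset.sum_range_succ']
  simp only [ad_pow_succ_semiDirect]
  ext
  · simp [sum_left, gauge, add_comm]
  · simp [sum_right]

/-- A sum of the exponential series up to the nilpotency class may be extended to any order at
which the operator vanishes. -/
lemma sum_range_nilpotencyClass {M : Type*} [AddCommGroup M] [Module F M] {a : Module.End F M}
    {n : ℕ} (h : a ^ n = 0) (y : M) :
    ∑ k ∈ Finset.range (nilpotencyClass a), ((k.factorial : F)⁻¹) • (a ^ k) y =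
      ∑ k ∈ Finset.range n, ((k.factorial : F)⁻¹) • (a ^ k) y := by
  have hle : nilpotencyClass a ≤ n := csInf_le' h
  refine Finset.sum_subset (Finset.range_mono hle) fun k _ hk => ?_
  rw [pow_eq_zero_of_le (by simpa using hk) (pow_nilpotencyClass ⟨n, h⟩)]
  simp

lemma map_gauge {L' : Type*} [LieRing L'] [LieAlgebra F L'] (σ : L →ₗ⁅F⁆ L')
    {δ : LieDerivation F L L} {δ' : LieDerivation F L' L'} (h : ∀ y, σ (δ y) = δ' (σ y))
    (N : ℕ) (X W : L) : σ (gauge N δ X W) = gauge N δ' (σ X) (σ W) := by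
  have hp : ∀ (k : ℕ) (y : L), σ (((LieAlgebra.ad F L X) ^ k) y) =
      ((LieAlgebra.ad F L' (σ X)) ^ k) (σ y) := by
    intro k
    induction k with
    | zero => simp
    | succ k ih =>
      intro y
      rw [pow_succ, Module.End.mul_apply, ih, pow_succ, Module.End.mul_apply]
      simp
  simp [gauge, hp, h]

variable [CharZero F]

/-- The exponential of a nilpotent inner derivation preserves brackets. -/
lemma exp_sum_lie {A : L} {n : ℕ} (hA : (LieAlgebra.ad F L A) ^ n = 0) (y z : L) :
    ∑ k ∈ Finset.range n, ((k.factorial : F)⁻¹) • ((LieAlgebra.ad F L A) ^ k) ⁅y, z⁆ =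
      ⁅∑ k ∈ Finset.range n, ((k.factorial : F)⁻¹) • ((LieAlgebra.ad F L A) ^ k) y,
        ∑ k ∈ Finset.range n, ((k.factorial : F)⁻¹) • ((LieAlgebra.ad F L A) ^ k) z⁆ := by
  let _ : Module ℚ L := Module.compHom L (algebraMap ℚ F)
  have hs : ∀ (r : ℚ) (m : L), r • m = (r : F) • m := fun r m => rfl
  let _ : LieAlgebra ℚ L := { lie_smul := fun t x m => by rw [hs, hs, lie_smul] }
  let D : LieDerivation F L L := LieDerivation.inner F L L (-A)
  have hD : D.toLinearMap = LieAlgebra.ad F L A := by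
    ext y
    simp [D]
  have hn : IsNilpotent D.toLinearMap := ⟨n, by rw [hD]; exact hA⟩
  have key : ∀ y, LieDerivation.exp D hn y =
      ∑ k ∈ Finset.range n, ((k.factorial : F)⁻¹) • ((LieAlgebra.ad F L A) ^ k) y := by
    intro y
    rw [LieDerivation.exp_map_apply, IsNilpotent.exp_eq_sum (k := n) (by rw [hD]; exact hA), hD,
      LinearMap.sum_apply]
    refine Finset.sum_congr rfl fun k _ => ?_
    rw [LinearMap.smul_apply, hs]
    simp
  rw [← key, ← key, ← key, LieEquiv.map_lie]

/-- Gauge transformations preserve flatness: if the connections `δ + W` and `D + W'` along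
commuting derivations `δ` and `D` commute, then so do their gauge transforms by `X`. -/
lemma gauge_flat {N : ℕ} {X : L} (hX : (LieAlgebra.ad F L X) ^ N = 0) {δ D : LieDerivation F L L}
    (hcomm : ∀ y, δ (D y) = D (δ y)) {W W' : L} (hflat : δ W' - D W + ⁅W, W'⁆ = 0) :
    δ (gauge N D X W') - D (gauge N δ X W) + ⁅gauge N δ X W, gauge N D X W'⁆ = 0 := by
  let ψ : LieDerivation F L L →ₗ⁅F⁆ LieDerivation F L L := LieHom.id
  let a : LieAlgebra.SemiDirectSum L (LieDerivation F L L) ψ := ⟨W, δ⟩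
  let b : LieAlgebra.SemiDirectSum L (LieDerivation F L L) ψ := ⟨W', D⟩
  have hc : ⁅δ, D⁆ = 0 := by
    ext y
    simp [hcomm]
  have h0 : ⁅a, b⁆ = 0 := by
    ext
    · change ⁅W, W'⁆ + δ W' - D W = 0
      rw [← hflat]; abel
    · change ⁅δ, D⁆ _ = 0
      rw [hc]; rfl
  have h := exp_sum_lie (ad_pow_semiDirect_eq_zero ψ hX) a b
  simp only [h0, map_zero, smul_zero, Finset.sum_const_zero] at h
  simp only [a, b, exp_sum_semiDirect] at h
  have h1 := congrArg LieAlgebra.SemiDirectSum.left h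
  change 0 = ⁅gauge N δ X W, gauge N D X W'⁆ + δ (gauge N D X W') - D (gauge N δ X W) at h1
  rw [h1]; abel

end GaugeLie

/-! ### Extension of scalars -/

section Tens

variable {F : Type*} [Field F] {𝔤 : Type*} [LieRing 𝔤] [LieAlgebra F 𝔤]
  {R : Type*} [CommRing R] [Algebra F R]

/-- The subspace `I ⊗ U` of `R ⊗ 𝔤`. -/
def tens (I : Submodule F R) (U : Submodule F 𝔤) : Submodule F (R ⊗[F] 𝔤) :=
  Submodule.map₂ (TensorProduct.mk F R 𝔤) I U

lemma tmul_mem_tens {I : Submodule F R} {U : Submodule F 𝔤} {r : R} {a : 𝔤} (hr : r ∈ I)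
    (ha : a ∈ U) : r ⊗ₜ[F] a ∈ tens I U :=
  Submodule.apply_mem_map₂ _ hr ha

lemma tens_le {I : Submodule F R} {U : Submodule F 𝔤} {S : Submodule F (R ⊗[F] 𝔤)} :
    tens I U ≤ S ↔ ∀ r ∈ I, ∀ a ∈ U, r ⊗ₜ[F] a ∈ S :=
  Submodule.map₂_le

lemma tens_mono {I I' : Submodule F R} {U U' : Submodule F 𝔤} (h : I ≤ I') (h' : U ≤ U') :
    tens I U ≤ tens I' U' :=
  Submodule.map₂_le_map₂ h h'

lemma tens_top_top : tens (⊤ : Submodule F R) (⊤ : Submodule F 𝔤) = ⊤ := by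
  rw [eq_top_iff, ← TensorProduct.span_tmul_eq_top, Submodule.span_le]
  rintro _ ⟨r, a, rfl⟩
  exact tmul_mem_tens Submodule.mem_top Submodule.mem_top

lemma tens_bot (I : Submodule F R) : tens I (⊥ : Submodule F 𝔤) = ⊥ :=
  Submodule.map₂_bot_right _ _

lemma tens_induction {I : Submodule F R} {U : Submodule F 𝔤} {p : R ⊗[F] 𝔤 → Prop}
    (tmul : ∀ r ∈ I, ∀ a ∈ U, p (r ⊗ₜ a)) (zero : p 0) (add : ∀ y z, p y → p z → p (y + z))
    {y : R ⊗[F] 𝔤} (hy : y ∈ tens I U) : p y := by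
  rw [tens, Submodule.map₂_eq_span_image2] at hy
  induction hy using Submodule.closure_induction with
  | zero => exact zero
  | add y z _ _ hy hz => exact add y z hy hz
  | smul_mem c y hy =>
    obtain ⟨r, hr, a, ha, rfl⟩ := hy
    exact tmul (c • r) (I.smul_mem c hr) a ha

lemma mem_baseChange_iff {U : Submodule F 𝔤} {y : R ⊗[F] 𝔤} :
    y ∈ U.baseChange R ↔ y ∈ tens ⊤ U := by
  constructor
  · intro h
    rw [Submodule.baseChange_eq_span] at h
    induction h using Submodule.span_induction with
    | mem y hy =>
      obtain ⟨a, ha, rfl⟩ := hy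
      exact tmul_mem_tens Submodule.mem_top ha
    | zero => exact zero_mem _
    | add y z _ _ hy hz => exact add_mem hy hz
    | smul r y _ hy =>
      have : tens ⊤ U ≤ (tens ⊤ U).comap
          (LinearMap.restrictScalars F (LinearMap.lsmul R (R ⊗[F] 𝔤) r)) := by
        rw [tens_le]
        intro s _ a ha
        simpa [TensorProduct.smul_tmul'] using tmul_mem_tens Submodule.mem_top ha
      exact this hy
  · intro h
    have : tens ⊤ U ≤ (U.baseChange R).restrictScalars F :=
      tens_le.2 fun r _ a ha => Submodule.tmul_mem_baseChange_of_mem r ha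
    exact this h

lemma lie_mem_tens {I I' I'' : Submodule F R} {U U' U'' : Submodule F 𝔤}
    (hI : ∀ r ∈ I, ∀ s ∈ I', r * s ∈ I'') (hU : ∀ a ∈ U, ∀ b ∈ U', ⁅a, b⁆ ∈ U'')
    {y z : R ⊗[F] 𝔤} (hy : y ∈ tens I U) (hz : z ∈ tens I' U') : ⁅y, z⁆ ∈ tens I'' U'' := by
  have h1 : tens I U ≤ (tens I'' U'').comap ((LieModule.toEnd F (R ⊗[F] 𝔤) (R ⊗[F] 𝔤) :
      (R ⊗[F] 𝔤) →ₗ[F] Module.End F (R ⊗[F] 𝔤)).flip z) := by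
    rw [tens_le]
    intro r hr a ha
    have h2 : tens I' U' ≤ (tens I'' U'').comap
        (LieModule.toEnd F (R ⊗[F] 𝔤) (R ⊗[F] 𝔤) (r ⊗ₜ a)) := by
      rw [tens_le]
      intro s hs b hb
      exact tmul_mem_tens (hI r hr s hs) (hU a ha b hb)
    exact h2 hz
  exact h1 hy

lemma map_mem_tens {R' 𝔤' : Type*} [CommRing R'] [Algebra F R'] [LieRing 𝔤'] [LieAlgebra F 𝔤']
    {I : Submodule F R} {U : Submodule F 𝔤} {I' : Submodule F R'} {U' : Submodule F 𝔤'}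
    {φ : R →ₗ[F] R'} {θ : 𝔤 →ₗ[F] 𝔤'} (hφ : ∀ r ∈ I, φ r ∈ I') (hθ : ∀ a ∈ U, θ a ∈ U')
    {y : R ⊗[F] 𝔤} (hy : y ∈ tens I U) : TensorProduct.map φ θ y ∈ tens I' U' := by
  have h : tens I U ≤ (tens I' U').comap (TensorProduct.map φ θ) :=
    tens_le.2 fun r hr a ha => tmul_mem_tens (hφ r hr) (hθ a ha)
  exact h hy

lemma rTensor_mem_tens {R' : Type*} [CommRing R'] [Algebra F R'] {I : Submodule F R}
    {U : Submodule F 𝔤} {I' : Submodule F R'} {φ : R →ₗ[F] R'} (hφ : ∀ r ∈ I, φ r ∈ I')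
    {y : R ⊗[F] 𝔤} (hy : y ∈ tens I U) : LinearMap.rTensor 𝔤 φ y ∈ tens I' U :=
  map_mem_tens (θ := LinearMap.id) hφ (fun _ h => h) hy

lemma lTensor_mem_tens {I : Submodule F R} {U U' : Submodule F 𝔤} {θ : 𝔤 →ₗ[F] 𝔤}
    (hθ : ∀ a ∈ U, θ a ∈ U') {y : R ⊗[F] 𝔤} (hy : y ∈ tens I U) :
    LinearMap.lTensor R θ y ∈ tens I U' :=
  map_mem_tens (φ := LinearMap.id) (fun _ h => h) hθ hy

/-- Two linear maps which agree on `r ⊗ a`, for `a ∈ U`, agree on `R ⊗ U`. -/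
lemma eqOn_tens {M : Type*} [AddCommGroup M] [Module F M] {I : Submodule F R}
    {U : Submodule F 𝔤} {φ θ : R ⊗[F] 𝔤 →ₗ[F] M}
    (h : ∀ r ∈ I, ∀ a ∈ U, φ (r ⊗ₜ a) = θ (r ⊗ₜ a)) {y : R ⊗[F] 𝔤} (hy : y ∈ tens I U) :
    φ y = θ y := by
  have : tens I U ≤ LinearMap.eqLocus φ θ := tens_le.2 fun r hr a ha => h r hr a ha
  exact this hy

variable (𝔤) in
/-- The derivation `d ⊗ id` of the Lie algebra `R ⊗ 𝔤`, for a derivation `d` of `R`. -/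
def tensDer (d : Derivation F R R) : LieDerivation F (R ⊗[F] 𝔤) (R ⊗[F] 𝔤) where
  toLinearMap := LinearMap.rTensor 𝔤 d.toLinearMap
  leibniz' y y' := by
    induction y with
    | zero => simp
    | add a b ha hb =>
      rw [add_lie, map_add, map_add, ha, hb, add_lie, lie_add]
      abel
    | tmul g a =>
      induction y' with
      | zero => simp
      | add c d hc hd =>
        rw [lie_add, map_add, map_add, hc, hd, add_lie, lie_add]
        abel
      | tmul h b =>
        simp only [LieAlgebra.ExtendScalars.bracket_tmul, LinearMap.rTensor_tmul,
          Derivation.coeFn_coe, Derivation.leibniz, smul_eq_mul]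
        rw [← lie_skew b a, TensorProduct.tmul_neg, sub_neg_eq_add, TensorProduct.add_tmul]

@[simp]
lemma tensDer_tmul (d : Derivation F R R) (r : R) (a : 𝔤) :
    tensDer 𝔤 d (r ⊗ₜ a) = d r ⊗ₜ a := rfl

lemma tensDer_mem_tens {d : Derivation F R R} {I I' : Submodule F R} {U : Submodule F 𝔤}
    (h : ∀ r ∈ I, d r ∈ I') {y : R ⊗[F] 𝔤} (hy : y ∈ tens I U) : tensDer 𝔤 d y ∈ tens I' U :=
  rTensor_mem_tens (φ := d.toLinearMap) h hy

variable {R' : Type*} [CommRing R'] [Algebra F R']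

variable (𝔤) in
/-- The homomorphism `R ⊗ 𝔤 → R' ⊗ 𝔤` of Lie algebras over `F` given by an algebra homomorphism
`R → R'`. -/
def tensMap (σ : R →ₐ[F] R') : R ⊗[F] 𝔤 →ₗ⁅F⁆ R' ⊗[F] 𝔤 where
  toLinearMap := LinearMap.rTensor 𝔤 σ.toLinearMap
  map_lie' {y z} := by
    induction y with
    | zero => simp
    | add a b ha hb => simp_all [add_lie]
    | tmul g a =>
      induction z with
      | zero => simp
      | add c d hc hd => simp_all [lie_add]
      | tmul h b => simp

@[simp]
lemma tensMap_tmul (σ : R →ₐ[F] R') (r : R) (a : 𝔤) :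
    tensMap 𝔤 σ (r ⊗ₜ a) = σ r ⊗ₜ a := rfl

lemma tensMap_mem_tens (σ : R →ₐ[F] R') {U : Submodule F 𝔤} {y : R ⊗[F] 𝔤}
    (hy : y ∈ tens ⊤ U) : tensMap 𝔤 σ y ∈ tens ⊤ U :=
  rTensor_mem_tens (φ := σ.toLinearMap) (fun _ _ => Submodule.mem_top) hy

lemma tensMap_tensDer {σ : R →ₐ[F] R'} {d : Derivation F R R} {d' : Derivation F R' R'}
    (h : ∀ r, σ (d r) = d' (σ r)) (y : R ⊗[F] 𝔤) :
    tensMap 𝔤 σ (tensDer 𝔤 d y) = tensDer 𝔤 d' (tensMap 𝔤 σ y) := by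
  induction y with
  | zero => simp
  | add a b ha hb => simp_all
  | tmul r a => simp [h]

lemma tensMap_smul (σ : R →ₐ[F] R') (r : R) (y : R ⊗[F] 𝔤) :
    tensMap 𝔤 σ (r • y) = σ r • tensMap 𝔤 σ y := by
  induction y with
  | zero => simp
  | add a b ha hb => simp only [smul_add, map_add, ha, hb]
  | tmul s a => simp [TensorProduct.smul_tmul']

/-- The coordinate `r ⊗ a ↦ ℓ(a) r` on `R ⊗ 𝔤` given by a linear form `ℓ` on `𝔤`. -/
def coord (ℓ : 𝔤 →ₗ[F] F) : R ⊗[F] 𝔤 →ₗ[F] R :=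
  (TensorProduct.rid F R).toLinearMap ∘ₗ LinearMap.lTensor R ℓ

@[simp]
lemma coord_tmul (ℓ : 𝔤 →ₗ[F] F) (r : R) (a : 𝔤) : coord ℓ (r ⊗ₜ[F] a) = ℓ a • r := by
  simp [coord]

lemma coord_tensDer (ℓ : 𝔤 →ₗ[F] F) (d : Derivation F R R) (y : R ⊗[F] 𝔤) :
    coord ℓ (tensDer 𝔤 d y) = d (coord ℓ y) := by
  induction y with
  | zero => simp
  | add a b ha hb => simp only [map_add, ha, hb]
  | tmul s a => simp

lemma coord_tensMap (ℓ : 𝔤 →ₗ[F] F) (σ : R →ₐ[F] R') (y : R ⊗[F] 𝔤) :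
    coord ℓ (tensMap 𝔤 σ y) = σ (coord ℓ y) := by
  induction y with
  | zero => simp
  | add a b ha hb => simp only [map_add, ha, hb]
  | tmul s a => simp

end Tens

/-! ### Gauge fixing -/

/-- The linear algebra behind gauge fixing. `G` is a decreasing filtration of the Lie algebra `𝔤`
(below, `G k = 𝔤_{≥ k/2}`), `n` is a nilpotent subalgebra acting on `M` (below, `M = m^⊥`), and `V`
is a complement of `[f, n]` in `M`. The map `θ` inverts `ad f : n → [f, n]`, vanishes on `V`, and
raises the filtration degree by two. -/
structure GaugeSlice (F 𝔤 : Type*) [Field F] [LieRing 𝔤] [LieAlgebra F 𝔤] where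
  f : 𝔤
  G : ℤ → Submodule F 𝔤
  n : Submodule F 𝔤
  M : Submodule F 𝔤
  V : Submodule F 𝔤
  θ : 𝔤 →ₗ[F] 𝔤
  lo : ℤ
  N : ℕ
  N_pos : 0 < N
  lie_mem_G : ∀ {i j : ℤ} {a b : 𝔤}, a ∈ G i → b ∈ G j → ⁅a, b⁆ ∈ G (i + j)
  G_anti : Antitone G
  G_lo : G lo = ⊤
  G_hi : G (lo + N) = ⊥
  f_mem : f ∈ G (-2)
  n_le : n ≤ G 1
  M_le : M ≤ G (-1)
  n_le_M : n ≤ M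
  V_le_M : V ≤ M
  lie_n_n : ∀ {a b : 𝔤}, a ∈ n → b ∈ n → ⁅a, b⁆ ∈ n
  lie_n_M : ∀ {a b : 𝔤}, a ∈ n → b ∈ M → ⁅a, b⁆ ∈ M
  lie_n_f : ∀ {a : 𝔤}, a ∈ n → ⁅a, f⁆ ∈ M
  θ_lie : ∀ {a : 𝔤}, a ∈ n → θ ⁅f, a⁆ = a
  θ_V : ∀ {a : 𝔤}, a ∈ V → θ a = 0
  θ_M : ∀ {a : 𝔤}, a ∈ M → θ a ∈ n
  sub_lie_θ_mem : ∀ {a : 𝔤}, a ∈ M → a - ⁅f, θ a⁆ ∈ V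
  θ_G : ∀ {k : ℤ} {a : 𝔤}, a ∈ G k → θ a ∈ G (k + 2)

namespace GaugeSlice

variable {F 𝔤 : Type*} [Field F] [LieRing 𝔤] [LieAlgebra F 𝔤] (S : GaugeSlice F 𝔤)
  {R : Type*} [CommRing R] [Algebra F R] (d : Derivation F R R)

/-- The gauge transform `q^X` over a differential algebra `R`. -/
def transform (X Q : R ⊗[F] 𝔤) : R ⊗[F] 𝔤 :=
  gauge S.N (tensDer 𝔤 d) X (Q + 1 ⊗ₜ S.f) - 1 ⊗ₜ S.f

variable {S d}

lemma lie_mem_tens_G {i j k : ℤ} (h : k ≤ i + j) {y z : R ⊗[F] 𝔤}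
    (hy : y ∈ tens ⊤ (S.G i)) (hz : z ∈ tens ⊤ (S.G j)) : ⁅y, z⁆ ∈ tens ⊤ (S.G k) :=
  lie_mem_tens (fun _ _ _ _ => Submodule.mem_top)
    (fun _ ha _ hb => S.G_anti h (S.lie_mem_G ha hb)) hy hz

lemma tens_G_mono {i j : ℤ} (h : j ≤ i) {y : R ⊗[F] 𝔤} (hy : y ∈ tens ⊤ (S.G i)) :
    y ∈ tens ⊤ (S.G j) :=
  tens_mono le_rfl (S.G_anti h) hy

lemma eq_zero_of_mem_G {k : ℤ} (hk : S.lo + S.N ≤ k) {y : R ⊗[F] 𝔤}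
    (hy : y ∈ tens ⊤ (S.G k)) : y = 0 := by
  have := tens_G_mono hk hy
  rwa [S.G_hi, tens_bot] at this

lemma n_mem_G {y : R ⊗[F] 𝔤} (hy : y ∈ tens ⊤ S.n) : y ∈ tens ⊤ (S.G 1) :=
  tens_mono le_rfl S.n_le hy

lemma M_mem_G {y : R ⊗[F] 𝔤} (hy : y ∈ tens ⊤ S.M) : y ∈ tens ⊤ (S.G (-1)) :=
  tens_mono le_rfl S.M_le hy

lemma lie_mem_tens_M {y z : R ⊗[F] 𝔤}
    (hy : y ∈ tens ⊤ S.n) (hz : z ∈ tens ⊤ S.M) : ⁅y, z⁆ ∈ tens ⊤ S.M :=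
  lie_mem_tens (fun _ _ _ _ => Submodule.mem_top) (fun _ ha _ hb => S.lie_n_M ha hb) hy hz

lemma lie_mem_tens_n {y z : R ⊗[F] 𝔤}
    (hy : y ∈ tens ⊤ S.n) (hz : z ∈ tens ⊤ S.n) : ⁅y, z⁆ ∈ tens ⊤ S.n :=
  lie_mem_tens (fun _ _ _ _ => Submodule.mem_top) (fun _ ha _ hb => S.lie_n_n ha hb) hy hz

lemma tensDer_mem {U : Submodule F 𝔤} {y : R ⊗[F] 𝔤} (hy : y ∈ tens ⊤ U) :
    tensDer 𝔤 d y ∈ tens ⊤ U :=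
  tensDer_mem_tens (fun _ _ => Submodule.mem_top) hy

lemma lie_f_mem {X : R ⊗[F] 𝔤} (hX : X ∈ tens ⊤ S.n) : ⁅X, (1 : R) ⊗ₜ S.f⁆ ∈ tens ⊤ S.M :=
  lie_mem_tens (I' := ⊤) (U' := Submodule.span F {S.f}) (fun _ _ _ _ => Submodule.mem_top)
    (fun a ha b hb => by
      obtain ⟨c, rfl⟩ := Submodule.mem_span_singleton.1 hb
      rw [lie_smul]
      exact Submodule.smul_mem _ _ (S.lie_n_f ha)) hX
    (tmul_mem_tens Submodule.mem_top (Submodule.mem_span_singleton_self _))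

lemma θ_lie_tens {X : R ⊗[F] 𝔤} (hX : X ∈ tens ⊤ S.n) :
    LinearMap.lTensor R S.θ ⁅X, (1 : R) ⊗ₜ S.f⁆ = -X := by
  rw [← lie_skew, map_neg, neg_inj]
  refine eqOn_tens (φ := LinearMap.lTensor R S.θ ∘ₗ
    LieModule.toEnd F (R ⊗[F] 𝔤) (R ⊗[F] 𝔤) ((1 : R) ⊗ₜ S.f)) (θ := LinearMap.id) ?_ hX
  intro r _ a ha
  simp [S.θ_lie ha]

lemma θ_mem_n {y : R ⊗[F] 𝔤} (hy : y ∈ tens ⊤ S.M) : LinearMap.lTensor R S.θ y ∈ tens ⊤ S.n :=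
  lTensor_mem_tens (fun _ ha => S.θ_M ha) hy

lemma θ_mem_G {k l : ℤ} (hl : l ≤ k + 2) {y : R ⊗[F] 𝔤} (hy : y ∈ tens ⊤ (S.G k)) :
    LinearMap.lTensor R S.θ y ∈ tens ⊤ (S.G l) :=
  lTensor_mem_tens (fun _ ha => S.G_anti hl (S.θ_G ha)) hy

/-- Membership in `R ⊗ V` is detected by `θ`. -/
lemma mem_V_iff {y : R ⊗[F] 𝔤} (hy : y ∈ tens ⊤ S.M) :
    y ∈ tens ⊤ S.V ↔ LinearMap.lTensor R S.θ y = 0 := by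
  constructor
  · intro h
    exact eqOn_tens (θ := 0) (fun r _ a ha => by simp [S.θ_V ha]) h
  · intro h
    have h2 : TensorProduct.map LinearMap.id (LinearMap.id - (LieAlgebra.ad F 𝔤 S.f) ∘ₗ S.θ) y ∈
        tens ⊤ S.V :=
      map_mem_tens (fun _ h => h) (fun a ha => S.sub_lie_θ_mem ha) hy
    have h3 : TensorProduct.map LinearMap.id (LinearMap.id - (LieAlgebra.ad F 𝔤 S.f) ∘ₗ S.θ) =
        LinearMap.id -
          LinearMap.lTensor R (LieAlgebra.ad F 𝔤 S.f : 𝔤 →ₗ[F] 𝔤) ∘ₗ LinearMap.lTensor R S.θ := by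
      ext r a
      simp [TensorProduct.tmul_sub]
    rw [h3] at h2
    simpa [h] using h2

/-- `ad X` is nilpotent on `R ⊗ 𝔤`, of order bounded independently of `R`. -/
lemma ad_pow_eq_zero {X : R ⊗[F] 𝔤} (hX : X ∈ tens ⊤ S.n) :
    (LieAlgebra.ad F (R ⊗[F] 𝔤) X) ^ S.N = 0 := by
  have key : ∀ (m : ℕ) (y : R ⊗[F] 𝔤),
      ((LieAlgebra.ad F (R ⊗[F] 𝔤) X) ^ m) y ∈ tens ⊤ (S.G (S.lo + m)) := by
    intro m y
    induction m with
    | zero => simp [S.G_lo, tens_top_top]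
    | succ m ih =>
      rw [pow_succ', Module.End.mul_apply]
      exact lie_mem_tens_G (by push_cast; omega) (n_mem_G hX) ih
  refine LinearMap.ext fun y => ?_
  exact eq_zero_of_mem_G le_rfl (key S.N y)

lemma lie_sub_mem {X Q : R ⊗[F] 𝔤} (hX : X ∈ tens ⊤ S.n) (hQ : Q ∈ tens ⊤ S.M) :
    ⁅X, Q + (1 : R) ⊗ₜ S.f⁆ - tensDer 𝔤 d X ∈ tens ⊤ S.M := by
  rw [lie_add]
  exact sub_mem (add_mem (lie_mem_tens_M hX hQ) (lie_f_mem hX))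
    (tens_mono le_rfl S.n_le_M (tensDer_mem hX))

lemma ad_pow_mem_M {X y : R ⊗[F] 𝔤} (hX : X ∈ tens ⊤ S.n) (hy : y ∈ tens ⊤ S.M) (k : ℕ) :
    ((LieAlgebra.ad F (R ⊗[F] 𝔤) X) ^ k) y ∈ tens ⊤ S.M := by
  induction k with
  | zero => simpa
  | succ k ih =>
    rw [pow_succ', Module.End.mul_apply]
    exact lie_mem_tens_M hX ih

lemma transform_eq (X Q : R ⊗[F] 𝔤) :
    S.transform d X Q = Q + ∑ k ∈ Finset.range S.N, ((k + 1).factorial : F)⁻¹ •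
      ((LieAlgebra.ad F (R ⊗[F] 𝔤) X) ^ k) (⁅X, Q + (1 : R) ⊗ₜ S.f⁆ - tensDer 𝔤 d X) := by
  rw [transform, gauge]
  abel

lemma transform_mem {X Q : R ⊗[F] 𝔤} (hX : X ∈ tens ⊤ S.n) (hQ : Q ∈ tens ⊤ S.M) :
    S.transform d X Q ∈ tens ⊤ S.M := by
  rw [transform_eq]
  exact add_mem hQ (sum_mem fun k _ =>
    Submodule.smul_mem _ _ (ad_pow_mem_M hX (lie_sub_mem hX hQ) k))

lemma transform_zero (Q : R ⊗[F] 𝔤) : S.transform d 0 Q = Q := by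
  rw [transform_eq]
  simp

/-- Gauge transforms by `X` and `Y` differ by `[X - Y, f]`, up to terms of higher degree. -/
lemma transform_sub_mem {X Y Q : R ⊗[F] 𝔤} (hX : X ∈ tens ⊤ S.n) (hY : Y ∈ tens ⊤ S.n)
    (hQ : Q ∈ tens ⊤ S.M) {k : ℤ} (h : X - Y ∈ tens ⊤ (S.G k)) :
    S.transform d X Q - S.transform d Y Q - ⁅X - Y, (1 : R) ⊗ₜ S.f⁆ ∈ tens ⊤ (S.G (k - 1)) := by
  set b : R ⊗[F] 𝔤 → R ⊗[F] 𝔤 := fun X => ⁅X, Q + (1 : R) ⊗ₜ S.f⁆ - tensDer 𝔤 d X with hb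
  have hf : ((1 : R) ⊗ₜ S.f : R ⊗[F] 𝔤) ∈ tens ⊤ (S.G (-2)) := tmul_mem_tens Submodule.mem_top S.f_mem
  have hQf := M_mem_G hQ
  have h1 : b X - b Y - ⁅X - Y, (1 : R) ⊗ₜ S.f⁆ ∈ tens ⊤ (S.G (k - 1)) := by
    have : b X - b Y - ⁅X - Y, (1 : R) ⊗ₜ S.f⁆ = ⁅X - Y, Q⁆ - tensDer 𝔤 d (X - Y) := by
      simp only [hb, lie_add, sub_lie, map_sub]
      abel
    rw [this]
    exact sub_mem (lie_mem_tens_G (by omega) h hQf) (tens_G_mono (by omega) (tensDer_mem h))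
  have h0 : b X - b Y ∈ tens ⊤ (S.G (k - 2)) := by
    have : b X - b Y = (b X - b Y - ⁅X - Y, (1 : R) ⊗ₜ S.f⁆) + ⁅X - Y, (1 : R) ⊗ₜ S.f⁆ := by abel
    rw [this]
    exact add_mem (tens_G_mono (by omega) h1) (lie_mem_tens_G (by omega) h hf)
  have hstep : ∀ m : ℕ,
      ((LieAlgebra.ad F (R ⊗[F] 𝔤) X) ^ m) (b X) - ((LieAlgebra.ad F (R ⊗[F] 𝔤) Y) ^ m) (b Y) ∈
        tens ⊤ (S.G (k - 2)) →
      ((LieAlgebra.ad F (R ⊗[F] 𝔤) X) ^ (m + 1)) (b X) -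
        ((LieAlgebra.ad F (R ⊗[F] 𝔤) Y) ^ (m + 1)) (b Y) ∈ tens ⊤ (S.G (k - 1)) := by
    intro m hm
    simp only [pow_succ', Module.End.mul_apply, LieAlgebra.ad_apply]
    set u := ((LieAlgebra.ad F (R ⊗[F] 𝔤) X) ^ m) (b X)
    set v := ((LieAlgebra.ad F (R ⊗[F] 𝔤) Y) ^ m) (b Y) with hv
    have : ⁅X, u⁆ - ⁅Y, v⁆ = ⁅X, u - v⁆ + ⁅X - Y, v⁆ := by
      simp only [lie_sub, sub_lie]; abel
    rw [this]
    exact add_mem (lie_mem_tens_G (by omega) (n_mem_G hX) hm)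
      (lie_mem_tens_G (by omega) h (M_mem_G (ad_pow_mem_M hY (lie_sub_mem hY hQ) m)))
  have hall : ∀ m : ℕ, ((LieAlgebra.ad F (R ⊗[F] 𝔤) X) ^ m) (b X) -
      ((LieAlgebra.ad F (R ⊗[F] 𝔤) Y) ^ m) (b Y) ∈ tens ⊤ (S.G (k - 2)) := by
    intro m
    induction m with
    | zero => simpa using h0
    | succ m ih => exact tens_G_mono (by omega) (hstep m ih)
  obtain ⟨N', hN'⟩ : ∃ N', S.N = N' + 1 := ⟨S.N - 1, by have := S.N_pos; omega⟩
  have hexp : S.transform d X Q - S.transform d Y Q - ⁅X - Y, (1 : R) ⊗ₜ S.f⁆ =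
      (b X - b Y - ⁅X - Y, (1 : R) ⊗ₜ S.f⁆) + ∑ m ∈ Finset.range N', ((m + 1 + 1).factorial : F)⁻¹ •
        (((LieAlgebra.ad F (R ⊗[F] 𝔤) X) ^ (m + 1)) (b X) -
        ((LieAlgebra.ad F (R ⊗[F] 𝔤) Y) ^ (m + 1)) (b Y)) := by
    rw [transform_eq, transform_eq, hN', Finset.sum_range_succ', Finset.sum_range_succ']
    simp only [smul_sub, Finset.sum_sub_distrib, hb]
    simp only [zero_add, Nat.factorial_one, Nat.cast_one, inv_one, one_smul, pow_zero,
      Module.End.one_apply]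
    abel
  rw [hexp]
  exact add_mem h1 (sum_mem fun m _ => Submodule.smul_mem _ _ (hstep m (hall m)))

/-- The map whose fixed points in `n ⊗ R` are the solutions `X` of `q^X ∈ V ⊗ R`. It is a
contraction for the filtration `G`. -/
def step (S : GaugeSlice F 𝔤) (d : Derivation F R R) (Q X : R ⊗[F] 𝔤) : R ⊗[F] 𝔤 :=
  X + LinearMap.lTensor R S.θ (S.transform d X Q)

lemma step_mem {X Q : R ⊗[F] 𝔤} (hX : X ∈ tens ⊤ S.n) (hQ : Q ∈ tens ⊤ S.M) :
    S.step d Q X ∈ tens ⊤ S.n :=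
  add_mem hX (θ_mem_n (transform_mem hX hQ))

lemma step_sub_mem {X Y Q : R ⊗[F] 𝔤} (hX : X ∈ tens ⊤ S.n) (hY : Y ∈ tens ⊤ S.n)
    (hQ : Q ∈ tens ⊤ S.M) {k : ℤ} (h : X - Y ∈ tens ⊤ (S.G k)) :
    S.step d Q X - S.step d Q Y ∈ tens ⊤ (S.G (k + 1)) := by
  have : S.step d Q X - S.step d Q Y = LinearMap.lTensor R S.θ
      (S.transform d X Q - S.transform d Y Q - ⁅X - Y, (1 : R) ⊗ₜ S.f⁆) := by
    rw [map_sub, θ_lie_tens (sub_mem hX hY), map_sub]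
    simp only [step]
    abel
  rw [this]
  exact θ_mem_G (by omega) (transform_sub_mem hX hY hQ h)

lemma transform_mem_V_iff {X Q : R ⊗[F] 𝔤} (hX : X ∈ tens ⊤ S.n) (hQ : Q ∈ tens ⊤ S.M) :
    S.transform d X Q ∈ tens ⊤ S.V ↔ S.step d Q X = X := by
  rw [mem_V_iff (transform_mem hX hQ), step, add_eq_left]

/-- The gauge `X` bringing `Q` to `V ⊗ R` is unique. -/
theorem eq_of_transform_mem {X Y Q : R ⊗[F] 𝔤} (hX : X ∈ tens ⊤ S.n) (hY : Y ∈ tens ⊤ S.n)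
    (hQ : Q ∈ tens ⊤ S.M) (hXV : S.transform d X Q ∈ tens ⊤ S.V)
    (hYV : S.transform d Y Q ∈ tens ⊤ S.V) : X = Y := by
  rw [transform_mem_V_iff hX hQ] at hXV
  rw [transform_mem_V_iff hY hQ] at hYV
  have key : ∀ m : ℕ, X - Y ∈ tens ⊤ (S.G (1 + m)) := by
    intro m
    induction m with
    | zero => simpa using n_mem_G (sub_mem hX hY)
    | succ m ih =>
      have := step_sub_mem (d := d) hX hY hQ ih
      rw [hXV, hYV] at this
      exact tens_G_mono (by push_cast; omega) this
  exact sub_eq_zero.1 (eq_zero_of_mem_G (k := 1 + ((S.lo + S.N).toNat : ℕ)) (by omega) (key _))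

/-- Existence of the gauge `X` bringing `Q` to `V ⊗ R`. It is reached from `0` by iterating `step`,
so it belongs to every set that contains `0` and is stable under `step`. -/
theorem exists_transform_mem {Q : R ⊗[F] 𝔤} (hQ : Q ∈ tens ⊤ S.M) :
    ∃ X ∈ tens ⊤ S.n, S.transform d X Q ∈ tens ⊤ S.V ∧
      ∀ T : Set (R ⊗[F] 𝔤), 0 ∈ T → (∀ Y ∈ T, S.step d Q Y ∈ T) → X ∈ T := by
  set u : ℕ → R ⊗[F] 𝔤 := fun m => (S.step d Q)^[m] 0 with hu
  have hs : ∀ m, u (m + 1) = S.step d Q (u m) := fun m => Function.iterate_succ_apply' _ _ _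
  have hn : ∀ m, u m ∈ tens ⊤ S.n := by
    intro m
    induction m with
    | zero => exact zero_mem _
    | succ m ih => rw [hs]; exact step_mem ih hQ
  have key : ∀ m : ℕ, u (m + 1) - u m ∈ tens ⊤ (S.G (1 + m)) := by
    intro m
    induction m with
    | zero => simpa using n_mem_G (sub_mem (hn 1) (hn 0))
    | succ m ih =>
      have := step_sub_mem (d := d) (hn _) (hn _) hQ ih
      rw [← hs, ← hs] at this
      exact tens_G_mono (by push_cast; omega) this
  refine ⟨u (S.lo + S.N).toNat, hn _, ?_, ?_⟩
  · rw [transform_mem_V_iff (hn _) hQ, ← hs, ← sub_eq_zero]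
    exact eq_zero_of_mem_G (k := 1 + ((S.lo + S.N).toNat : ℕ)) (by omega) (key _)
  · intro T h0 hT
    have : ∀ m, u m ∈ T := by
      intro m
      induction m with
      | zero => exact h0
      | succ m ih => rw [hs]; exact hT _ ih
    exact this _

/-- Infinitesimal uniqueness: no non-zero infinitesimal gauge transformation of `∂ + Q + f` is
tangent to `V ⊗ R`. -/
theorem eq_zero_of_lie_sub_mem {C Q : R ⊗[F] 𝔤} (hC : C ∈ tens ⊤ S.n) (hQ : Q ∈ tens ⊤ S.M)
    (h : ⁅C, Q + (1 : R) ⊗ₜ S.f⁆ - tensDer 𝔤 d C ∈ tens ⊤ S.V) : C = 0 := by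
  have h0 := (mem_V_iff (lie_sub_mem hC hQ)).1 h
  have h1 : C = LinearMap.lTensor R S.θ (⁅C, Q⁆ - tensDer 𝔤 d C) := by
    have : ⁅C, Q + (1 : R) ⊗ₜ S.f⁆ - tensDer 𝔤 d C =
        (⁅C, Q⁆ - tensDer 𝔤 d C) + ⁅C, (1 : R) ⊗ₜ S.f⁆ := by
      rw [lie_add]; abel
    rw [this, map_add, θ_lie_tens hC, ← sub_eq_add_neg, sub_eq_zero] at h0
    exact h0.symm
  have key : ∀ m : ℕ, C ∈ tens ⊤ (S.G (1 + m)) := by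
    intro m
    induction m with
    | zero => simpa using n_mem_G hC
    | succ m ih =>
      rw [h1]
      refine θ_mem_G (k := m) (by push_cast; omega)
        (sub_mem (lie_mem_tens_G (by omega) ih (M_mem_G hQ)) (tens_G_mono (by omega)
          (tensDer_mem ih)))
  exact eq_zero_of_mem_G (k := 1 + ((S.lo + S.N).toNat : ℕ)) (by omega) (key _)

/-- Gauge transforms commute with homomorphisms of differential algebras. -/
lemma tensMap_transform {R' : Type*} [CommRing R'] [Algebra F R'] {σ : R →ₐ[F] R'}
    {d' : Derivation F R' R'} (h : ∀ r, σ (d r) = d' (σ r)) (X Q : R ⊗[F] 𝔤) :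
    tensMap 𝔤 σ (S.transform d X Q) = S.transform d' (tensMap 𝔤 σ X) (tensMap 𝔤 σ Q) := by
  simp [transform, map_gauge (tensMap 𝔤 σ) (tensMap_tensDer h)]

/-- A derivation `D` commuting with `d` which acts on `Q` by the infinitesimal gauge transformation
`A` acts on `q^X` by an infinitesimal gauge transformation, namely by the element `C` with
`e^{ad X} (D - A) = D - C`. -/
lemma tensDer_transform [CharZero F] {X Q A : R ⊗[F] 𝔤} {D : Derivation F R R}
    (hcomm : ∀ r, d (D r) = D (d r))
    (hX : X ∈ tens ⊤ S.n)
    (hD : tensDer 𝔤 D Q = ⁅A, Q + (1 : R) ⊗ₜ S.f⁆ - tensDer 𝔤 d A) :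
    tensDer 𝔤 D (S.transform d X Q) =
      ⁅-gauge S.N (tensDer 𝔤 D) X (-A), S.transform d X Q + (1 : R) ⊗ₜ S.f⁆ -
        tensDer 𝔤 d (-gauge S.N (tensDer 𝔤 D) X (-A)) := by
  have hc : ∀ y : R ⊗[F] 𝔤, tensDer 𝔤 d (tensDer 𝔤 D y) = tensDer 𝔤 D (tensDer 𝔤 d y) := by
    intro y
    induction y with
    | zero => simp
    | add a b ha hb => simp_all
    | tmul r a => simp [hcomm]
  have h := gauge_flat (ad_pow_eq_zero hX) hc (W := Q + (1 : R) ⊗ₜ S.f) (W' := -A) (by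
    rw [map_add, hD, tensDer_tmul]
    simp only [lie_neg, map_neg, Derivation.map_one_eq_zero, TensorProduct.zero_tmul]
    rw [← lie_skew A]
    abel)
  have e1 : S.transform d X Q + (1 : R) ⊗ₜ S.f =
      gauge S.N (tensDer 𝔤 d) X (Q + (1 : R) ⊗ₜ S.f) := sub_add_cancel _ _
  have e2 : tensDer 𝔤 D (S.transform d X Q) =
      tensDer 𝔤 D (gauge S.N (tensDer 𝔤 d) X (Q + (1 : R) ⊗ₜ S.f)) := by
    rw [transform, map_sub, tensDer_tmul]
    simp
  rw [e1, e2, neg_lie, lie_skew, map_neg]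
  rw [← sub_eq_zero, ← neg_eq_zero]
  rw [← h]
  abel

end GaugeSlice

/-! ### Representations of `sl₂` -/

section Sl2

variable {F M : Type*} [Field F] [AddCommGroup M] [Module F M]

open Polynomial in
lemma ker_prod_le_iSup_eigenspace (H : Module.End F M) (s : Finset F) :
    LinearMap.ker (aeval H (∏ c ∈ s, (X - C c))) ≤ ⨆ c ∈ s, Module.End.eigenspace H c := by
  classical
  induction s using Finset.induction_on with
  | empty => simp [Module.End.one_eq_id]
  | insert c s hc ih =>
    have hcop : IsCoprime (X - C c) (∏ c ∈ s, (X - C c)) := by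
      refine IsCoprime.prod_right fun c' hc' => ?_
      exact isCoprime_X_sub_C_of_isUnit_sub
        (sub_ne_zero.2 (by rintro rfl; exact hc hc')).isUnit
    rw [Finset.prod_insert hc, ← sup_ker_aeval_eq_ker_aeval_mul_of_coprime H hcop,
      Finset.iSup_insert]
    refine sup_le_sup ?_ ih
    rw [Module.End.eigenspace_def]
    simp [Algebra.algebraMap_eq_smul_one]

open Polynomial in
lemma exists_prod_aeval_eq_zero (H : Module.End F M) (T : Set F) {y : M}
    (hy : y ∈ ⨆ c ∈ T, Module.End.eigenspace H c) :
    ∃ s : Finset F, (s : Set F) ⊆ T ∧ aeval H (∏ c ∈ s, (X - C c)) y = 0 := by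
  classical
  induction hy using Submodule.iSup_induction' with
  | mem c y hy =>
    by_cases hc : c ∈ T
    · refine ⟨{c}, by simpa using hc, ?_⟩
      simp only [hc, iSup_pos, Module.End.mem_eigenspace_iff] at hy
      simp [hy, Module.algebraMap_end_apply]
    · simp only [hc, iSup_neg, not_false_eq_true, Submodule.mem_bot] at hy
      exact ⟨∅, by simp, by simp [hy]⟩
  | zero => exact ⟨∅, by simp, by simp⟩
  | add y z _ _ hy hz =>
    obtain ⟨s, hs, hs'⟩ := hy
    obtain ⟨t, ht, ht'⟩ := hz
    have hdvd : ∀ {s u : Finset F} {y : M}, s ⊆ u → aeval H (∏ c ∈ s, (X - C c)) y = 0 →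
        aeval H (∏ c ∈ u, (X - C c)) y = 0 := by
      intro s u y hsu h
      obtain ⟨q, hq⟩ := Finset.prod_dvd_prod_of_subset s u (fun c => X - C c) hsu
      rw [hq, mul_comm, map_mul, Module.End.mul_apply, h, map_zero]
    refine ⟨s ∪ t, by simp [hs, ht], ?_⟩
    rw [map_add, hdvd Finset.subset_union_left hs', hdvd Finset.subset_union_right ht', add_zero]

/-- If `[H, E] = c E` with `c ≠ 0`, then `E` is nilpotent: the non-zero powers of `E` are
eigenvectors of `ad H` with distinct eigenvalues `n c`. -/
lemma isNilpotent_of_commutator [CharZero F] [FiniteDimensional F M] {H E : Module.End F M} {c : F}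
    (hc : c ≠ 0) (h : H * E - E * H = c • E) : ∃ n, E ^ n = 0 := by
  by_contra hne
  push Not at hne
  have hp : ∀ n : ℕ, H * E ^ n - E ^ n * H = ((n : F) * c) • E ^ n := by
    intro n
    induction n with
    | zero => simp
    | succ n ih =>
      have : H * E ^ (n + 1) - E ^ (n + 1) * H =
          (H * E ^ n - E ^ n * H) * E + E ^ n * (H * E - E * H) := by
        rw [pow_succ]; noncomm_ring
      rw [this, ih, h, smul_mul_assoc, mul_smul_comm, ← pow_succ, ← add_smul]
      push_cast
      congr 1
      ring
  let A : Module.End F (Module.End F M) := LinearMap.mulLeft F H - LinearMap.mulRight F H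
  have hfin := Module.End.finite_hasEigenvalue A
  have hinj : Function.Injective fun n : ℕ => (n : F) * c := fun m n hmn => by
    simpa [hc] using hmn
  refine (Set.infinite_range_of_injective hinj) (hfin.subset ?_)
  rintro _ ⟨n, rfl⟩
  refine Module.End.hasEigenvalue_of_hasEigenvector (x := E ^ n) ⟨?_, hne n⟩
  rw [Module.End.mem_eigenspace_iff]
  exact hp n

/-- The commutation relations of `sl₂` for three endomorphisms. -/
structure Sl2Rel (H E N : Module.End F M) : Prop where
  he : ∀ v, H (E v) = E (H v) + (2 : F) • E v
  hn : ∀ v, H (N v) = N (H v) - (2 : F) • N v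
  en : ∀ v, E (N v) = N (E v) + H v

namespace Sl2Rel

variable {H E N : Module.End F M}

lemma symm (t : Sl2Rel H E N) : Sl2Rel (-H) N E where
  he v := by simp [t.hn]; abel
  hn v := by simp [t.he]; abel
  en v := by simp [t.en]

variable [CharZero F]

lemma pow_e (t : Sl2Rel H E N) [FiniteDimensional F M] : ∃ n, E ^ n = 0 := by
  refine isNilpotent_of_commutator (H := H) (two_ne_zero (α := F)) ?_
  refine LinearMap.ext fun v => ?_
  simp [t.he]

omit [CharZero F] in
lemma e_f_pow (t : Sl2Rel H E N) {v : M} (hv : E v = 0) (k : ℕ) :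
    E ((N ^ (k + 1)) v) = ((k : F) + 1) • (N ^ k) (H v - (k : F) • v) := by
  have hH : ∀ k : ℕ, H ((N ^ k) v) = (N ^ k) (H v) - (2 * k : F) • (N ^ k) v := by
    intro k
    induction k with
    | zero => simp
    | succ k ih =>
      rw [pow_succ', Module.End.mul_apply, t.hn, ih, Module.End.mul_apply]
      simp only [map_sub, map_smul]
      push_cast
      module
  induction k with
  | zero => simp [t.en, hv]
  | succ k ih =>
    rw [pow_succ', Module.End.mul_apply, t.en, ih, hH]
    simp only [pow_succ', Module.End.mul_apply, map_sub, map_smul]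
    push_cast
    module

open Polynomial in
/-- On the kernel of `e`, the element `h` is diagonalizable with eigenvalues in `ℕ`. -/
lemma prod_apply_eq_zero (t : Sl2Rel H E N) (n : ℕ) {v : M} (hv : E v = 0)
    (hn : (N ^ n) v = 0) : aeval H (∏ k ∈ Finset.range n, (X - C (k : F))) v = 0 := by
  induction n generalizing v with
  | zero => simpa using hn
  | succ n ih =>
    have h1 := t.e_f_pow hv n
    rw [hn, map_zero, eq_comm, smul_eq_zero] at h1
    have h2 := h1.resolve_left (by exact_mod_cast Nat.succ_ne_zero n)
    have h3 := ih (v := H v - (n : F) • v) (by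
      have := t.he v
      simp only [hv, map_zero, smul_zero, add_zero] at this
      simp [hv, ← this]) h2
    rw [Finset.prod_range_succ, map_mul, Module.End.mul_apply]
    have h4 : aeval H (X - C (n : F)) v = H v - (n : F) • v := by
      simp only [map_sub, aeval_X, aeval_C, LinearMap.sub_apply, Module.algebraMap_end_apply]
    rw [h4, h3]

lemma e_pow_f_e (t : Sl2Rel H E N) {y : M} {ν : F} (hy : H y = ν • y) (k : ℕ) :
    (E ^ k) (N (E y)) = N ((E ^ (k + 1)) y) + ((k : F) * (ν + k + 1)) • (E ^ k) y := by
  have hH : ∀ k : ℕ, H ((E ^ k) y) = (ν + 2 * k) • (E ^ k) y := by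
    intro k
    induction k with
    | zero => simp [hy]
    | succ k ih =>
      rw [pow_succ', Module.End.mul_apply, t.he, ih, map_smul]
      push_cast
      module
  induction k with
  | zero => simp
  | succ k ih =>
    have hs : ∀ j w, E ((E ^ j) w) = (E ^ (j + 1)) w := fun j w => by
      rw [pow_succ', Module.End.mul_apply]
    rw [← hs k, ih, map_add, t.en, hH, map_smul, hs, hs]
    push_cast
    module

/-- A vector `y` of positive weight is in the image of `e`. The proof is by induction on the order
`k` of nilpotency of `e` at `y`: for the constant `c` of `e_pow_f_e`, the vector `f e y - c y` is
annihilated by a smaller power of `e`. -/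
lemma exists_e_eq (t : Sl2Rel H E N) {ν : ℕ} (hν : 0 < ν) (k : ℕ) {y : M}
    (hy : H y = (ν : F) • y) (hk : (E ^ k) y = 0) :
    ∃ z, H z = ((ν : F) - 2) • z ∧ E z = y := by
  induction k generalizing y with
  | zero => exact ⟨0, by simp, by simpa using hk.symm⟩
  | succ k ih =>
    set c : F := (k : F) * (ν + k + 1) with hc
    obtain ⟨z, hz, hz'⟩ := ih (y := N (E y) - c • y)
      (by simp only [map_sub, map_smul, t.hn, t.he, hy, map_add]; module)
      (by rw [map_sub, t.e_pow_f_e hy, hk, map_smul]; simp [hc])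
    have hne : c + (ν : F) ≠ 0 := by
      have : 0 < k * (ν + k + 1) + ν := by positivity
      rw [hc]
      exact_mod_cast this.ne'
    refine ⟨(c + (ν : F))⁻¹ • (N y - z), ?_, ?_⟩
    · simp only [map_smul, map_sub, t.hn, hy, hz]; module
    · rw [map_smul, map_sub, t.en, hz', hy, inv_smul_eq_iff₀ hne]; module

open Polynomial in
/-- In a finite-dimensional representation of `sl₂`, the element `h` is diagonalizable, with
integer eigenvalues. -/
theorem iSup_eigenspace_eq_top (t : Sl2Rel H E N) [FiniteDimensional F M] :
    ⨆ k : ℤ, Module.End.eigenspace H (k : F) = ⊤ := by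
  classical
  obtain ⟨m, hm⟩ := t.pow_e
  obtain ⟨n, hn⟩ := t.symm.pow_e
  set W := ⨆ k : ℤ, Module.End.eigenspace H (k : F) with hW
  have hWk : ∀ k : ℤ, Module.End.eigenspace H (k : F) ≤ W := fun k => le_iSup_iff.2 fun b hb => hb k
  -- It is enough that `e v ∈ W` implies `v ∈ W`, as `e` is nilpotent.
  have key : ∀ v, E v ∈ W → v ∈ W := by
    intro v hv
    set Wp := ⨆ k : ℤ, ⨆ _ : 0 < k, Module.End.eigenspace H (k : F) with hWp
    set T : Set F := {c | ∃ k : ℤ, k ≤ 0 ∧ (k : F) = c} with hT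
    have hle : W ≤ Wp ⊔ ⨆ c ∈ T, Module.End.eigenspace H c := by
      refine iSup_le fun k => ?_
      rcases lt_or_ge 0 k with hk | hk
      · exact le_sup_of_le_left (le_iSup₂_of_le k hk le_rfl)
      · exact le_sup_of_le_right (le_iSup₂_of_le (k : F) ⟨k, hk, rfl⟩ le_rfl)
    have hWpE : Wp ≤ W.map E := by
      refine iSup₂_le fun k hk y hy => ?_
      rw [Module.End.mem_eigenspace_iff] at hy
      lift k to ℕ using hk.le
      obtain ⟨z, hz, hz'⟩ := t.exists_e_eq (ν := k) (by exact_mod_cast hk) m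
        (by simpa using hy) (by simp [hm])
      refine ⟨z, hWk ((k : ℤ) - 2) ?_, hz'⟩
      rw [Module.End.mem_eigenspace_iff, hz]
      simp
    obtain ⟨y₁, hy₁, y₂, hy₂, hy⟩ := Submodule.mem_sup.1 (hle hv)
    obtain ⟨z, hz, rfl⟩ := hWpE hy₁
    have hv' : E (v - z) = y₂ := by rw [map_sub, ← hy]; abel
    obtain ⟨s, hsT, hs⟩ := exists_prod_aeval_eq_zero H T hy₂
    -- `E` intertwines `H - c` with `H - (c - 2)`
    have hint : ∀ (s : Finset F) (w : M), aeval H (∏ c ∈ s, (X - C c)) (E w) =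
        E (aeval H (∏ c ∈ s, (X - C (c - 2))) w) := by
      intro s
      induction s using Finset.induction_on with
      | empty => simp
      | insert c s hc ih =>
        intro w
        rw [Finset.prod_insert hc, Finset.prod_insert hc, mul_comm, map_mul, Module.End.mul_apply,
          mul_comm, map_mul, Module.End.mul_apply, ← ih]
        congr 1
        simp only [map_sub, aeval_X, aeval_C, LinearMap.sub_apply, Module.algebraMap_end_apply,
          t.he, map_smul]
        module
    have hker : E (aeval H (∏ c ∈ s, (X - C (c - 2))) (v - z)) = 0 := by
      rw [← hint, hv', hs]
    have hp := t.prod_apply_eq_zero n hker (by simp [hn])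
    rw [← Module.End.mul_apply, ← map_mul] at hp
    have hinj : Function.Injective fun c : F => c - 2 := fun a b h => by simpa using h
    have hprod : (∏ k ∈ Finset.range n, (X - C (k : F))) * ∏ c ∈ s, (X - C (c - 2)) =
        ∏ c ∈ (Finset.range n).image (fun k : ℕ => (k : F)) ∪ s.image (fun c => c - 2),
          (X - C c) := by
      rw [Finset.prod_union, Finset.prod_image (fun a _ b _ h => by exact_mod_cast h),
        Finset.prod_image (fun a _ b _ h => hinj h)]
      rw [Finset.disjoint_left]
      intro c hc hc'
      obtain ⟨k, -, rfl⟩ := Finset.mem_image.1 hc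
      obtain ⟨c', hc's, hc'⟩ := Finset.mem_image.1 hc'
      obtain ⟨j, hj, rfl⟩ := hsT hc's
      have : (j - 2 : ℤ) = (k : ℤ) := by
        have h2 : ((j - 2 : ℤ) : F) = ((k : ℤ) : F) := by push_cast; exact hc'
        exact_mod_cast h2
      omega
    rw [hprod] at hp
    have hmem : v - z ∈ W := by
      suffices hle : _ ≤ W from hle (ker_prod_le_iSup_eigenspace H _ hp)
      refine iSup₂_le fun c hc => ?_
      rcases Finset.mem_union.1 hc with hc | hc
      · obtain ⟨k, -, rfl⟩ := Finset.mem_image.1 hc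
        simpa using hWk k
      · obtain ⟨c', hc's, rfl⟩ := Finset.mem_image.1 hc
        obtain ⟨j, hj, rfl⟩ := hsT hc's
        simpa using hWk (j - 2)
    simpa using add_mem hmem hz
  have hall : ∀ (k : ℕ) (v : M), (E ^ k) v ∈ W → v ∈ W := by
    intro k
    induction k with
    | zero => intro v hv; simpa using hv
    | succ k ih =>
      intro v hv
      rw [pow_succ', Module.End.mul_apply] at hv
      exact ih v (key _ hv)
  rw [eq_top_iff]
  intro v _
  exact hall m v (by simp [hm])

/-- The element `f` is injective on the spaces of positive weight. -/
lemma eq_zero_of_f_eq_zero (t : Sl2Rel H E N) [FiniteDimensional F M] {v : M} {c : ℚ}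
    (hc : 0 < c) (hv : H v = (c : F) • v) (hN : N v = 0) : v = 0 := by
  obtain ⟨n, hn⟩ := t.pow_e
  have h := t.symm.prod_apply_eq_zero n hN (by simp [hn])
  have hev : ∀ p : Polynomial F, Polynomial.aeval (-H) p v = p.eval (-(c : F)) • v := by
    intro p
    rcases eq_or_ne v 0 with rfl | hv0
    · simp
    refine Module.End.aeval_apply_of_hasEigenvector (f := -H) ⟨?_, hv0⟩
    rw [Module.End.mem_eigenspace_iff]
    simp [hv]
  rw [hev, smul_eq_zero] at h
  refine h.resolve_left ?_
  rw [Polynomial.eval_prod, ← ne_eq, Finset.prod_ne_zero_iff]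
  intro k _
  have : -c - (k : ℚ) ≠ 0 := by
    have : (0 : ℚ) ≤ k := by positivity
    linarith
  simp only [Polynomial.eval_sub, Polynomial.eval_X, Polynomial.eval_C]
  exact_mod_cast this

end Sl2Rel

end Sl2

/-! ### The grading by eigenvalues of `ad x` -/

section Grading

variable {F : Type*} [Field F] {𝔤 : Type*} [LieRing 𝔤] [LieAlgebra F 𝔤] {x : 𝔤}

lemma mem_gr {i : ℚ} {a : 𝔤} : a ∈ gr (F := F) x i ↔ ⁅x, a⁆ = (i : F) • a := by
  rw [gr, Module.End.mem_eigenspace_iff, LieAlgebra.ad_apply]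

/-- The linear endomorphism which agrees with `φ j` on `𝔤_j`. -/
def gradedLift (h : DirectSum.IsInternal (gr (F := F) x)) (φ : ℚ → 𝔤 →ₗ[F] 𝔤) : 𝔤 →ₗ[F] 𝔤 :=
  DirectSum.toModule F ℚ 𝔤 (fun j => φ j ∘ₗ (gr (F := F) x j).subtype) ∘ₗ
    (LinearEquiv.ofBijective (DirectSum.coeLinearMap (gr (F := F) x)) h).symm.toLinearMap

variable (h : DirectSum.IsInternal (gr (F := F) x))

include h in
lemma iSup_gr_eq_top : ⨆ i, gr (F := F) x i = ⊤ := h.submodule_iSup_eq_top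

lemma gradedLift_apply (φ : ℚ → 𝔤 →ₗ[F] 𝔤) {j : ℚ} {v : 𝔤} (hv : v ∈ gr (F := F) x j) :
    gradedLift h φ v = φ j v := by
  have : (LinearEquiv.ofBijective (DirectSum.coeLinearMap (gr (F := F) x)) h).symm v =
      DirectSum.lof F ℚ (fun j => gr (F := F) x j) j ⟨v, hv⟩ := by
    rw [LinearEquiv.symm_apply_eq]
    exact (DirectSum.coeLinearMap_lof (gr (F := F) x) j ⟨v, hv⟩).symm
  simp [gradedLift, this]

/-- The projection of `𝔤` on `𝔤_i`. -/
def pr (h : DirectSum.IsInternal (gr (F := F) x)) (i : ℚ) : 𝔤 →ₗ[F] 𝔤 :=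
  gradedLift h fun j => if j = i then LinearMap.id else 0

lemma pr_of_mem {i : ℚ} {v : 𝔤} (hv : v ∈ gr (F := F) x i) : pr h i v = v := by
  simp [pr, gradedLift_apply h _ hv]

lemma pr_of_mem_ne {i j : ℚ} (hij : j ≠ i) {v : 𝔤} (hv : v ∈ gr (F := F) x j) :
    pr h i v = 0 := by
  simp [pr, gradedLift_apply h _ hv, hij]

include h in
lemma gr_induction {p : 𝔤 → Prop} (hom : ∀ i, ∀ v ∈ gr (F := F) x i, p v) (zero : p 0)
    (add : ∀ v w, p v → p w → p (v + w)) (v : 𝔤) : p v := by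
  have hv : v ∈ ⨆ i, gr (F := F) x i := by rw [iSup_gr_eq_top h]; exact Submodule.mem_top
  exact Submodule.iSup_induction _ (motive := p) hv hom zero add

lemma pr_mem (i : ℚ) (v : 𝔤) : pr h i v ∈ gr (F := F) x i := by
  induction v using gr_induction h with
  | hom j v hv =>
    by_cases hij : j = i
    · subst hij; rwa [pr_of_mem h hv]
    · rw [pr_of_mem_ne h hij hv]; exact zero_mem _
  | zero => simp
  | add v w hv hw => rw [map_add]; exact add_mem hv hw

lemma lie_mem_gr {i j : ℚ} [CharZero F] {a b : 𝔤} (ha : a ∈ gr (F := F) x i)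
    (hb : b ∈ gr (F := F) x j) : ⁅a, b⁆ ∈ gr (F := F) x (i + j) := by
  rw [mem_gr] at *
  rw [leibniz_lie, ha, hb, smul_lie, lie_smul, Rat.cast_add, add_smul]

lemma pr_lie [CharZero F] {i : ℚ} (k j : ℚ) (hk : k = i + j) {a : 𝔤} (ha : a ∈ gr (F := F) x i)
    (b : 𝔤) : pr h k ⁅a, b⁆ = ⁅a, pr h j b⁆ := by
  subst hk
  induction b using gr_induction h with
  | hom l b hb =>
    by_cases hl : l = j
    · subst hl; rw [pr_of_mem h hb, pr_of_mem h (lie_mem_gr ha hb)]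
    · rw [pr_of_mem_ne h hl hb, pr_of_mem_ne h (by simpa using hl) (lie_mem_gr ha hb), lie_zero]
  | zero => simp
  | add v w hv hw => simp [hv, hw]

lemma exists_finset_sum_pr [CharZero F] [FiniteDimensional F 𝔤] :
    ∃ s : Finset ℚ, ∀ v, ∑ i ∈ s, pr h i v = v := by
  have hfin : {i : ℚ | gr (F := F) x i ≠ ⊥}.Finite := by
    refine Set.Finite.preimage (f := fun i : ℚ => (i : F)) (fun a _ b _ h => Rat.cast_injective h)
      (Module.End.finite_hasEigenvalue (LieAlgebra.ad F 𝔤 x))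
  refine ⟨hfin.toFinset, fun v => ?_⟩
  induction v using gr_induction h with
  | hom j v hv =>
    rcases eq_or_ne v 0 with rfl | hv0
    · simp
    rw [Finset.sum_eq_single j, pr_of_mem h hv]
    · intro i _ hij
      exact pr_of_mem_ne h hij.symm hv
    · intro hj
      simp only [Set.Finite.mem_toFinset, Set.mem_ofPred_eq, not_not] at hj
      rw [hj, Submodule.mem_bot] at hv
      exact absurd hv hv0
  | zero => simp
  | add v w hv hw => simp only [map_add, Finset.sum_add_distrib, hv, hw]

variable [CharZero F] [FiniteDimensional F 𝔤]

lemma mem_of_pr_mem {U : Submodule F 𝔤} {v : 𝔤} (hv : ∀ i, pr h i v ∈ U) : v ∈ U := by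
  obtain ⟨s, hs⟩ := exists_finset_sum_pr h
  rw [← hs v]
  exact sum_mem fun i _ => hv i

omit [CharZero F] [FiniteDimensional F 𝔤] in
lemma pr_mem_of_isGraded {U : Submodule F 𝔤} (hU : IsGraded x U) {v : 𝔤} (hv : v ∈ U) (i : ℚ) :
    pr h i v ∈ U := by
  rw [hU] at hv
  induction hv using Submodule.iSup_induction' with
  | mem j v hv =>
    by_cases hij : j = i
    · subst hij; rw [pr_of_mem h hv.2]; exact hv.1
    · rw [pr_of_mem_ne h hij hv.2]; exact zero_mem _
  | zero => simp
  | add v w _ _ hv hw => rw [map_add]; exact add_mem hv hw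

lemma mem_iSup_gr_iff (P : ℚ → Prop) {v : 𝔤} :
    v ∈ ⨆ (i : ℚ) (_ : P i), gr (F := F) x i ↔ ∀ i, ¬ P i → pr h i v = 0 := by
  constructor
  · intro hv i hi
    induction hv using Submodule.iSup_induction' with
    | mem j v hv =>
      by_cases hj : P j
      · simp only [hj, iSup_pos] at hv
        exact pr_of_mem_ne h (by rintro rfl; exact hi hj) hv
      · simp only [hj, iSup_neg, not_false_eq_true, Submodule.mem_bot] at hv
        simp [hv]
    | zero => simp
    | add v w _ _ hv hw => rw [map_add, hv, hw, add_zero]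
  · intro hv
    refine mem_of_pr_mem h fun i => ?_
    by_cases hi : P i
    · exact Submodule.mem_iSup_of_mem i (Submodule.mem_iSup_of_mem hi (pr_mem h i v))
    · rw [hv i hi]; exact zero_mem _

variable (x F) in
/-- The subspace `𝔤_{≥ k/2}`. -/
def grGe (k : ℤ) : Submodule F 𝔤 := ⨆ (i : ℚ) (_ : (k : ℚ) / 2 ≤ i), gr x i

omit [CharZero F] [FiniteDimensional F 𝔤] in
lemma grGeOne_eq : grGeOne (F := F) x = grGe F x 2 := by
  simp [grGeOne, grGe]

lemma mem_grGe_iff {k : ℤ} {v : 𝔤} :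
    v ∈ grGe F x k ↔ ∀ i : ℚ, i < (k : ℚ) / 2 → pr h i v = 0 := by
  rw [grGe, mem_iSup_gr_iff h]
  simp

omit [CharZero F] [FiniteDimensional F 𝔤] in
lemma grGe_anti : Antitone (grGe F x) := by
  intro k l hkl
  refine iSup₂_le fun i hi => le_iSup₂_of_le i (le_trans ?_ hi) le_rfl
  have : (k : ℚ) ≤ l := by exact_mod_cast hkl
  linarith

omit [CharZero F] [FiniteDimensional F 𝔤] in
lemma gr_le_grGe {k : ℤ} {i : ℚ} (hi : (k : ℚ) / 2 ≤ i) : gr x i ≤ grGe F x k :=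
  le_iSup₂_of_le i hi le_rfl

omit [FiniteDimensional F 𝔤] in
lemma lie_mem_grGe {k l : ℤ} {a b : 𝔤} (ha : a ∈ grGe F x k) (hb : b ∈ grGe F x l) :
    ⁅a, b⁆ ∈ grGe F x (k + l) := by
  have h1 : grGe F x k ≤ (grGe F x (k + l)).comap
      ((LieModule.toEnd F 𝔤 𝔤 : 𝔤 →ₗ[F] Module.End F 𝔤).flip b) := by
    refine iSup₂_le fun i hi a ha => ?_
    have h2 : grGe F x l ≤ (grGe F x (k + l)).comap (LieModule.toEnd F 𝔤 𝔤 a) := by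
      refine iSup₂_le fun j hj b hb => ?_
      refine gr_le_grGe (i := i + j) ?_ (lie_mem_gr ha hb)
      push_cast
      linarith
    exact h2 hb
  exact h1 ha

end Grading

/-! ### The slice -/

section Slice

variable {F : Type*} [Field F] {𝔤 : Type*} [LieRing 𝔤] [LieAlgebra F 𝔤]

/-- The standing hypotheses on the invariant form, the `sl₂`-triple and the subspace `l`. -/
structure Setting (κ : LinearMap.BilinForm F 𝔤) (f x e : 𝔤) (l : Submodule F 𝔤) : Prop where
  nondeg : κ.Nondegenerate
  symm : κ.IsSymm
  inv : κ.lieInvariant 𝔤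
  sl2 : IsSl2Triple ((2 : F) • x) e f
  l_le : l ≤ gr x (1 / 2)

namespace Setting

variable {κ : LinearMap.BilinForm F 𝔤} {f x e : 𝔤} {l : Submodule F 𝔤} (t : Setting κ f x e l)
include t

lemma kappa_lie (a b c : 𝔤) : κ ⁅a, b⁆ c = - κ b ⁅a, c⁆ := t.inv a b c

lemma kappa_comm (a b : 𝔤) : κ a b = κ b a := t.symm.eq a b

lemma kappa_lie' (a b c : 𝔤) : κ ⁅a, b⁆ c = κ a ⁅b, c⁆ := by
  rw [← lie_skew, map_neg, LinearMap.neg_apply, t.kappa_lie, neg_neg]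

variable [CharZero F]

lemma sl2Rel : Sl2Rel (LieAlgebra.ad F 𝔤 ((2 : F) • x)) (LieAlgebra.ad F 𝔤 e)
    (LieAlgebra.ad F 𝔤 f) where
  he v := by
    have := t.sl2.lie_h_e_smul F
    simp only [LieAlgebra.ad_apply]
    rw [leibniz_lie, this, smul_lie, add_comm]
  hn v := by
    have := t.sl2.lie_lie_smul_f F
    simp only [LieAlgebra.ad_apply]
    rw [leibniz_lie, this, neg_lie, smul_lie]
    abel
  en v := by
    simp only [LieAlgebra.ad_apply]
    rw [leibniz_lie, t.sl2.lie_e_f, add_comm]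

omit t in
lemma eigenspace_two_smul_eq_gr (c : F) (k : ℚ) (hk : c = 2 * (k : F)) :
    Module.End.eigenspace (LieAlgebra.ad F 𝔤 ((2 : F) • x)) c = gr x k := by
  ext v
  rw [mem_gr, Module.End.mem_eigenspace_iff, LieAlgebra.ad_apply, hk, smul_lie, mul_smul]
  exact smul_right_inj two_ne_zero

variable [FiniteDimensional F 𝔤]

lemma iSup_gr_half : ⨆ k : ℤ, gr (F := F) x ((k : ℚ) / 2) = ⊤ := by
  rw [← t.sl2Rel.iSup_eigenspace_eq_top]
  refine iSup_congr fun k => (eigenspace_two_smul_eq_gr _ _ ?_).symm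
  push_cast
  ring

lemma isInternal : DirectSum.IsInternal (gr (F := F) x) := by
  refine DirectSum.isInternal_submodule_of_iSupIndep_of_iSup_eq_top ?_ ?_
  · exact (Module.End.eigenspaces_iSupIndep (LieAlgebra.ad F 𝔤 x)).comp
      (f := fun i : ℚ => (i : F)) Rat.cast_injective
  · rw [eq_top_iff, ← t.iSup_gr_half]
    exact iSup_le fun k => le_iSup (gr (F := F) x) _

lemma pr_eq_zero {i : ℚ} (hi : ∀ k : ℤ, i ≠ k / 2) (v : 𝔤) : pr t.isInternal i v = 0 := by
  have hv : v ∈ ⨆ k : ℤ, gr (F := F) x ((k : ℚ) / 2) := by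
    rw [t.iSup_gr_half]; exact Submodule.mem_top
  induction hv using Submodule.iSup_induction' with
  | mem k v hv => exact pr_of_mem_ne t.isInternal (hi k).symm hv
  | zero => simp
  | add v w _ _ hv hw => rw [map_add, hv, hw, add_zero]

lemma f_mem : f ∈ gr (F := F) x (-1) := by
  rw [mem_gr]
  have h := t.sl2.lie_lie_smul_f F
  rw [smul_lie, ← smul_neg] at h
  rw [smul_right_injective 𝔤 (two_ne_zero (α := F)) h]
  simp

lemma eq_zero_of_lie_f {i : ℚ} (hi : 0 < i) {v : 𝔤} (hv : v ∈ gr (F := F) x i)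
    (h : ⁅f, v⁆ = 0) : v = 0 := by
  refine t.sl2Rel.eq_zero_of_f_eq_zero (c := 2 * i) (by linarith) ?_ (by simpa using h)
  rw [mem_gr] at hv
  simp [hv, smul_smul]

omit [FiniteDimensional F 𝔤] in
lemma kappa_gr {i j : ℚ} (hij : i + j ≠ 0) {a b : 𝔤} (ha : a ∈ gr (F := F) x i)
    (hb : b ∈ gr (F := F) x j) : κ a b = 0 := by
  have h1 := t.kappa_lie x a b
  rw [mem_gr] at ha hb
  rw [ha, hb, map_smul, map_smul, LinearMap.smul_apply, smul_eq_mul, smul_eq_mul] at h1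
  have h2 : ((i + j : ℚ) : F) * κ a b = 0 := by push_cast; linear_combination h1
  rcases mul_eq_zero.1 h2 with h3 | h3
  · exact absurd (by exact_mod_cast h3) hij
  · exact h3

/-- The projections on `𝔤_i` and `𝔤_{-i}` are adjoint to each other. -/
lemma kappa_pr (i j : ℚ) (hij : j = -i) (a b : 𝔤) :
    κ (pr t.isInternal i a) b = κ a (pr t.isInternal j b) := by
  subst hij
  have h := t.isInternal
  induction a using gr_induction h with
  | hom k a ha =>
    induction b using gr_induction h with
    | hom m b hb =>
      by_cases hkm : k + m = 0
      · by_cases hki : k = i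
        · rw [pr_of_mem h (by rwa [← hki]), pr_of_mem h (by rwa [show -i = m by linarith])]
        · rw [pr_of_mem_ne h hki ha, pr_of_mem_ne h (fun hm => hki (by linarith)) hb]
          simp
      · rw [t.kappa_gr (i := k) (j := -i + (m + i)) (by simpa using hkm)]
        · by_cases hm : m = -i
          · rw [pr_of_mem h (by rwa [← hm]), t.kappa_gr hkm ha hb]
          · rw [pr_of_mem_ne h hm hb, map_zero]
        · by_cases hki : k = i
          · rwa [pr_of_mem h (by rwa [← hki])]
          · rw [pr_of_mem_ne h hki ha]; exact zero_mem _
        · simpa using hb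
    | zero => simp
    | add v w hv hw => simp only [map_add, hv, hw]
  | zero => simp
  | add v w hv hw => simp only [map_add, LinearMap.add_apply, hv, hw]

lemma kappa_grGe {k m : ℤ} (hkm : 0 < k + m) {a b : 𝔤} (ha : a ∈ grGe F x k)
    (hb : b ∈ grGe F x m) : κ a b = 0 := by
  have h1 : grGe F x k ≤ LinearMap.ker (κ.flip b) := by
    refine iSup₂_le fun i hi a ha => ?_
    have h2 : grGe F x m ≤ LinearMap.ker (κ a) := by
      refine iSup₂_le fun j hj b hb => ?_
      have : (0 : ℚ) < (k : ℚ) + m := by exact_mod_cast hkm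
      exact t.kappa_gr (by linarith) ha hb
    exact h2 hb
  exact h1 ha

lemma grGe_two_le_m : grGe F x 2 ≤ subM x l := by
  rw [← grGeOne_eq]; exact le_sup_right

lemma grGe_two_le_n : grGe F x 2 ≤ subN κ f x l := by
  rw [← grGeOne_eq]; exact le_sup_right

omit t [CharZero F] [FiniteDimensional F 𝔤] in
lemma symplCompl_le : symplCompl κ f x l ≤ gr x (1 / 2) := fun _ ha => ha.1

lemma m_le : subM x l ≤ grGe F x 1 :=
  sup_le (t.l_le.trans (gr_le_grGe (by norm_num))) (by rw [grGeOne_eq]; exact grGe_anti (by norm_num))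

lemma n_le : subN κ f x l ≤ grGe F x 1 :=
  sup_le (symplCompl_le.trans (gr_le_grGe (by norm_num)))
    (by rw [grGeOne_eq]; exact grGe_anti (by norm_num))

lemma grGe_three_le : grGe F x 3 ≤ LinearMap.ker (κ f) := fun b hb =>
  t.kappa_grGe (k := -2) (m := 3) (by norm_num) (gr_le_grGe (by norm_num) t.f_mem) hb

/-- The pairing `κ(f | [n, m])` vanishes. -/
lemma kappa_f_lie {a b : 𝔤} (ha : a ∈ subN κ f x l) (hb : b ∈ subM x l) : κ f ⁅a, b⁆ = 0 := by
  have hb1 := t.m_le hb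
  obtain ⟨a₁, ha₁, a₂, ha₂, rfl⟩ := Submodule.mem_sup.1 ha
  obtain ⟨b₁, hb₁, b₂, hb₂, rfl⟩ := Submodule.mem_sup.1 hb
  rw [grGeOne_eq] at ha₂ hb₂
  have h1 : κ f ⁅a₁, b₁⁆ = 0 := ha₁.2 b₁ hb₁
  have h2 : κ f ⁅a₁, b₂⁆ = 0 := t.grGe_three_le
    (lie_mem_grGe (k := 1) (l := 2) (gr_le_grGe (by norm_num) ha₁.1) hb₂)
  have h3 : κ f ⁅a₂, b₁ + b₂⁆ = 0 := t.grGe_three_le (lie_mem_grGe (k := 2) (l := 1) ha₂ hb1)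
  rw [add_lie, lie_add, map_add, map_add, h1, h2, h3]
  simp

lemma lie_n_m {a b : 𝔤} (ha : a ∈ subN κ f x l) (hb : b ∈ subM x l) : ⁅a, b⁆ ∈ subM x l :=
  t.grGe_two_le_m (lie_mem_grGe (k := 1) (l := 1) (t.n_le ha) (t.m_le hb))

lemma lie_n_mPerp {a y : 𝔤} (ha : a ∈ subN κ f x l) (hy : y ∈ mPerp κ x l) :
    ⁅a, y⁆ ∈ mPerp κ x l := by
  intro b hb
  change κ b ⁅a, y⁆ = 0
  have := t.kappa_lie a b y
  have h2 := hy _ (t.lie_n_m ha hb)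
  change κ _ _ = 0 at h2
  rw [h2] at this
  simpa using this.symm

lemma lie_n_f {a : 𝔤} (ha : a ∈ subN κ f x l) : ⁅a, f⁆ ∈ mPerp κ x l := by
  intro b hb
  change κ b ⁅a, f⁆ = 0
  rw [t.kappa_comm, t.kappa_lie, t.kappa_f_lie ha hb, neg_zero]

lemma n_le_mPerp : subN κ f x l ≤ mPerp κ x l := fun _ ha _ hb =>
  t.kappa_grGe (k := 1) (m := 1) (by norm_num) (t.m_le hb) (t.n_le ha)

lemma mPerp_le : mPerp κ x l ≤ grGe F x (-1) := by
  intro y hy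
  rw [mem_grGe_iff t.isInternal]
  intro i hi
  by_cases hk : ∃ k : ℤ, i = k / 2
  · obtain ⟨k, rfl⟩ := hk
    have hk2 : k ≤ -2 := by
      have : (k : ℚ) < -1 := by push_cast at hi; linarith
      have : k < -1 := by exact_mod_cast this
      omega
    refine t.nondeg.1 _ fun b => ?_
    rw [t.kappa_pr _ (-(k / 2)) rfl, t.kappa_comm]
    refine hy _ (t.grGe_two_le_m (gr_le_grGe ?_ (pr_mem _ _ _)))
    have : (k : ℚ) ≤ -2 := by exact_mod_cast hk2
    push_cast
    linarith
  · push Not at hk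
    exact t.pr_eq_zero hk y

lemma pr_mem_grGe (k : ℤ) {v : 𝔤} (hv : v ∈ grGe F x k) (i : ℚ) :
    pr t.isInternal i v ∈ grGe F x k := by
  by_cases hi : (k : ℚ) / 2 ≤ i
  · exact gr_le_grGe hi (pr_mem _ _ _)
  · rw [(mem_grGe_iff t.isInternal).1 hv i (not_le.1 hi)]
    exact zero_mem _

lemma pr_mem_sup {U : Submodule F 𝔤} (hU : U ≤ gr x (1 / 2)) {v : 𝔤} (hv : v ∈ U ⊔ grGeOne x)
    (i : ℚ) : pr t.isInternal i v ∈ U ⊔ grGeOne x := by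
  obtain ⟨a, ha, b, hb, rfl⟩ := Submodule.mem_sup.1 hv
  rw [map_add]
  refine add_mem (Submodule.mem_sup_left ?_) (Submodule.mem_sup_right ?_)
  · by_cases hi : 1 / 2 = i
    · subst hi; rwa [pr_of_mem _ (hU ha)]
    · rw [pr_of_mem_ne _ hi (hU ha)]; exact zero_mem _
  · rw [grGeOne_eq] at hb ⊢
    exact t.pr_mem_grGe 2 hb i

lemma pr_mem_n {v : 𝔤} (hv : v ∈ subN κ f x l) (i : ℚ) :
    pr t.isInternal i v ∈ subN κ f x l :=
  t.pr_mem_sup symplCompl_le hv i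

lemma pr_mem_m {v : 𝔤} (hv : v ∈ subM x l) (i : ℚ) :
    pr t.isInternal i v ∈ subM x l :=
  t.pr_mem_sup t.l_le hv i

lemma pr_mem_mPerp {v : 𝔤} (hv : v ∈ mPerp κ x l) (i : ℚ) :
    pr t.isInternal i v ∈ mPerp κ x l := by
  intro b hb
  change κ b (pr t.isInternal i v) = 0
  rw [t.kappa_comm, t.kappa_pr i (-i) rfl, t.kappa_comm]
  exact hv _ (t.pr_mem_m hb _)

lemma lie_f_injective_n {a : 𝔤} (ha : a ∈ subN κ f x l) (h : ⁅f, a⁆ = 0) : a = 0 := by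
  have h0 : a ∈ (⊥ : Submodule F 𝔤) := by
    refine mem_of_pr_mem t.isInternal fun i => ?_
    rw [Submodule.mem_bot]
    by_cases hi : i < ((1 : ℤ) : ℚ) / 2
    · exact (mem_grGe_iff t.isInternal).1 (t.n_le ha) i hi
    · refine t.eq_zero_of_lie_f (i := i) ?_ (pr_mem _ _ _) ?_
      · push Not at hi; push_cast at hi; linarith
      · rw [← pr_lie t.isInternal (i - 1) i (by ring) t.f_mem, h, map_zero]
  simpa using h0

/-- The inverse of `ad f` on `[f, n]`, extended by zero to `V`, can be chosen homogeneous. -/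
lemma exists_theta {V : Submodule F 𝔤} (hV : IsGraded x V)
    (hdisj : Disjoint (lieFN κ f x l) V) :
    ∃ θ : 𝔤 →ₗ[F] 𝔤, (∀ a ∈ subN κ f x l, θ ⁅f, a⁆ = a) ∧ (∀ a ∈ V, θ a = 0) ∧
      ∀ (i : ℚ), ∀ a ∈ gr (F := F) x i, θ a ∈ gr (F := F) x (i + 1) := by
  let φ : (subN κ f x l × V) →ₗ[F] 𝔤 :=
    ((LieAlgebra.ad F 𝔤 f : 𝔤 →ₗ[F] 𝔤) ∘ₗ (subN κ f x l).subtype).coprod V.subtype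
  have hφ : LinearMap.ker φ = ⊥ := by
    rw [LinearMap.ker_eq_bot']
    rintro ⟨⟨a, ha⟩, ⟨v, hv⟩⟩ hav
    have hav' : ⁅f, a⁆ + v = 0 := hav
    have hm : ⁅f, a⁆ ∈ lieFN κ f x l := ⟨a, ha, rfl⟩
    have hv2 : ⁅f, a⁆ ∈ V := by
      rw [eq_neg_of_add_eq_zero_left hav']
      exact neg_mem hv
    have h0 := Submodule.disjoint_def.1 hdisj _ hm hv2
    rw [h0, zero_add] at hav'
    simp [t.lie_f_injective_n ha h0, hav']
  obtain ⟨ψ, hψ⟩ := LinearMap.exists_leftInverse_of_injective φ hφ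
  let θ₀ : 𝔤 →ₗ[F] 𝔤 := (subN κ f x l).subtype ∘ₗ LinearMap.fst F _ _ ∘ₗ ψ
  have h1 : ∀ a ∈ subN κ f x l, θ₀ ⁅f, a⁆ = a := by
    intro a ha
    have := LinearMap.congr_fun hψ (⟨a, ha⟩, 0)
    simp only [LinearMap.comp_apply, φ, LinearMap.coprod_apply, map_zero, add_zero,
      Submodule.subtype_apply, LieAlgebra.ad_apply, LinearMap.id_apply] at this
    simp [θ₀, this]
  have h2 : ∀ a ∈ V, θ₀ a = 0 := by
    intro a ha
    have := LinearMap.congr_fun hψ (0, ⟨a, ha⟩)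
    simp only [LinearMap.comp_apply, φ, LinearMap.coprod_apply, map_zero, zero_add,
      Submodule.subtype_apply, LinearMap.id_apply] at this
    simp [θ₀, this]
  have h := t.isInternal
  obtain ⟨s, hs⟩ := exists_finset_sum_pr h
  refine ⟨gradedLift h fun j => pr h (j + 1) ∘ₗ θ₀, fun a ha => ?_, fun a ha => ?_,
    fun i a ha => ?_⟩
  · nth_rewrite 1 [← hs a]
    nth_rewrite 2 [← hs a]
    rw [lie_sum, map_sum]
    refine Finset.sum_congr rfl fun i _ => ?_
    rw [gradedLift_apply h _ (lie_mem_gr t.f_mem (pr_mem h i a)), LinearMap.comp_apply,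
      h1 _ (t.pr_mem_n ha i), show -1 + i + 1 = i by ring, pr_of_mem h (pr_mem h i a)]
  · nth_rewrite 1 [← hs a]
    rw [map_sum]
    refine Finset.sum_eq_zero fun i _ => ?_
    rw [gradedLift_apply h _ (pr_mem h i a), LinearMap.comp_apply,
      h2 _ (pr_mem_of_isGraded h hV ha i), map_zero]
  · rw [gradedLift_apply h _ ha]
    exact pr_mem _ _ _

/-- The gauge slice attached to `V`. Its map `θ` is homogeneous. -/
theorem exists_slice {V : Submodule F 𝔤} (hV : IsGraded x V)
    (hdisj : Disjoint (lieFN κ f x l) V) (hsup : lieFN κ f x l ⊔ V = mPerp κ x l) :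
    ∃ S : GaugeSlice F 𝔤, S.f = f ∧ S.n = subN κ f x l ∧ S.M = mPerp κ x l ∧ S.V = V ∧
      ∀ (i : ℚ), ∀ a ∈ gr (F := F) x i, S.θ a ∈ gr (F := F) x (i + 1) := by
  obtain ⟨θ, h1, h2, h3⟩ := t.exists_theta hV hdisj
  have h := t.isInternal
  obtain ⟨s, hs⟩ := exists_finset_sum_pr h
  obtain ⟨B, hB⟩ : ∃ B : ℕ, ∀ i ∈ s, |i| ≤ B := by
    obtain ⟨b, hb⟩ := (s.finite_toSet.image fun i => |i|).bddAbove
    obtain ⟨B, hB⟩ := exists_nat_ge b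
    exact ⟨B, fun i hi => (hb ⟨i, hi, rfl⟩).trans hB⟩
  have hdec : ∀ y ∈ mPerp κ x l, ∃ a ∈ subN κ f x l, ∃ v ∈ V, y = ⁅f, a⁆ + v ∧ θ y = a := by
    intro y hy
    rw [← hsup] at hy
    obtain ⟨_, ⟨a, ha, rfl⟩, v, hv, rfl⟩ := Submodule.mem_sup.1 hy
    exact ⟨a, ha, v, hv, rfl, by rw [map_add, LieAlgebra.ad_apply, h1 a ha, h2 v hv, add_zero]⟩
  refine ⟨
    { f := f
      G := grGe F x
      n := subN κ f x l
      M := mPerp κ x l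
      V := V
      θ := θ
      lo := -(2 * B)
      N := 4 * B + 1
      N_pos := by omega
      lie_mem_G := lie_mem_grGe
      G_anti := grGe_anti
      G_lo := ?_
      G_hi := ?_
      f_mem := gr_le_grGe (by norm_num) t.f_mem
      n_le := t.n_le
      M_le := t.mPerp_le
      n_le_M := t.n_le_mPerp
      V_le_M := hsup ▸ le_sup_right
      lie_n_n := fun ha hb => t.grGe_two_le_n (lie_mem_grGe (k := 1) (l := 1) (t.n_le ha)
        (t.n_le hb))
      lie_n_M := t.lie_n_mPerp
      lie_n_f := t.lie_n_f
      θ_lie := fun ha => h1 _ ha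
      θ_V := fun ha => h2 _ ha
      θ_M := ?_
      sub_lie_θ_mem := ?_
      θ_G := ?_ }, rfl, rfl, rfl, rfl, h3⟩
  · rw [eq_top_iff]
    intro v _
    rw [← hs v]
    refine sum_mem fun i hi => gr_le_grGe ?_ (pr_mem h i v)
    have := (abs_le.1 (hB i hi)).1
    push_cast
    linarith
  · rw [eq_bot_iff]
    intro v hv
    rw [mem_grGe_iff h] at hv
    rw [Submodule.mem_bot, ← hs v]
    refine Finset.sum_eq_zero fun i hi => hv i ?_
    have := (abs_le.1 (hB i hi)).2
    push_cast
    linarith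
  · intro y hy
    obtain ⟨a, ha, v, hv, rfl, hθ⟩ := hdec y hy
    rwa [hθ]
  · intro y hy
    obtain ⟨a, ha, v, hv, rfl, hθ⟩ := hdec y hy
    rw [hθ]
    simpa using hv
  · intro k a ha
    have : grGe F x k ≤ (grGe F x (k + 2)).comap θ := by
      refine iSup₂_le fun i hi a ha => gr_le_grGe ?_ (h3 i a ha)
      push_cast
      linarith
    exact this ha

/-- The double orthogonal of `l` in `𝔤_{1/2}` with respect to the symplectic form `ω` is `l`. -/
lemma mem_l_of_omega {b : 𝔤} (hb : b ∈ gr (F := F) x (1 / 2))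
    (h : ∀ a ∈ symplCompl κ f x l, κ f ⁅b, a⁆ = 0) : b ∈ l := by
  let B : LinearMap.BilinForm F (gr (F := F) x (1 / 2)) :=
    LinearMap.mk₂ F (fun a b => κ f ⁅(a : 𝔤), (b : 𝔤)⁆) (by simp) (by simp) (by simp) (by simp)
  have hB : ∀ a b, B a b = κ f ⁅(a : 𝔤), (b : 𝔤)⁆ := fun a b => rfl
  have hskew : ∀ a b, B a b = - B b a := fun a b => by
    rw [hB, hB, ← lie_skew, map_neg]
  have hrefl : B.IsRefl := fun a b hab => by rw [hskew, hab, neg_zero]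
  have hnd : B.Nondegenerate := by
    refine (LinearMap.IsRefl.nondegenerate_iff_separatingLeft hrefl).2 fun a ha => ?_
    have : ⁅f, (a : 𝔤)⁆ = 0 := by
      refine t.nondeg.1 _ fun c => ?_
      have hpr : ⁅f, (a : 𝔤)⁆ = pr t.isInternal (-(1 / 2)) ⁅f, (a : 𝔤)⁆ := by
        rw [pr_of_mem]
        have := lie_mem_gr t.f_mem a.2
        norm_num at this ⊢
        exact this
      rw [hpr, t.kappa_pr _ (1 / 2) (by norm_num), t.kappa_lie']
      exact ha ⟨_, pr_mem _ _ c⟩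
    exact Subtype.ext (t.eq_zero_of_lie_f (by norm_num) a.2 this)
  have hW := LinearMap.BilinForm.orthogonal_orthogonal hnd hrefl
    (l.comap (gr (F := F) x (1 / 2)).subtype)
  have hmem : (⟨b, hb⟩ : gr (F := F) x (1 / 2)) ∈
      B.orthogonal (B.orthogonal (l.comap (gr (F := F) x (1 / 2)).subtype)) := by
    intro a ha
    change B a _ = 0
    rw [hskew, hB, neg_eq_zero]
    refine h _ ⟨a.2, fun c hc => ?_⟩
    have := ha ⟨c, t.l_le hc⟩ hc
    change B _ a = 0 at this
    rw [hskew, neg_eq_zero] at this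
    exact this
  rw [hW] at hmem
  exact hmem

/-- The orthogonal complement of `[f, n]` is `m ⊕ 𝔤^f`. -/
lemma orthogonal_lieFN : κ.orthogonal (lieFN κ f x l) =
    subM x l ⊔ LinearMap.ker (LieAlgebra.ad F 𝔤 f) := by
  have h := t.isInternal
  refine le_antisymm ?_ (sup_le ?_ ?_)
  · intro b hb
    have hb' : ∀ a ∈ subN κ f x l, κ b ⁅f, a⁆ = 0 := fun a ha => by
      rw [t.kappa_comm]; exact hb _ ⟨a, ha, rfl⟩
    have hbi : ∀ i, ∀ a ∈ subN κ f x l, κ (pr h i b) ⁅f, a⁆ = 0 := fun i a ha => by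
      rw [t.kappa_pr i (-i) rfl, pr_lie h (-i) (-i + 1) (by ring) t.f_mem]
      exact hb' _ (t.pr_mem_n ha _)
    refine mem_of_pr_mem h fun i => ?_
    have hmem := pr_mem h i b
    rcases le_or_gt i 0 with hi | hi
    · refine Submodule.mem_sup_right ?_
      rw [LinearMap.mem_ker, LieAlgebra.ad_apply]
      refine t.nondeg.1 _ fun c => ?_
      have hpr : ⁅f, pr h i b⁆ = pr h (-1 + i) ⁅f, pr h i b⁆ := by
        rw [pr_of_mem h (lie_mem_gr t.f_mem hmem)]
      rw [hpr, t.kappa_pr _ (1 - i) (by ring), t.kappa_lie, hbi, neg_zero]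
      exact t.grGe_two_le_n (gr_le_grGe (by push_cast; linarith) (pr_mem h _ _))
    · refine Submodule.mem_sup_left ?_
      by_cases hk : ∃ k : ℤ, i = k / 2
      · obtain ⟨k, rfl⟩ := hk
        have hk0 : 0 < k := by
          have : (0 : ℚ) < k := by linarith
          exact_mod_cast this
        rcases eq_or_lt_of_le (show 1 ≤ k by omega) with rfl | hk1
        · refine Submodule.mem_sup_left (t.mem_l_of_omega (by simpa using hmem) fun a ha => ?_)
          rw [← t.kappa_lie', t.kappa_lie, hbi _ a (Submodule.mem_sup_left ha), neg_zero]
        · refine t.grGe_two_le_m (gr_le_grGe ?_ hmem)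
          have : (2 : ℚ) ≤ k := by exact_mod_cast hk1
          push_cast
          linarith
      · push Not at hk
        rw [t.pr_eq_zero hk]
        exact zero_mem _
  · rintro b hb _ ⟨a, ha, rfl⟩
    change κ ⁅f, a⁆ b = 0
    rw [t.kappa_lie', t.kappa_f_lie ha hb]
  · rintro b hb _ ⟨a, ha, rfl⟩
    change κ ⁅f, a⁆ b = 0
    rw [LinearMap.mem_ker, LieAlgebra.ad_apply] at hb
    rw [t.kappa_lie, hb, map_zero, neg_zero]

/-- `𝔤^f ⊆ 𝔤_{≤ 0}` -/
lemma ker_le : LinearMap.ker (LieAlgebra.ad F 𝔤 f) ≤ ⨆ (i : ℚ) (_ : i ≤ 0), gr (F := F) x i := by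
  intro b hb
  rw [LinearMap.mem_ker, LieAlgebra.ad_apply] at hb
  rw [mem_iSup_gr_iff t.isInternal]
  intro i hi
  refine t.eq_zero_of_lie_f (not_le.1 hi) (pr_mem _ _ _) ?_
  rw [← pr_lie t.isInternal (i - 1) i (by ring) t.f_mem, hb, map_zero]

lemma disjoint_m_ker : Disjoint (subM x l) (LinearMap.ker (LieAlgebra.ad F 𝔤 f)) := by
  rw [Submodule.disjoint_def]
  intro b hb hb'
  have h1 := (mem_grGe_iff t.isInternal).1 (t.m_le hb)
  have h2 := (mem_iSup_gr_iff t.isInternal _).1 (t.ker_le hb')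
  have h0 : b ∈ (⊥ : Submodule F 𝔤) := by
    refine mem_of_pr_mem t.isInternal fun i => ?_
    rw [Submodule.mem_bot]
    rcases le_or_gt i 0 with hi | hi
    · exact h1 i (by push_cast; linarith)
    · exact h2 i (not_le.2 hi)
  simpa using h0

/-- The dimension of a slice is that of the centralizer of `f`. -/
theorem finrank_eq {V : Submodule F 𝔤} (hdisj : Disjoint (lieFN κ f x l) V)
    (hsup : lieFN κ f x l ⊔ V = mPerp κ x l) :
    Module.finrank F V = Module.finrank F (LinearMap.ker (LieAlgebra.ad F 𝔤 f)) := by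
  have h1 := LinearMap.BilinForm.finrank_orthogonal t.nondeg (lieFN κ f x l)
  have h2 := LinearMap.BilinForm.finrank_orthogonal t.nondeg (subM x l)
  have h3 := Submodule.finrank_sup_add_finrank_inf_eq (lieFN κ f x l) V
  have h4 := Submodule.finrank_sup_add_finrank_inf_eq (subM x l)
    (LinearMap.ker (LieAlgebra.ad F 𝔤 f))
  rw [hdisj.eq_bot, finrank_bot, add_zero, hsup] at h3
  rw [t.disjoint_m_ker.eq_bot, finrank_bot, add_zero, ← t.orthogonal_lieFN] at h4
  change Module.finrank F (mPerp κ x l) = _ at h2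
  have h5 := Submodule.finrank_le (lieFN κ f x l)
  have h6 := Submodule.finrank_le (subM x l)
  omega

lemma ker_le_of_isGraded {p : Submodule F 𝔤} (hp : IsGraded x p) (hmp : IsCompl (subM x l) p) :
    LinearMap.ker (LieAlgebra.ad F 𝔤 f) ≤ p := by
  refine t.ker_le.trans (iSup₂_le fun i hi b hb => ?_)
  have hb' : b ∈ subM x l ⊔ p := by rw [hmp.sup_eq_top]; exact Submodule.mem_top
  obtain ⟨m, hm, c, hc, rfl⟩ := Submodule.mem_sup.1 hb'
  rw [← pr_of_mem t.isInternal hb, map_add,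
    (mem_grGe_iff t.isInternal).1 (t.m_le hm) i (by push_cast; linarith), zero_add]
  exact pr_mem_of_isGraded t.isInternal hp hc i

/-- If `p` is graded, then `𝔤^f` is the orthogonal complement of `[f, n]` in `p`. -/
lemma ker_eq_inf {p : Submodule F 𝔤} (hp : IsGraded x p) (hmp : IsCompl (subM x l) p) :
    LinearMap.ker (LieAlgebra.ad F 𝔤 f) = p ⊓ κ.orthogonal (lieFN κ f x l) := by
  have h := t.ker_le_of_isGraded hp hmp
  rw [t.orthogonal_lieFN]
  refine le_antisymm (le_inf h le_sup_right) ?_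
  rintro b ⟨hb, hb'⟩
  obtain ⟨m, hm, c, hc, rfl⟩ := Submodule.mem_sup.1 hb'
  have : m ∈ p := by simpa using sub_mem hb (h hc)
  rw [Submodule.disjoint_def.1 hmp.disjoint m hm this, zero_add]
  exact hc

end Setting

end Slice

/-! ### Variations of differential polynomials -/

section Variation

open MvPolynomial

variable {F : Type*} [Field F] {I J : Type*} {R : Type*} [CommRing R] [Algebra F R]

/-- The homomorphism of differential algebras `DP F J → R` with `u_j ↦ c j`. -/
def diffHom (d : Derivation F R R) (c : J → R) : DP F J →ₐ[F] R :=
  aeval fun k : J × ℕ => d^[k.2] (c k.1)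

lemma der_iterate_X (j : J) (m n : ℕ) :
    (der F J)^[n] (X (j, m)) = X (j, m + n) := by
  induction n with
  | zero => rfl
  | succ n ih =>
    rw [Function.iterate_succ_apply', ih, der, mkDerivation_X, add_assoc]

/-- An algebra homomorphism which commutes with the derivations on the variables is a homomorphism
of differential algebras. -/
lemma comm_der {ψ : DP F J →ₐ[F] R} {d : Derivation F R R}
    (h : ∀ j n, ψ (X (j, n + 1)) = d (ψ (X (j, n)))) (g : DP F J) : ψ (der F J g) = d (ψ g) := by
  induction g using MvPolynomial.induction_on with
  | C a => simp [MvPolynomial.algHom_C]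
  | add p q hp hq => simp [hp, hq]
  | mul_X p k hp =>
    have : der F J (X k) = X (k.1, k.2 + 1) := mkDerivation_X _ _ _
    simp only [Derivation.leibniz, smul_eq_mul, map_add, map_mul, hp, this, h]

lemma diffHom_der (d : Derivation F R R) (c : J → R) (g : DP F J) :
    diffHom d c (der F J g) = d (diffHom d c g) :=
  comm_der (fun j n => by simp [diffHom, Function.iterate_succ_apply']) g

lemma diffHom_X (d : Derivation F R R) (c : J → R) (j : J) (n : ℕ) :
    diffHom d c (X (j, n)) = d^[n] (c j) := by
  simp [diffHom]

lemma diffEval_der (a : I → DP F J) (g : DP F I) :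
    diffEval a (der F I g) = der F J (diffEval a g) := diffHom_der _ a g

lemma diffEval_X (a : I → DP F J) (j : I) (n : ℕ) :
    diffEval a (X (j, n)) = (der F J)^[n] (a j) := diffHom_X _ a j n

lemma map_iterate {ψ : DP F J →ₐ[F] R} {d : Derivation F R R}
    (h : ∀ g, ψ (der F J g) = d (ψ g)) (n : ℕ) (g : DP F J) :
    ψ ((der F J)^[n] g) = d^[n] (ψ g) := by
  induction n generalizing g with
  | zero => rfl
  | succ n ih => rw [Function.iterate_succ_apply, ih, h, Function.iterate_succ_apply]

/-- Homomorphisms of differential algebras out of `DP F J` are determined by their values on the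
generators. -/
lemma algHom_ext_of_comm {ψ ψ' : DP F J →ₐ[F] R} {d : Derivation F R R}
    (h : ∀ g, ψ (der F J g) = d (ψ g)) (h' : ∀ g, ψ' (der F J g) = d (ψ' g))
    (h0 : ∀ j, ψ (X (j, 0)) = ψ' (X (j, 0))) : ψ = ψ' := by
  refine MvPolynomial.algHom_ext fun k => ?_
  obtain ⟨j, n⟩ := k
  have : (X (j, n) : DP F J) = (der F J)^[n] (X (j, 0)) := by rw [der_iterate_X, zero_add]
  rw [this, map_iterate h, map_iterate h', h0]

/-- The derivation along `ψ : DP F J → R` which commutes with the derivations and sends `u_j` to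
`c j`; it is the first variation of `ψ` in the direction `c`. -/
def vary (ψ : DP F J →ₐ[F] R) (d : Derivation F R R) (c : J → R) : DP F J →ₗ[F] R where
  toFun g := ∑ y ∈ g.vars, ψ (pderiv y g) * d^[y.2] (c y.1)
  map_add' g h := by
    classical
    have key : ∀ (g : DP F J) (S : Finset (J × ℕ)), g.vars ⊆ S →
        ∑ y ∈ g.vars, ψ (pderiv y g) * d^[y.2] (c y.1) =
          ∑ y ∈ S, ψ (pderiv y g) * d^[y.2] (c y.1) := fun g S hS =>
      Finset.sum_subset hS fun y _ hy => by
        rw [pderiv_eq_zero_of_notMem_vars hy, map_zero, zero_mul]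
    rw [key _ _ (vars_add_subset g h), key g _ Finset.subset_union_left,
      key h _ Finset.subset_union_right, ← Finset.sum_add_distrib]
    simp [add_mul]
  map_smul' r g := by
    have hS : (r • g).vars ⊆ g.vars := by
      rw [smul_eq_C_mul]
      classical
      refine (vars_mul _ _).trans ?_
      simp
    rw [Finset.sum_subset hS fun y _ hy => by
        rw [pderiv_eq_zero_of_notMem_vars hy, map_zero, zero_mul], RingHom.id_apply,
      Finset.smul_sum]
    simp

variable {ψ : DP F J →ₐ[F] R} {d : Derivation F R R} {c : J → R}

lemma vary_apply (g : DP F J) :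
    vary ψ d c g = ∑ y ∈ g.vars, ψ (pderiv y g) * d^[y.2] (c y.1) := rfl

lemma vary_eq_sum {g : DP F J} {S : Finset (J × ℕ)} (hS : g.vars ⊆ S) :
    vary ψ d c g = ∑ y ∈ S, ψ (pderiv y g) * d^[y.2] (c y.1) :=
  Finset.sum_subset hS fun y _ hy => by
    rw [pderiv_eq_zero_of_notMem_vars hy, map_zero, zero_mul]

lemma vary_C (a : F) : vary ψ d c (C a) = 0 := by
  simp [vary_apply]

lemma vary_X (k : J × ℕ) : vary ψ d c (X k) = d^[k.2] (c k.1) := by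
  simp [vary_apply]

lemma vary_mul (g h : DP F J) : vary ψ d c (g * h) = ψ g * vary ψ d c h + ψ h * vary ψ d c g := by
  classical
  rw [vary_eq_sum (vars_mul g h), vary_eq_sum (g := g) (S := g.vars ∪ h.vars)
    Finset.subset_union_left, vary_eq_sum (g := h) (S := g.vars ∪ h.vars)
    Finset.subset_union_right, Finset.mul_sum, Finset.mul_sum, ← Finset.sum_add_distrib]
  refine Finset.sum_congr rfl fun y _ => ?_
  rw [pderiv_mul, map_add, map_mul, map_mul]
  ring

lemma vary_der (hψ : ∀ g, ψ (der F J g) = d (ψ g)) (g : DP F J) :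
    vary ψ d c (der F J g) = d (vary ψ d c g) := by
  induction g using MvPolynomial.induction_on with
  | C a => simp [vary_C]
  | add p q hp hq => simp [hp, hq]
  | mul_X p k hp =>
    have h1 : der F J (X k) = X (k.1, k.2 + 1) := mkDerivation_X _ _ _
    have h2 : vary ψ d c (der F J (X k)) = d (vary ψ d c (X k)) := by
      rw [h1, vary_X, vary_X, Function.iterate_succ_apply']
    simp only [Derivation.leibniz, smul_eq_mul, map_add, vary_mul, hp, h2, hψ]
    ring

lemma vary_iterate (hψ : ∀ g, ψ (der F J g) = d (ψ g)) (n : ℕ) (g : DP F J) :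
    vary ψ d c ((der F J)^[n] g) = d^[n] (vary ψ d c g) := by
  induction n generalizing g with
  | zero => rfl
  | succ n ih => rw [Function.iterate_succ_apply, ih, vary_der hψ, Function.iterate_succ_apply]

/-- The chain rule. -/
lemma vary_diffEval (hψ : ∀ g, ψ (der F J g) = d (ψ g)) (a : I → DP F J) (g : DP F I) :
    vary ψ d c (diffEval a g) = vary (ψ.comp (diffEval a)) d (fun i => vary ψ d c (a i)) g := by
  induction g using MvPolynomial.induction_on with
  | C r => rw [vary_C, MvPolynomial.algHom_C, MvPolynomial.algebraMap_eq, vary_C]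
  | add p q hp hq => simp [hp, hq]
  | mul_X p k hp =>
    obtain ⟨i, n⟩ := k
    rw [map_mul, vary_mul, vary_mul, hp, vary_X, diffEval_X, vary_iterate hψ, AlgHom.comp_apply,
      AlgHom.comp_apply, diffEval_X]

/-- A derivation along `ψ` commuting with `d` is a variation. -/
lemma eq_vary {D : DP F J →ₗ[F] R}
    (hmul : ∀ g h, D (g * h) = ψ g * D h + ψ h * D g) (hD : ∀ g, D (der F J g) = d (D g))
    (g : DP F J) : D g = vary ψ d (fun j => D (X (j, 0))) g := by
  have h1 : D 1 = 0 := by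
    have := hmul 1 1
    simp only [mul_one, map_one, one_mul] at this
    simpa using this
  have hX : ∀ j n, D (X (j, n)) = d^[n] (D (X (j, 0))) := by
    intro j n
    induction n with
    | zero => rfl
    | succ n ih =>
      have h2 : (X (j, n + 1) : DP F J) = der F J (X (j, n)) := (der_iterate_X j n 1).symm
      rw [h2, hD, ih, Function.iterate_succ_apply']
  induction g using MvPolynomial.induction_on with
  | C r =>
    rw [vary_C, ← mul_one (C r), ← smul_eq_C_mul, map_smul, h1, smul_zero]
  | add p q hp hq => simp [hp, hq]
  | mul_X p k hp => rw [hmul, vary_mul, hp, vary_X, hX]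

/-- `H(λ) ↦ H(∂) φ`, for a polynomial `H` in `λ` with coefficients taken to `R` by `ψ`. -/
def symb (ψ : DP F J →ₐ[F] R) (d : Derivation F R R) (φ : R) : Polynomial (DP F J) →ₗ[F] R :=
  Polynomial.lsum fun k => LinearMap.mulRight F (d^[k] φ) ∘ₗ ψ.toLinearMap

lemma symb_monomial (φ : R) (k : ℕ) (g : DP F J) :
    symb ψ d φ (Polynomial.monomial k g) = ψ g * d^[k] φ := by
  simp [symb, Polynomial.lsum]

lemma symb_C_mul (φ : R) (g : DP F J) (H : Polynomial (DP F J)) :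
    symb ψ d φ (Polynomial.C g * H) = ψ g * symb ψ d φ H := by
  induction H using Polynomial.induction_on' with
  | add p q hp hq => simp only [mul_add, map_add, hp, hq]
  | monomial k h =>
    rw [Polynomial.C_mul_monomial, symb_monomial, symb_monomial, map_mul, mul_assoc]

lemma derCoeff_monomial (k : ℕ) (g : DP F J) :
    derCoeff (Polynomial.monomial k g) = Polynomial.monomial k (der F J g) := by
  change (Polynomial.monomial k g).sum (fun n c => Polynomial.monomial n (der F J c)) = _
  rw [Polynomial.sum_monomial_index _ _ (by simp)]

lemma lamDer_monomial (k : ℕ) (g : DP F J) :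
    lamDer (Polynomial.monomial k g) =
      Polynomial.monomial (k + 1) g + Polynomial.monomial k (der F J g) := by
  rw [lamDer, LinearMap.add_apply, LinearMap.mulLeft_apply, derCoeff_monomial,
    Polynomial.X_mul_monomial]

lemma symb_lamDer (hψ : ∀ g, ψ (der F J g) = d (ψ g)) (φ : R) (H : Polynomial (DP F J)) :
    symb ψ d φ (lamDer H) = d (symb ψ d φ H) := by
  induction H using Polynomial.induction_on' with
  | add p q hp hq => simp only [map_add, hp, hq]
  | monomial k h =>
    rw [lamDer_monomial, map_add, symb_monomial, symb_monomial, symb_monomial, hψ,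
      Derivation.leibniz, Function.iterate_succ_apply', smul_eq_mul, smul_eq_mul]
    ring

lemma symb_lamDer_pow (hψ : ∀ g, ψ (der F J g) = d (ψ g)) (φ : R) (n : ℕ)
    (H : Polynomial (DP F J)) : symb ψ d φ ((lamDer ^ n) H) = d^[n] (symb ψ d φ H) := by
  induction n with
  | zero => rfl
  | succ n ih =>
    rw [pow_succ', Module.End.mul_apply, symb_lamDer hψ, ih, Function.iterate_succ_apply']

lemma symb_map (ρ : DP F I →ₐ[F] DP F J) (φ : R) (H : Polynomial (DP F I)) :
    symb ψ d φ (H.map ρ.toRingHom) = symb (ψ.comp ρ) d φ H := by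
  induction H using Polynomial.induction_on' with
  | add p q hp hq => simp only [Polynomial.map_add, map_add, hp, hq]
  | monomial k h =>
    rw [Polynomial.map_monomial, symb_monomial, symb_monomial]
    rfl

/-- A differential operator with coefficients in `DP F J` which vanishes on `DP F J` is zero. -/
lemma eq_zero_of_symb [Nonempty J] {H : Polynomial (DP F J)}
    (h : ∀ φ, symb (AlgHom.id F _) (der F J) φ H = 0) : H = 0 := by
  classical
  obtain ⟨j⟩ := ‹Nonempty J›
  -- a jet order exceeding those occurring in the coefficients of `H`
  obtain ⟨N, hN⟩ : ∃ N : ℕ, ∀ k ∈ H.support, ∀ y ∈ (H.coeff k).vars, y.2 < N := by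
    refine ⟨(H.support.biUnion fun k => (H.coeff k).vars).sup (fun y => y.2) + 1,
      fun k hk y hy => Nat.lt_succ_of_le ?_⟩
    exact Finset.le_sup (f := fun y : J × ℕ => y.2) (Finset.mem_biUnion.2 ⟨k, hk, hy⟩)
  ext1 k₀
  rw [Polynomial.coeff_zero]
  by_cases hk₀ : k₀ ∈ H.support
  swap
  · exact Polynomial.notMem_support_iff.1 hk₀
  have h1 := congrArg (pderiv (j, N + k₀)) (h (X (j, N)))
  have hsum : symb (AlgHom.id F _) (der F J) (X (j, N)) H =
      ∑ k ∈ H.support, H.coeff k * X (j, N + k) := by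
    conv_lhs => rw [H.as_sum_support]
    rw [map_sum]
    refine Finset.sum_congr rfl fun k _ => ?_
    rw [symb_monomial, der_iterate_X, AlgHom.id_apply]
  rw [hsum, map_sum, map_zero, Finset.sum_eq_single k₀] at h1
  · rw [pderiv_mul, pderiv_X_self, mul_one, pderiv_eq_zero_of_notMem_vars (fun hy => by
      have := hN _ hk₀ _ hy; simp at this), zero_mul, zero_add] at h1
    exact h1
  · intro k hk hkk
    rw [pderiv_mul, pderiv_X_of_ne (by simpa using hkk), mul_zero, add_zero,
      pderiv_eq_zero_of_notMem_vars (fun hy => by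
        have := hN _ hk _ hy; simp at this), zero_mul]
  · intro hk; exact absurd hk₀ hk

end Variation

/-! ### The affine bracket with an element of `𝔤` -/

section Bracket

open MvPolynomial

variable {F : Type*} [Field F] {𝔤 : Type*} [LieRing 𝔤] [LieAlgebra F 𝔤] {I : Type*}

lemma gen_basis {M : Type*} [AddCommGroup M] [Module F M] (u : Module.Basis I F M) (i : I) :
    gen u (u i) = X (i, 0) := by
  simp [gen]

lemma gen_eq_sum {M : Type*} [AddCommGroup M] [Module F M] (u : Module.Basis I F M) (a : M) :
    gen u a = ∑ i ∈ (u.repr a).support, (u.repr a) i • (X (i, 0) : DP F I) := by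
  rw [gen, Module.Basis.constr_apply, Finsupp.sum]

lemma lamDer_pow_C (r : F) (n : ℕ) :
    (lamDer ^ n) (Polynomial.C (C r : DP F I)) = Polynomial.monomial n (C r) := by
  induction n with
  | zero => simp
  | succ n ih =>
    rw [pow_succ', Module.End.mul_apply, ih, lamDer_monomial, MvPolynomial.derivation_C]
    simp

lemma applyLamDer_C (H : Polynomial (DP F I)) (r : F) :
    applyLamDer H (Polynomial.C (C r)) = r • H := by
  have : ∀ k c, Polynomial.C c * (lamDer ^ k) (Polynomial.C (C r : DP F I)) =
      Polynomial.monomial k (r • c) := fun k c => by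
    rw [lamDer_pow_C, Polynomial.C_mul_monomial, smul_eq_C_mul, mul_comm]
  rw [applyLamDer]
  simp only [this]
  conv_rhs => rw [← Polynomial.sum_monomial_eq H]
  rw [Polynomial.sum_def, Polynomial.sum_def, Finset.smul_sum]
  exact Finset.sum_congr rfl fun k _ => (Polynomial.smul_monomial _ _ _).symm

lemma applyLamDer_zero (H : Polynomial (DP F I)) : applyLamDer H 0 = 0 := by
  simp [applyLamDer, Polynomial.sum_def]

variable (κ : LinearMap.BilinForm F 𝔤) (s : 𝔤) (z : F) (u : Module.Basis I F 𝔤)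

/-- The bracket `{a_λ G}` for `a ∈ 𝔤`: in the Master Formula only `m = 0` contributes, and `∂a/∂u_i`
is constant. -/
lemma affineBracket_gen (a : 𝔤) (G : DP F I) :
    affineBracket κ s z u (gen u a) G = ∑ y ∈ G.vars, Polynomial.C (pderiv y G) *
      (lamDer ^ y.2) (Polynomial.C (gen u ⁅a, u y.1⁆)
        + Polynomial.C (algebraMap F (DP F I) (κ a (u y.1))) * Polynomial.X
        + Polynomial.C (algebraMap F (DP F I) (z * κ s ⁅a, u y.1⁆))) := by
  classical
  rw [affineBracket, masterBracket]
  refine Finset.sum_congr rfl fun y _ => ?_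
  set H : I → Polynomial (DP F I) := fun i => Polynomial.C (gen u ⁅u i, u y.1⁆)
      + Polynomial.C (algebraMap F (DP F I) (κ (u i) (u y.1))) * Polynomial.X
      + Polynomial.C (algebraMap F (DP F I) (z * κ s ⁅u i, u y.1⁆)) with hH
  rw [← Finset.mul_sum, ← map_sum]
  congr 2
  have hpd : ∀ k : I × ℕ, pderiv k (gen u a) = if k.2 = 0 then C (u.repr a k.1) else 0 := by
    rintro ⟨i, n⟩
    rw [gen_eq_sum, map_sum]
    simp only [Derivation.map_smul, pderiv_X, Pi.single_apply, Prod.mk.injEq]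
    by_cases hn : n = 0
    · subst hn
      simp only [and_true, if_true, smul_ite, smul_zero]
      rw [Finset.sum_ite_eq' (u.repr a).support i]
      split_ifs with hi
      · rw [smul_eq_C_mul, mul_one]
      · rw [Finsupp.notMem_support_iff.1 hi, map_zero]
    · simp [Ne.symm hn, hn]
  set T : I × ℕ → Polynomial (DP F I) := fun k => applyLamDer (H k.1)
    (((-lamDer : Module.End F (Polynomial (DP F I))) ^ k.2)
      (Polynomial.C (pderiv k (gen u a)))) with hT
  have hT0 : ∀ k, pderiv k (gen u a) = 0 → T k = 0 := fun k hk => by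
    rw [hT]; simp only [hk, map_zero, applyLamDer_zero]
  have h1 : ∑ k ∈ (gen u a).vars, T k = ∑ i ∈ (u.repr a).support, T (i, 0) := by
    let ι : I ↪ I × ℕ := ⟨fun i => (i, 0), fun i j h => by simpa using h⟩
    have hmap : ∑ i ∈ (u.repr a).support, T (i, 0) = ∑ k ∈ (u.repr a).support.map ι, T k :=
      (Finset.sum_map (u.repr a).support ι T).symm
    rw [hmap]
    refine Finset.sum_subset_zero_on_sdiff (fun k hk => ?_) (fun k hk => ?_) (fun _ _ => rfl)
    · by_contra hk2
      refine (Finset.mem_map.not.1 hk2) ⟨k.1, ?_, ?_⟩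
      · by_contra hk3
        rw [Finsupp.notMem_support_iff] at hk3
        rw [gen_eq_sum] at hk
        obtain ⟨i, hi, hki⟩ := Finset.mem_biUnion.1 (vars_sum_subset _ _ hk)
        rw [smul_eq_C_mul] at hki
        have := vars_mul _ _ hki
        simp only [vars_C, Finset.empty_union, vars_X, Finset.mem_singleton] at this
        rw [this] at hk3
        exact (Finsupp.mem_support_iff.1 hi) hk3
      · rw [gen_eq_sum] at hk
        obtain ⟨i, hi, hki⟩ := Finset.mem_biUnion.1 (vars_sum_subset _ _ hk)
        rw [smul_eq_C_mul] at hki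
        have := vars_mul _ _ hki
        simp only [vars_C, Finset.empty_union, vars_X, Finset.mem_singleton] at this
        rw [this]
        rfl
    · exact hT0 k (pderiv_eq_zero_of_notMem_vars (Finset.mem_sdiff.1 hk).2)
  rw [h1]
  have h2 : ∀ i, T (i, 0) = (u.repr a) i • H i := fun i => by
    rw [hT]
    simp only [hpd, if_true, pow_zero, Module.End.one_apply]
    exact applyLamDer_C _ _
  simp only [h2]
  -- both sides are linear in `a`
  let Φ : 𝔤 →ₗ[F] Polynomial (DP F I) :=
    { toFun := fun a => Polynomial.C (gen u ⁅a, u y.1⁆)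
        + Polynomial.C (algebraMap F (DP F I) (κ a (u y.1))) * Polynomial.X
        + Polynomial.C (algebraMap F (DP F I) (z * κ s ⁅a, u y.1⁆))
      map_add' := fun a b => by
        simp only [add_lie, map_add, LinearMap.add_apply, mul_add, add_mul]
        abel
      map_smul' := fun r a => by
        simp only [smul_lie, map_smul, LinearMap.smul_apply, RingHom.id_apply, smul_add,
          smul_eq_mul, map_mul]
        simp only [Algebra.smul_def, Polynomial.algebraMap_apply, map_mul]
        simp only [MvPolynomial.algebraMap_eq]
        ring }
  change _ = Φ a
  conv_rhs => rw [← u.linearCombination_repr a, Finsupp.linearCombination_apply, Finsupp.sum,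
    map_sum]
  simp only [map_smul]
  rfl

end Bracket

/-! ### The `W`-algebra and infinitesimal gauge invariance -/

section Dual

variable {F : Type*} [Field F] {𝔤 : Type*} [LieRing 𝔤] [LieAlgebra F 𝔤]
  {κ : LinearMap.BilinForm F 𝔤} {U U' : Submodule F 𝔤} {P : Type*} [Fintype P] [DecidableEq P]
  {q : Module.Basis P F U} {q' : Module.Basis P F U'}
  (hq : ∀ i j, κ (q' i : 𝔤) (q j : 𝔤) = if i = j then 1 else 0)
include hq

lemma sum_dual {a : 𝔤} (ha : a ∈ U') : ∑ i, κ a (q i) • (q' i : 𝔤) = a := by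
  have h := q'.sum_repr ⟨a, ha⟩
  have h1 : ∑ i, q'.repr ⟨a, ha⟩ i • (q' i : 𝔤) = a := by
    have := congrArg (Submodule.subtype _) h
    rw [map_sum] at this
    simpa only [map_smul, Submodule.subtype_apply] using this
  conv_rhs => rw [← h1]
  refine Finset.sum_congr rfl fun j _ => ?_
  congr 1
  conv_lhs => rw [← h1]
  simp [hq]

lemma sum_dual' {b : 𝔤} (hb : b ∈ U) : ∑ i, κ (q' i) b • (q i : 𝔤) = b := by
  have h := q.sum_repr ⟨b, hb⟩
  have h1 : ∑ i, q.repr ⟨b, hb⟩ i • (q i : 𝔤) = b := by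
    have := congrArg (Submodule.subtype _) h
    rw [map_sum] at this
    simpa only [map_smul, Submodule.subtype_apply] using this
  conv_rhs => rw [← h1]
  refine Finset.sum_congr rfl fun j _ => ?_
  congr 1
  conv_lhs => rw [← h1]
  simp [hq]

lemma gen_eq_sum_dual (b : U) :
    gen q b = ∑ i, κ (q' i) b • (MvPolynomial.X (i, 0) : DP F P) := by
  have : b = ∑ i, κ (q' i) b • q i := by
    apply Subtype.ext
    simpa using (sum_dual' hq b.2).symm
  conv_lhs => rw [this]
  simp [gen_basis]

/-- An element of `R ⊗ U'` in terms of the dual bases. -/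
lemma eq_sum_coord {R : Type*} [CommRing R] [Algebra F R] {Y : R ⊗[F] 𝔤}
    (hY : Y ∈ tens ⊤ U') : Y = ∑ i, coord (κ.flip (q i)) Y ⊗ₜ[F] (q' i : 𝔤) := by
  refine tens_induction
    (p := fun Y => Y = ∑ i, coord (κ.flip (q i)) Y ⊗ₜ[F] (q' i : 𝔤)) ?_ ?_ ?_ hY
  · intro r _ a ha
    conv_lhs => rw [← sum_dual hq ha]
    simp [TensorProduct.tmul_sum, TensorProduct.smul_tmul]
  · simp
  · intro y z hy hz
    conv_lhs => rw [hy, hz]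
    simp only [map_add, TensorProduct.add_tmul, Finset.sum_add_distrib]

omit hq in
lemma sum_mem_tens {R : Type*} [CommRing R] [Algebra F R] {c : P → R} :
    ∑ i, c i ⊗ₜ[F] (q' i : 𝔤) ∈ tens ⊤ U' :=
  sum_mem fun i _ => tmul_mem_tens Submodule.mem_top (q' i).2

lemma coord_sum {R : Type*} [CommRing R] [Algebra F R] (c : P → R) (j : P) :
    coord (κ.flip (q j)) (∑ i, c i ⊗ₜ[F] (q' i : 𝔤)) = c j := by
  simp [hq]

end Dual

section WAlg

variable {F : Type*} [Field F] [CharZero F] {𝔤 : Type*} [LieRing 𝔤] [LieAlgebra F 𝔤]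
  [FiniteDimensional F 𝔤] {κ : LinearMap.BilinForm F 𝔤} {f x e : 𝔤} {l p : Submodule F 𝔤}
  {I P : Type*} {hmp : IsCompl (subM x l) p} {u : Module.Basis I F 𝔤} {q : Module.Basis P F p}

lemma rho_der (g : DP F I) : rho κ f hmp u q (der F I g) = der F P (rho κ f hmp u q g) :=
  diffEval_der _ g

lemma inclV_der (g : DP F P) : inclV u q (der F P g) = der F I (inclV u q g) :=
  diffEval_der _ g

lemma rho_gen (b : 𝔤) : rho κ f hmp u q (gen u b) =
    gen q (p.projectionOnto (subM x l) hmp.symm b) + algebraMap F (DP F P) (κ f b) := by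
  have : (rho κ f hmp u q).toLinearMap ∘ₗ gen u =
      gen q ∘ₗ p.projectionOnto (subM x l) hmp.symm + (Algebra.linearMap F (DP F P)) ∘ₗ κ f := by
    refine u.ext fun i => ?_
    rw [LinearMap.comp_apply, gen_basis]
    have h1 : rho κ f hmp u q (MvPolynomial.X (i, 0)) = _ := diffEval_X _ i 0
    rw [AlgHom.toLinearMap_apply, h1]
    rfl
  exact LinearMap.congr_fun this b

variable (t : Setting κ f x e l)
include t

lemma kappa_f_eq_zero (hp : p ≤ grLeHalf x) {b : 𝔤} (hb : b ∈ p) : κ f b = 0 := by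
  have : grLeHalf x ≤ LinearMap.ker (κ f) :=
    iSup₂_le fun i hi b hb => t.kappa_gr (by linarith) t.f_mem hb
  exact this (hp hb)

lemma rho_comp_inclV (hp : p ≤ grLeHalf x) :
    (rho κ f hmp u q).comp (inclV u q) = AlgHom.id F _ := by
  refine algHom_ext_of_comm (d := der F P) (fun g => ?_) (fun g => rfl) fun j => ?_
  · rw [AlgHom.comp_apply, inclV_der, rho_der, AlgHom.comp_apply]
  · rw [AlgHom.comp_apply, inclV, diffEval_X, Function.iterate_zero_apply, rho_gen,
      kappa_f_eq_zero t hp (q j).2, Submodule.projectionOnto_apply_left, gen_basis]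
    simp

variable [Fintype P] [DecidableEq P] {q' : Module.Basis P F (mPerp κ x l)}
  (hq : ∀ i j, κ (q' i : 𝔤) (q j : 𝔤) = if i = j then 1 else 0)
  {R : Type*} [CommRing R] [Algebra F R] {d : Derivation F R R} {ψ : DP F P →ₐ[F] R}
include hq

/-- In coordinates, the infinitesimal gauge transformation by `φ ⊗ a` is given by
`-ρ{a_∂ q_j} φ`. -/
lemma coord_lie_sub {a : 𝔤} (φ : R) (j : P) :
    coord (κ.flip (q j)) (⁅φ ⊗ₜ[F] a, (∑ i, ψ (MvPolynomial.X (i, 0)) ⊗ₜ[F] (q' i : 𝔤)) +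
        (1 : R) ⊗ₜ f⁆ - tensDer 𝔤 d (φ ⊗ₜ[F] a)) =
      -(ψ (rho κ f hmp u q (gen u ⁅a, (q j : 𝔤)⁆)) * φ + κ a (q j) • d φ) := by
  have hproj : ∀ i, κ (q' i) (p.projectionOnto (subM x l) hmp.symm ⁅a, (q j : 𝔤)⁆) =
      κ (q' i) ⁅a, (q j : 𝔤)⁆ := by
    intro i
    have h1 : ⁅a, (q j : 𝔤)⁆ - p.projectionOnto (subM x l) hmp.symm ⁅a, (q j : 𝔤)⁆ ∈ subM x l := by
      rw [← Submodule.projectionOnto_apply_eq_zero_iff hmp.symm, map_sub,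
        Submodule.projectionOnto_apply_left, sub_self]
    have h2 := (q' i).2 _ h1
    change κ _ _ = 0 at h2
    rw [t.kappa_comm, map_sub, sub_eq_zero] at h2
    exact h2.symm
  rw [rho_gen, gen_eq_sum_dual hq]
  simp only [hproj]
  have hfl : ∀ b, κ.flip (q j : 𝔤) b = κ b (q j) := fun _ => rfl
  rw [lie_add, lie_sum, map_sub, map_add, map_sum, tensDer_tmul]
  simp only [LieAlgebra.ExtendScalars.bracket_tmul, coord_tmul, hfl, t.kappa_lie a, map_add, map_sum, map_smul, AlgHom.commutes, add_mul, Finset.sum_mul,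
    neg_smul, Finset.sum_neg_distrib, smul_mul_assoc, mul_comm φ, one_mul]
  rw [Algebra.smul_def (κ f ⁅a, (q j : 𝔤)⁆)]
  abel

/-- The symbol of `ρ{a_λ g}`, applied to `φ`, is minus the variation of `g` under the infinitesimal
gauge transformation by `φ ⊗ a`. -/
theorem symb_bracket (hp : p ≤ grLeHalf x) {s : 𝔤} (hs : ∀ a ∈ subN κ f x l, ⁅a, s⁆ = 0) (z : F)
    (hψ : ∀ g, ψ (der F P g) = d (ψ g)) {a : 𝔤} (ha : a ∈ subN κ f x l) (φ : R) (g : DP F P) :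
    symb ψ d φ ((affineBracket κ s z u (gen u a) (inclV u q g)).map (rho κ f hmp u q).toRingHom) =
      -vary ψ d (fun j => coord (κ.flip (q j)) (⁅φ ⊗ₜ[F] a,
        (∑ i, ψ (MvPolynomial.X (i, 0)) ⊗ₜ[F] (q' i : 𝔤)) + (1 : R) ⊗ₜ f⁆ -
          tensDer 𝔤 d (φ ⊗ₜ[F] a))) g := by
  have hz : ∀ b, κ s ⁅a, b⁆ = 0 := fun b => by
    rw [t.kappa_comm, t.kappa_lie, t.kappa_comm]
    rw [← neg_eq_zero, neg_neg]
    rw [hs a ha]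
    simp
  have hψρ : ∀ g, (ψ.comp (rho κ f hmp u q)) (der F I g) = d ((ψ.comp (rho κ f hmp u q)) g) := by
    intro g
    rw [AlgHom.comp_apply, rho_der, hψ, AlgHom.comp_apply]
  rw [symb_map, affineBracket_gen, map_sum]
  -- the direction of variation, as a linear function of `b ∈ 𝔤`
  let c : 𝔤 →ₗ[F] R := LinearMap.mulRight F φ ∘ₗ ψ.toLinearMap ∘ₗ (rho κ f hmp u q).toLinearMap ∘ₗ
    gen u ∘ₗ (LieAlgebra.ad F 𝔤 a : 𝔤 →ₗ[F] 𝔤) + (κ a).smulRight (d φ)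
  have hc : ∀ b, c b = ψ (rho κ f hmp u q (gen u ⁅a, b⁆)) * φ + κ a b • d φ := fun b => rfl
  have h1 : ∀ y : I × ℕ, symb (ψ.comp (rho κ f hmp u q)) d φ
      (Polynomial.C (MvPolynomial.pderiv y (inclV u q g)) *
        (lamDer ^ y.2) (Polynomial.C (gen u ⁅a, u y.1⁆)
          + Polynomial.C (algebraMap F (DP F I) (κ a (u y.1))) * Polynomial.X
          + Polynomial.C (algebraMap F (DP F I) (z * κ s ⁅a, u y.1⁆)))) =
      (ψ.comp (rho κ f hmp u q)) (MvPolynomial.pderiv y (inclV u q g)) * d^[y.2] (c (u y.1)) := by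
    intro y
    rw [symb_C_mul, symb_lamDer_pow hψρ, hz, mul_zero, map_zero, Polynomial.C_0, add_zero, map_add,
      symb_C_mul, ← Polynomial.monomial_zero_left, symb_monomial, ← Polynomial.monomial_one_one_eq_X,
      symb_monomial, hc]
    simp [Algebra.smul_def]
  simp only [h1]
  rw [← vary_apply (d := d) (c := fun i => c (u i)), inclV, vary_diffEval hψρ]
  have h2 : (ψ.comp (rho κ f hmp u q)).comp (diffEval fun i => gen u (q i : 𝔤)) = ψ := by
    have := rho_comp_inclV (hmp := hmp) (u := u) (q := q) t hp
    rw [inclV] at this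
    rw [AlgHom.comp_assoc, this, AlgHom.comp_id]
  have h3 : ∀ b, vary (ψ.comp (rho κ f hmp u q)) d (fun i => c (u i)) (gen u b) = c b := by
    have : (vary (ψ.comp (rho κ f hmp u q)) d (fun i => c (u i))) ∘ₗ gen u = c := by
      refine u.ext fun i => ?_
      rw [LinearMap.comp_apply, gen_basis, vary_X, Function.iterate_zero_apply]
    exact fun b => LinearMap.congr_fun this b
  simp only [h2, h3]
  have h4 : ∀ j, coord (κ.flip (q j)) (⁅φ ⊗ₜ[F] a,
        (∑ i, ψ (MvPolynomial.X (i, 0)) ⊗ₜ[F] (q' i : 𝔤)) + (1 : R) ⊗ₜ f⁆ -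
          tensDer 𝔤 d (φ ⊗ₜ[F] a)) = -c (q j) := fun j =>
    (coord_lie_sub (u := u) (hmp := hmp) t hq φ j).trans (by rw [hc])
  simp only [h4]
  rw [vary_apply, vary_apply, ← Finset.sum_neg_distrib]
  refine Finset.sum_congr rfl fun y _ => ?_
  have h5 : d^[y.2] (-c (q y.1)) = -d^[y.2] (c (q y.1)) :=
    Function.Commute.iterate_left (f := d) (g := Neg.neg) (fun r => map_neg d r) y.2 _
  rw [h5, mul_neg, neg_neg]

/-- Elements of `W` are invariant under infinitesimal gauge transformations over any differential
algebra. -/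
theorem vary_eq_zero_of_mem_walg (hp : p ≤ grLeHalf x) {s : 𝔤}
    (hs : ∀ a ∈ subN κ f x l, ⁅a, s⁆ = 0) {z : F}
    (hψ : ∀ g, ψ (der F P g) = d (ψ g)) {g : DP F P} (hg : g ∈ walg κ f x l s z hmp u q)
    {A : R ⊗[F] 𝔤} (hA : A ∈ tens ⊤ (subN κ f x l)) :
    vary ψ d (fun j => coord (κ.flip (q j)) (⁅A,
        (∑ i, ψ (MvPolynomial.X (i, 0)) ⊗ₜ[F] (q' i : 𝔤)) + (1 : R) ⊗ₜ f⁆ - tensDer 𝔤 d A)) g =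
      0 := by
  have hit : ∀ (n : ℕ) (r r' : R), d^[n] (r + r') = d^[n] r + d^[n] r' := fun n r r' => by
    induction n generalizing r r' with
    | zero => rfl
    | succ n ih => simp only [Function.iterate_succ_apply, map_add, ih]
  have hit0 : ∀ (n : ℕ), d^[n] 0 = 0 := fun n => by
    induction n with
    | zero => rfl
    | succ n ih => simp only [Function.iterate_succ_apply, map_zero, ih]
  refine tens_induction (p := fun A => vary ψ d (fun j => coord (κ.flip (q j)) (⁅A,
        (∑ i, ψ (MvPolynomial.X (i, 0)) ⊗ₜ[F] (q' i : 𝔤)) + (1 : R) ⊗ₜ f⁆ - tensDer 𝔤 d A)) g =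
      0) ?_ ?_ ?_ hA
  · intro φ _ a ha
    have h := symb_bracket (u := u) (hmp := hmp) t hq hp hs z hψ ha φ g
    rw [hg a ha, map_zero, eq_comm, neg_eq_zero] at h
    exact h
  · rw [vary_apply]
    refine Finset.sum_eq_zero fun y _ => ?_
    simp [hit0]
  · intro A B hA hB
    rw [vary_apply] at hA hB ⊢
    rw [← add_zero (0 : R)]
    nth_rewrite 1 [← hA]
    rw [← hB, ← Finset.sum_add_distrib]
    refine Finset.sum_congr rfl fun y _ => ?_
    rw [← mul_add, ← hit, ← map_add]
    congr 4
    rw [add_lie, map_add]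
    abel

/-- Gauge invariance under the infinitesimal transformations `φ ⊗ a` characterizes `W`. -/
theorem mem_walg_of_vary [Nonempty P] (hp : p ≤ grLeHalf x) {s : 𝔤}
    (hs : ∀ a ∈ subN κ f x l, ⁅a, s⁆ = 0) {z : F} {g : DP F P}
    (h : ∀ a ∈ subN κ f x l, ∀ φ : DP F P, vary (AlgHom.id F _) (der F P)
      (fun j => coord (κ.flip (q j)) (⁅φ ⊗ₜ[F] a,
        (∑ i, gen q (q i) ⊗ₜ[F] (q' i : 𝔤)) + (1 : DP F P) ⊗ₜ f⁆ -
          tensDer 𝔤 (der F P) (φ ⊗ₜ[F] a))) g = 0) :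
    g ∈ walg κ f x l s z hmp u q := by
  intro a ha
  refine eq_zero_of_symb fun φ => ?_
  rw [symb_bracket t hq hp hs z (fun _ => rfl) ha φ g]
  have h1 := h a ha φ
  simp only [gen_basis] at h1
  simp only [AlgHom.id_apply]
  rw [h1, neg_zero]

end WAlg

/-! ### Gauge invariance of the components of the gauge-fixed element -/

lemma smul_mem_tens_top {F 𝔤 : Type*} [Field F] [LieRing 𝔤] [LieAlgebra F 𝔤] {R : Type*}
    [CommRing R] [Algebra F R] {U : Submodule F 𝔤} {y : R ⊗[F] 𝔤} (r : R) (hy : y ∈ tens ⊤ U) :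
    r • y ∈ tens ⊤ U :=
  mem_baseChange_iff.1 (Submodule.smul_mem _ r (mem_baseChange_iff.2 hy))

namespace GaugeSlice

variable {F 𝔤 : Type*} [Field F] [LieRing 𝔤] [LieAlgebra F 𝔤] {S : GaugeSlice F 𝔤}
  {R : Type*} [CommRing R] [Algebra F R] {d : Derivation F R R}

lemma gauge_mem_n {X A : R ⊗[F] 𝔤} {D : Derivation F R R} (hX : X ∈ tens ⊤ S.n)
    (hA : A ∈ tens ⊤ S.n) : gauge S.N (tensDer 𝔤 D) X A ∈ tens ⊤ S.n := by
  have hpow : ∀ (k : ℕ) (y : R ⊗[F] 𝔤), y ∈ tens ⊤ S.n →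
      ((LieAlgebra.ad F (R ⊗[F] 𝔤) X) ^ k) y ∈ tens ⊤ S.n := by
    intro k
    induction k with
    | zero => exact fun y hy => hy
    | succ k ih =>
      intro y hy
      rw [pow_succ, Module.End.mul_apply]
      exact ih _ (lie_mem_tens_n hX hy)
  exact add_mem hA (sum_mem fun k _ => Submodule.smul_mem _ _
    (hpow k _ (sub_mem (lie_mem_tens_n hX hA) (tensDer_mem hX))))

/-- If `Q` moves along a gauge direction, its gauge-fixed form does not move. -/
theorem tensDer_transform_eq_zero [CharZero F] {X Q A : R ⊗[F] 𝔤} {D : Derivation F R R}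
    (hcomm : ∀ r, d (D r) = D (d r)) (hX : X ∈ tens ⊤ S.n) (hA : A ∈ tens ⊤ S.n)
    (hXV : S.transform d X Q ∈ tens ⊤ S.V)
    (hD : tensDer 𝔤 D Q = ⁅A, Q + (1 : R) ⊗ₜ S.f⁆ - tensDer 𝔤 d A) :
    tensDer 𝔤 D (S.transform d X Q) = 0 := by
  have h := tensDer_transform hcomm hX hD
  have hC : -gauge S.N (tensDer 𝔤 D) X (-A) = 0 := by
    refine eq_zero_of_lie_sub_mem (d := d) (Q := S.transform d X Q)
      (neg_mem (gauge_mem_n hX (neg_mem hA))) (tens_mono le_rfl S.V_le_M hXV) ?_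
    rw [← h]
    exact tensDer_mem hXV
  rw [h, hC, zero_lie, map_zero, sub_zero]

/-- If `D` kills `Q`, it acts on `q^X` by an infinitesimal gauge transformation. -/
lemma exists_tensDer_transform [CharZero F] {X Q : R ⊗[F] 𝔤} {D : Derivation F R R}
    (hcomm : ∀ r, d (D r) = D (d r)) (hX : X ∈ tens ⊤ S.n) (hD : tensDer 𝔤 D Q = 0) :
    ∃ C ∈ tens ⊤ S.n, tensDer 𝔤 D (S.transform d X Q) =
      ⁅C, S.transform d X Q + (1 : R) ⊗ₜ S.f⁆ - tensDer 𝔤 d C :=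
  ⟨_, neg_mem (gauge_mem_n hX (neg_mem (zero_mem _))),
    tensDer_transform hcomm hX (by rw [hD, zero_lie, map_zero, sub_zero])⟩

end GaugeSlice

/-- The extension of a derivation of `R` to `R[t]` acting on coefficients. -/
def polyDer {F : Type*} [Field F] {R : Type*} [CommRing R] [Algebra F R] (d : Derivation F R R) :
    Derivation F (Polynomial R) (Polynomial R) :=
  ((PolynomialModule.equivPolynomialSelf (R := R)) : _ →ₗ[Polynomial R] _).compDer d.mapCoeffs

lemma polyDer_monomial {F : Type*} [Field F] {R : Type*} [CommRing R] [Algebra F R]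
    (d : Derivation F R R) (n : ℕ) (r : R) :
    polyDer d (Polynomial.monomial n r) = Polynomial.monomial n (d r) := by
  simp [polyDer]

section WAlg

variable {F : Type*} [Field F] [CharZero F] {𝔤 : Type*} [LieRing 𝔤] [LieAlgebra F 𝔤]
  [FiniteDimensional F 𝔤] {κ : LinearMap.BilinForm F 𝔤} {f x e : 𝔤} {l p : Submodule F 𝔤}
  {I P : Type*} {hmp : IsCompl (subM x l) p} {u : Module.Basis I F 𝔤} {q : Module.Basis P F p}
  (t : Setting κ f x e l) [Fintype P] [DecidableEq P] {q' : Module.Basis P F (mPerp κ x l)}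
  (hq : ∀ i j, κ (q' i : 𝔤) (q j : 𝔤) = if i = j then 1 else 0)

/-- The universal element `q = ∑ q_i ⊗ q^i` of `V(p) ⊗ m^⊥`. -/
def univ (q' : Module.Basis P F (mPerp κ x l)) : DP F P ⊗[F] 𝔤 :=
  ∑ i, (MvPolynomial.X (i, 0) : DP F P) ⊗ₜ[F] (q' i : 𝔤)

lemma univ_mem : univ q' ∈ tens ⊤ (mPerp κ x l) := sum_mem_tens

variable {S : GaugeSlice F 𝔤} (hSf : S.f = f) (hSn : S.n = subN κ f x l) (hSM : S.M = mPerp κ x l)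
  {X : DP F P ⊗[F] 𝔤} (hX : X ∈ tens ⊤ S.n)
  (hXV : S.transform (der F P) X (univ q') ∈ tens ⊤ S.V)
include hq hSf hSn hSM hX hXV

/-- The components of the gauge-fixed element are invariant under infinitesimal gauge
transformations. -/
lemma vary_coord_transform {a : 𝔤} (ha : a ∈ subN κ f x l) (φ : DP F P) (ℓ : 𝔤 →ₗ[F] F) :
    vary (AlgHom.id F _) (der F P) (fun j => coord (κ.flip (q j)) (⁅φ ⊗ₜ[F] a,
        univ q' + (1 : DP F P) ⊗ₜ f⁆ - tensDer 𝔤 (der F P) (φ ⊗ₜ[F] a)))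
      (coord ℓ (S.transform (der F P) X (univ q'))) = 0 := by
  have hA : φ ⊗ₜ[F] a ∈ tens ⊤ S.n := tmul_mem_tens Submodule.mem_top (hSn ▸ ha)
  have hZ : ⁅φ ⊗ₜ[F] a, univ q' + (1 : DP F P) ⊗ₜ f⁆ - tensDer 𝔤 (der F P) (φ ⊗ₜ[F] a) ∈
      tens ⊤ (mPerp κ x l) := by
    rw [← hSM, ← hSf]
    exact GaugeSlice.lie_sub_mem hA (hSM ▸ univ_mem)
  set Z := ⁅φ ⊗ₜ[F] a, univ q' + (1 : DP F P) ⊗ₜ f⁆ - tensDer 𝔤 (der F P) (φ ⊗ₜ[F] a) with hZdef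
  -- the evolutionary derivation of `V(p)` attached to `φ ⊗ a`
  let D : Derivation F (DP F P) (DP F P) := MvPolynomial.mkDerivation F fun k : P × ℕ =>
    (der F P)^[k.2] (coord (κ.flip (q k.1)) Z)
  have hDX : ∀ j n, D (MvPolynomial.X (j, n)) = (der F P)^[n] (coord (κ.flip (q j)) Z) :=
    fun j n => MvPolynomial.mkDerivation_X _ _ _
  have hder : ∀ k : P × ℕ, der F P (MvPolynomial.X k) = MvPolynomial.X (k.1, k.2 + 1) :=
    fun k => MvPolynomial.mkDerivation_X _ _ _
  have hcomm : ∀ r, der F P (D r) = D (der F P r) := by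
    have h : ⁅der F P, D⁆ = 0 := by
      refine MvPolynomial.derivation_ext fun k => ?_
      rw [Derivation.commutator_apply, hder, hDX, hDX, Function.iterate_succ_apply', sub_self]
      rfl
    intro r
    have h1 := congrArg (fun E : Derivation F (DP F P) (DP F P) => E r) h
    rw [← sub_eq_zero]
    exact h1
  have hDQ : tensDer 𝔤 D (univ q') = ⁅φ ⊗ₜ[F] a, univ q' + (1 : DP F P) ⊗ₜ S.f⁆ -
      tensDer 𝔤 (der F P) (φ ⊗ₜ[F] a) := by
    rw [hSf, ← hZdef, eq_sum_coord hq hZ, univ, map_sum]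
    refine Finset.sum_congr rfl fun i _ => ?_
    rw [tensDer_tmul, hDX]
    rfl
  have h0 := GaugeSlice.tensDer_transform_eq_zero hcomm hX hA hXV hDQ
  have h1 := eq_vary (ψ := AlgHom.id F _) (d := der F P) (D := D.toLinearMap)
    (fun g h => D.leibniz g h) (fun g => (hcomm g).symm)
    (coord ℓ (S.transform (der F P) X (univ q')))
  have h2 : ∀ j, D.toLinearMap (MvPolynomial.X (j, 0)) = coord (κ.flip (q j)) Z :=
    fun j => hDX j 0
  simp only [h2] at h1
  rw [← h1]
  change D _ = 0
  rw [← coord_tensDer, h0, map_zero]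

include t in
/-- Differential polynomials in the components of the gauge-fixed element belong to `W`. -/
theorem diffEval_mem_walg [Nonempty P] (hp : p ≤ grLeHalf x) {s : 𝔤}
    (hs : ∀ a ∈ subN κ f x l, ⁅a, s⁆ = 0) {z : F} {J : Type*} (ℓ : J → 𝔤 →ₗ[F] F) (G : DP F J) :
    diffEval (fun j => coord (ℓ j) (S.transform (der F P) X (univ q'))) G ∈
      walg κ f x l s z hmp u q := by
  refine mem_walg_of_vary t hq hp hs fun a ha φ => ?_
  have hu : ∑ i, gen q (q i) ⊗ₜ[F] (q' i : 𝔤) = univ q' := by simp only [gen_basis, univ]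
  rw [hu, vary_diffEval (fun _ => rfl)]
  simp only [vary_coord_transform hq hSf hSn hSM hX hXV ha φ]
  rw [vary_apply]
  refine Finset.sum_eq_zero fun y _ => ?_
  rw [Function.iterate_fixed (map_zero _), mul_zero]

include t in
/-- An element of `W` is unchanged when the universal element is replaced by its gauge-fixed form:
its values along the path `t ↦ q^{tX}` of gauge transforms are constant. -/
theorem eq_diffHom_of_mem_walg (hp : p ≤ grLeHalf x) {s : 𝔤}
    (hs : ∀ a ∈ subN κ f x l, ⁅a, s⁆ = 0) {z : F} {g : DP F P}
    (hg : g ∈ walg κ f x l s z hmp u q) :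
    diffHom (der F P) (fun j => coord (κ.flip (q j)) (S.transform (der F P) X (univ q'))) g =
      g := by
  let d' := polyDer (der F P)
  let ι : DP F P →ₐ[F] Polynomial (DP F P) := Polynomial.CAlgHom
  let D' : Derivation F (Polynomial (DP F P)) (Polynomial (DP F P)) :=
    Polynomial.derivative'.restrictScalars F
  have hD' : ∀ r, D' r = Polynomial.derivative r := fun _ => rfl
  let X' : Polynomial (DP F P) ⊗[F] 𝔤 := (Polynomial.X : Polynomial (DP F P)) • tensMap 𝔤 ι X
  let y := S.transform d' X' (tensMap 𝔤 ι (univ q'))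
  have hX' : X' ∈ tens ⊤ S.n := smul_mem_tens_top _ (tensMap_mem_tens ι hX)
  have hy : y ∈ tens ⊤ (mPerp κ x l) := by
    rw [← hSM]
    exact GaugeSlice.transform_mem hX' (hSM ▸ tensMap_mem_tens ι univ_mem)
  have hcomm : ∀ r, d' (D' r) = D' (d' r) := by
    intro r
    induction r using Polynomial.induction_on' with
    | add a b ha hb => simp only [map_add, ha, hb]
    | monomial n r =>
      rw [hD', hD', polyDer_monomial, Polynomial.derivative_monomial,
        Polynomial.derivative_monomial, polyDer_monomial]
      simp [mul_comm]
  have hDQ : tensDer 𝔤 D' (tensMap 𝔤 ι (univ q')) = 0 := by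
    simp [univ, hD', ι, Polynomial.CAlgHom]
  obtain ⟨C, hC, hDy⟩ := GaugeSlice.exists_tensDer_transform (d := d') hcomm hX' hDQ
  rw [hSn] at hC
  let Ψ : DP F P →ₐ[F] Polynomial (DP F P) := diffHom d' fun j => coord (κ.flip (q j)) y
  have hΨ : ∀ g, Ψ (der F P g) = d' (Ψ g) := diffHom_der _ _
  have hΨX : ∀ j, Ψ (MvPolynomial.X (j, 0)) = coord (κ.flip (q j)) y := fun j => diffHom_X _ _ j 0
  have h0 := vary_eq_zero_of_mem_walg (ψ := Ψ) (d := d') t hq hp hs hΨ hg hC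
  simp only [hΨX] at h0
  rw [← eq_sum_coord hq hy, ← hSf] at h0
  change vary Ψ d' (fun j => coord (κ.flip (q j)) (⁅C, S.transform d' X' (tensMap 𝔤 ι (univ q')) +
    (1 : Polynomial (DP F P)) ⊗ₜ S.f⁆ - tensDer 𝔤 d' C)) g = 0 at h0
  rw [← hDy] at h0
  simp only [coord_tensDer] at h0
  have h1 := eq_vary (ψ := Ψ) (d := d') (D := D'.toLinearMap ∘ₗ Ψ.toLinearMap)
    (fun g h => by
      change D' (Ψ (g * h)) = Ψ g * D' (Ψ h) + Ψ h * D' (Ψ g)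
      rw [map_mul, D'.leibniz]
      rfl)
    (fun g => by
      change D' (Ψ (der F P g)) = d' (D' (Ψ g))
      rw [hΨ, hcomm]) g
  have h2 : ∀ j, (D'.toLinearMap ∘ₗ Ψ.toLinearMap) (MvPolynomial.X (j, 0)) =
      D' (coord (κ.flip (q j)) y) := fun j => by
    rw [← hΨX]; rfl
  simp only [h2] at h1
  have h3 : Polynomial.derivative (Ψ g) = 0 := h1.trans h0
  have h4 := Polynomial.eq_C_of_derivative_eq_zero h3
  -- the values at `t = 0` and at `t = 1`
  let ev : F → Polynomial (DP F P) →ₐ[F] DP F P := fun c =>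
    (Polynomial.aeval (algebraMap F (DP F P) c)).restrictScalars F
  have hevm : ∀ c n r, ev c (Polynomial.monomial n r) = c ^ n • r := by
    intro c n r
    simp only [ev, AlgHom.restrictScalars_apply, Polynomial.aeval_monomial, Algebra.algebraMap_self,
      RingHom.id_apply]
    rw [← map_pow, mul_comm, Algebra.smul_def]
  have hev : ∀ c r, ev c (d' r) = der F P (ev c r) := by
    intro c r
    induction r using Polynomial.induction_on' with
    | add a b ha hb => simp only [map_add, ha, hb]
    | monomial n r =>
      change ev c (polyDer _ _) = _
      rw [polyDer_monomial, hevm, hevm, Derivation.map_smul]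
  have hevι : ∀ c, (ev c).comp ι = AlgHom.id F _ := by
    intro c
    ext k
    simp [ev, ι, Polynomial.CAlgHom]
  have hevT : ∀ c Y, tensMap 𝔤 (ev c) (tensMap 𝔤 ι Y) = Y := by
    intro c Y
    induction Y with
    | zero => simp
    | add a b ha hb => simp only [map_add, ha, hb]
    | tmul r a =>
      rw [tensMap_tmul, tensMap_tmul, ← AlgHom.comp_apply, hevι, AlgHom.id_apply]
  have hevX : ∀ c, tensMap 𝔤 (ev c) X' = c • X := by
    intro c
    have : ev c Polynomial.X = algebraMap F (DP F P) c := by simp [ev]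
    rw [tensMap_smul, hevT, this, algebraMap_smul]
  have hevΨ : ∀ c, (ev c).comp Ψ = diffHom (der F P)
      (fun j => coord (κ.flip (q j)) (S.transform (der F P) (c • X) (univ q'))) := by
    intro c
    refine algHom_ext_of_comm (d := der F P) (fun g => ?_) (fun g => diffHom_der _ _ g)
      fun j => ?_
    · rw [AlgHom.comp_apply, hΨ, hev, AlgHom.comp_apply]
    · rw [AlgHom.comp_apply, hΨX, ← coord_tensMap, diffHom_X, Function.iterate_zero_apply,
        GaugeSlice.tensMap_transform (hev c), hevX, hevT]
  have h5 : ∀ c, ev c (Ψ g) = (Ψ g).coeff 0 := by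
    intro c
    rw [h4]
    simp [ev]
  have h6 : diffHom (der F P)
      (fun j => coord (κ.flip (q j)) (S.transform (der F P) ((0 : F) • X) (univ q'))) =
      AlgHom.id F _ := by
    refine algHom_ext_of_comm (d := der F P) (fun g => diffHom_der _ _ g) (fun g => rfl)
      fun j => ?_
    rw [diffHom_X, Function.iterate_zero_apply, zero_smul, GaugeSlice.transform_zero, univ,
      coord_sum hq]
    rfl
  have h7 := h5 1
  rw [← h5 0, ← AlgHom.comp_apply, ← AlgHom.comp_apply, hevΨ, hevΨ, h6, one_smul] at h7
  exact h7

end WAlg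

/-- Functionals dual to a basis `b` of a subspace `V`, and the resulting expansion of the elements
of `V ⊗ R`. -/
lemma exists_dual {F 𝔤 : Type*} [Field F] [LieRing 𝔤] [LieAlgebra F 𝔤] {R : Type*}
    [CommRing R] [Algebra F R] {V : Submodule F 𝔤} {J : Type*} [Fintype J]
    (b : Module.Basis J F V) : ∃ ℓ : J → 𝔤 →ₗ[F] F,
      (∀ c : J → R, ∀ i, coord (ℓ i) (∑ j, c j ⊗ₜ[F] (b j : 𝔤)) = c i) ∧
      ∀ w : R ⊗[F] 𝔤, w ∈ tens ⊤ V → w = ∑ j, coord (ℓ j) w ⊗ₜ[F] (b j : 𝔤) := by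
  classical
  obtain ⟨π, hπ⟩ := V.subtype.exists_leftInverse_of_injective V.ker_subtype
  have hπ' : ∀ v : V, π v = v := fun v => LinearMap.congr_fun hπ v
  refine ⟨fun j => b.coord j ∘ₗ π, fun c i => ?_, fun w hw => ?_⟩
  · simp [coord_tmul, hπ', Finsupp.single_apply]
  · refine tens_induction
      (p := fun w => w = ∑ j, coord (b.coord j ∘ₗ π) w ⊗ₜ[F] (b j : 𝔤)) ?_ ?_ ?_ hw
    · intro r _ a ha
      have h1 : ∑ j, b.repr ⟨a, ha⟩ j • (b j : 𝔤) = a := by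
        have := congrArg V.subtype (b.sum_repr ⟨a, ha⟩)
        rw [map_sum] at this
        simpa only [map_smul, Submodule.subtype_apply] using this
      have h2 : π a = ⟨a, ha⟩ := hπ' ⟨a, ha⟩
      simp only [coord_tmul, LinearMap.comp_apply, h2, Module.Basis.coord_apply,
        TensorProduct.smul_tmul]
      rw [← TensorProduct.tmul_sum, h1]
    · simp
    · intro y z hy hz
      conv_lhs => rw [hy, hz]
      simp only [map_add, TensorProduct.add_tmul, Finset.sum_add_distrib]

section WAlg

variable {F : Type*} [Field F] [CharZero F] {𝔤 : Type*} [LieRing 𝔤] [LieAlgebra F 𝔤]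
  [FiniteDimensional F 𝔤] {κ : LinearMap.BilinForm F 𝔤} {f x e : 𝔤} {l p : Submodule F 𝔤}
  {I P : Type*} {hmp : IsCompl (subM x l) p} {u : Module.Basis I F 𝔤} {q : Module.Basis P F p}
  (t : Setting κ f x e l) [Fintype P] [DecidableEq P] {q' : Module.Basis P F (mPerp κ x l)}
  (hq : ∀ i j, κ (q' i : 𝔤) (q j : 𝔤) = if i = j then 1 else 0)
  {S : GaugeSlice F 𝔤} (hSf : S.f = f) (hSn : S.n = subN κ f x l) (hSM : S.M = mPerp κ x l)
  {X : DP F P ⊗[F] 𝔤} (hX : X ∈ tens ⊤ S.n)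
  (hXV : S.transform (der F P) X (univ q') ∈ tens ⊤ S.V)
include t hq hSf hSn hSM hX hXV

/-- `W` is the algebra of differential polynomials in the components of the gauge-fixed element. -/
theorem walg_generators [Nonempty P] (hp : p ≤ grLeHalf x) {s : 𝔤}
    (hs : ∀ a ∈ subN κ f x l, ⁅a, s⁆ = 0) (z : F) {J : Type*} [Fintype J]
    (b : Module.Basis J F S.V) : ∃ w : J → DP F P,
      S.transform (der F P) X (univ q') = ∑ j, w j ⊗ₜ[F] (b j : 𝔤) ∧
      Function.Injective (diffEval w) ∧ Set.range (diffEval w) = walg κ f x l s z hmp u q := by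
  classical
  obtain ⟨ℓ, -, hℓ⟩ := exists_dual (R := DP F P) b
  set w := fun j => coord (ℓ j) (S.transform (der F P) X (univ q')) with hw
  have hsum := hℓ _ hXV
  change _ = ∑ j, w j ⊗ₜ[F] (b j : 𝔤) at hsum
  -- the substitution which restricts a differential polynomial on `m^⊥` to `V`
  let σ : DP F P →ₐ[F] DP F J := diffHom (der F J) fun i =>
    ∑ j, κ (b j) (q i) • (MvPolynomial.X (j, 0) : DP F J)
  have hσ : ∀ g, σ (der F P g) = der F J (σ g) := diffHom_der _ _
  have hσX : ∀ i, σ (MvPolynomial.X (i, 0)) = ∑ j, κ (b j) (q i) • (MvPolynomial.X (j, 0)) :=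
    fun i => diffHom_X _ _ i 0
  refine ⟨w, hsum, ?_, Set.Subset.antisymm ?_ ?_⟩
  · set B : DP F J ⊗[F] 𝔤 := ∑ j, (MvPolynomial.X (j, 0) : DP F J) ⊗ₜ[F] (b j : 𝔤) with hB
    have hBV : B ∈ tens ⊤ S.V := sum_mem fun j _ => tmul_mem_tens Submodule.mem_top (b j).2
    have hBM : B ∈ tens ⊤ S.M := tens_mono le_rfl S.V_le_M hBV
    have hσQ : tensMap 𝔤 σ (univ q') = B := by
      rw [eq_sum_coord hq (Y := B) (hSM ▸ hBM), univ, map_sum]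
      refine Finset.sum_congr rfl fun i _ => ?_
      rw [tensMap_tmul, hσX, hB, map_sum]
      simp only [coord_tmul]
      rfl
    have h1 : S.transform (der F J) (tensMap 𝔤 σ X) B = tensMap 𝔤 σ
        (S.transform (der F P) X (univ q')) := by
      rw [GaugeSlice.tensMap_transform hσ, hσQ]
    have h2 : tensMap 𝔤 σ X = 0 := by
      refine GaugeSlice.eq_of_transform_mem (d := der F J) (tensMap_mem_tens σ hX) (zero_mem _) hBM ?_ ?_
      · rw [h1]
        exact tensMap_mem_tens σ hXV
      · rw [GaugeSlice.transform_zero]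
        exact hBV
    rw [h2, GaugeSlice.transform_zero] at h1
    obtain ⟨ℓ', hℓ', -⟩ := exists_dual (R := DP F J) b
    have h3 : ∀ j, σ (w j) = MvPolynomial.X (j, 0) := by
      intro j
      have h4 := congrArg (coord (ℓ' j)) h1
      rw [hB, hℓ', hsum, map_sum] at h4
      simp only [tensMap_tmul] at h4
      rw [hℓ' fun j => σ (w j)] at h4
      exact h4.symm
    have h4 : σ.comp (diffEval w) = AlgHom.id F _ := by
      refine algHom_ext_of_comm (d := der F J) (fun g => ?_) (fun g => rfl) fun j => ?_
      · rw [AlgHom.comp_apply, diffEval_der, hσ, AlgHom.comp_apply]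
      · rw [AlgHom.comp_apply, diffEval_X, Function.iterate_zero_apply, h3]
        rfl
    exact Function.LeftInverse.injective (g := σ) fun g => AlgHom.congr_fun h4 g
  · rintro _ ⟨G, rfl⟩
    exact diffEval_mem_walg t hq hSf hSn hSM hX hXV hp hs ℓ G
  · intro g hg
    have h1 : diffHom (der F P) (fun j => coord (κ.flip (q j))
        (S.transform (der F P) X (univ q'))) = (diffEval w).comp σ := by
      refine algHom_ext_of_comm (d := der F P) (fun g => diffHom_der _ _ g) (fun g => ?_)
        fun i => ?_
      · rw [AlgHom.comp_apply, hσ, diffEval_der, AlgHom.comp_apply]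
      · rw [AlgHom.comp_apply, hσX, diffHom_X, Function.iterate_zero_apply, map_sum, hsum, map_sum]
        refine Finset.sum_congr rfl fun j _ => ?_
        rw [coord_tmul, map_smul, diffEval_X]
        rfl
    refine ⟨σ g, ?_⟩
    rw [← AlgHom.comp_apply, ← h1]
    exact eq_diffHom_of_mem_walg t hq hSf hSn hSM hX hXV hp hs hg

end WAlg

/-! ### Conformal weights -/

section MonSpan

variable {F : Type*} [Field F] {M P : Type*} [AddCommGroup M] [Module F M]
  {q : Module.Basis P F M} {L : M → ℚ → Prop}

/-- The span of the monomials `a_1^{(m_1)} ⋯ a_s^{(m_s)}` whose letters `a_k` are in relation `L`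
with numbers `ε_k` such that `s - ∑ ε_k + ∑ m_k` satisfies `C`. The spaces `V(p){d}` and the spaces
of differential polynomials without terms of low degree are of this form. -/
def monSpan (q : Module.Basis P F M) (L : M → ℚ → Prop) (C : ℚ → Prop) : Submodule F (DP F P) :=
  Submodule.span F {g | ∃ (s : ℕ) (a : Fin s → M) (ε : Fin s → ℚ) (m : Fin s → ℕ),
    (∀ k, L (a k) (ε k)) ∧ C ((s : ℚ) - ∑ k, ε k + ∑ k, (m k : ℚ)) ∧
    g = ∏ k, (der F P)^[m k] (gen q (a k))}

lemma prod_mem_monSpan {C : ℚ → Prop} {s : ℕ} {a : Fin s → M} {ε : Fin s → ℚ} {m : Fin s → ℕ}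
    (h : ∀ k, L (a k) (ε k)) (hC : C ((s : ℚ) - ∑ k, ε k + ∑ k, (m k : ℚ))) :
    ∏ k, (der F P)^[m k] (gen q (a k)) ∈ monSpan q L C :=
  Submodule.subset_span ⟨s, a, ε, m, h, hC, rfl⟩

lemma monSpan_mono {C C' : ℚ → Prop} (h : ∀ d, C d → C' d) : monSpan q L C ≤ monSpan q L C' := by
  refine Submodule.span_mono ?_
  rintro _ ⟨s, a, ε, m, h1, h2, rfl⟩
  exact ⟨s, a, ε, m, h1, h _ h2, rfl⟩

lemma one_mem_monSpan {C : ℚ → Prop} (h : C 0) : (1 : DP F P) ∈ monSpan q L C := by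
  have := prod_mem_monSpan (F := F) (q := q) (L := L) (C := C) (s := 0) (a := Fin.elim0)
    (ε := Fin.elim0) (m := Fin.elim0) (fun k => k.elim0) (by simpa using h)
  simpa using this

lemma iterate_gen_mem_monSpan {C : ℚ → Prop} {a : M} {ε : ℚ} {m : ℕ} (ha : L a ε)
    (h : C (1 - ε + m)) : (der F P)^[m] (gen q a) ∈ monSpan q L C := by
  have := prod_mem_monSpan (F := F) (q := q) (L := L) (C := C) (s := 1) (a := fun _ => a)
    (ε := fun _ => ε) (m := fun _ => m) (fun _ => ha) (by simpa using h)
  simpa using this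

lemma gen_mem_monSpan {C : ℚ → Prop} {a : M} {ε : ℚ} (ha : L a ε) (h : C (1 - ε)) :
    gen q a ∈ monSpan q L C :=
  iterate_gen_mem_monSpan (m := 0) ha (by simpa using h)

lemma mul_mem_monSpan {C C' C'' : ℚ → Prop} (h : ∀ c d, C c → C' d → C'' (c + d))
    {g g' : DP F P} (hg : g ∈ monSpan q L C) (hg' : g' ∈ monSpan q L C') :
    g * g' ∈ monSpan q L C'' := by
  have h1 : monSpan q L C * monSpan q L C' ≤ monSpan q L C'' := by
    rw [monSpan, monSpan, Submodule.span_mul_span, Submodule.span_le]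
    rintro _ ⟨_, ⟨s, a, ε, m, h1, h2, rfl⟩, _, ⟨s', a', ε', m', h1', h2', rfl⟩, rfl⟩
    refine Submodule.subset_span ⟨s + s', Fin.append a a', Fin.append ε ε', Fin.append m m',
      fun k => ?_, ?_, ?_⟩
    · induction k using Fin.addCases <;> simp [h1, h1']
    · convert h _ _ h2 h2' using 1
      simp only [Fin.sum_univ_add, Fin.append_left, Fin.append_right]
      push_cast
      ring
    · simp only [Fin.prod_univ_add, Fin.append_left, Fin.append_right]
  exact h1 (Submodule.mul_mem_mul hg hg')

lemma der_mem_monSpan {C C' : ℚ → Prop} (h : ∀ d, C d → C' (d + 1)) {g : DP F P}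
    (hg : g ∈ monSpan q L C) : der F P g ∈ monSpan q L C' := by
  induction hg using Submodule.span_induction with
  | zero => rw [map_zero]; exact zero_mem _
  | add g g' _ _ hg hg' => rw [map_add]; exact add_mem hg hg'
  | smul r g _ hg => rw [Derivation.map_smul]; exact Submodule.smul_mem _ r hg
  | mem g hg =>
    obtain ⟨s, a, ε, m, h1, h2, rfl⟩ := hg
    have key : ∀ (s : ℕ) (a : Fin s → M) (ε : Fin s → ℚ) (m : Fin s → ℕ),
        (∀ k, L (a k) (ε k)) → der F P (∏ k, (der F P)^[m k] (gen q (a k))) ∈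
          monSpan q L (· = (s : ℚ) - ∑ k, ε k + ∑ k, (m k : ℚ) + 1) := by
      intro s
      induction s with
      | zero =>
        intro a ε m _
        simp only [Finset.univ_eq_empty, Finset.prod_empty, Derivation.map_one_eq_zero]
        exact zero_mem _
      | succ s ih =>
        intro a ε m hL
        rw [Fin.prod_univ_succ, Derivation.leibniz, smul_eq_mul, smul_eq_mul]
        refine add_mem ?_ ?_
        · refine mul_mem_monSpan (C := (· = 1 - ε 0 + (m 0 : ℚ))) (fun c d hc hd => ?_)
            (iterate_gen_mem_monSpan (hL 0) rfl) (ih _ _ _ fun k => hL k.succ)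
          rw [hc, hd, Fin.sum_univ_succ, Fin.sum_univ_succ]
          push_cast
          ring
        · rw [← Function.iterate_succ_apply' (der F P)]
          refine mul_mem_monSpan
            (C' := (· = 1 - ε 0 + ((m 0 + 1 : ℕ) : ℚ))) (fun c d hc hd => ?_)
            (prod_mem_monSpan (C := (· = _)) (fun k => hL k.succ) rfl)
            (iterate_gen_mem_monSpan (hL 0) rfl)
          rw [hc, hd, Fin.sum_univ_succ, Fin.sum_univ_succ]
          push_cast
          ring
    refine monSpan_mono ?_ (key s a ε m h1)
    rintro _ rfl
    exact h _ h2

end MonSpan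

section Weights

variable {F : Type*} [Field F] {𝔤 : Type*} [LieRing 𝔤] [LieAlgebra F 𝔤] {p : Submodule F 𝔤}
  {P : Type*} {q : Module.Basis P F p} {x : 𝔤}

lemma confWt_eq (d : ℚ) :
    confWt x q d = monSpan q (fun a ε => (a : 𝔤) ∈ gr (F := F) x ε) (· = d) := rfl

lemma one_mem_confWt : (1 : DP F P) ∈ confWt x q 0 := by
  rw [confWt_eq]
  exact one_mem_monSpan rfl

lemma gen_mem_confWt {a : p} {ε : ℚ} (ha : (a : 𝔤) ∈ gr (F := F) x ε) :
    gen q a ∈ confWt x q (1 - ε) := by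
  rw [confWt_eq]
  exact gen_mem_monSpan ha rfl

lemma mul_mem_confWt {c d : ℚ} {g g' : DP F P} (hg : g ∈ confWt x q c) (hg' : g' ∈ confWt x q d) :
    g * g' ∈ confWt x q (c + d) := by
  rw [confWt_eq] at *
  exact mul_mem_monSpan (fun _ _ h h' => by rw [h, h']) hg hg'

lemma der_mem_confWt {c : ℚ} {g : DP F P} (hg : g ∈ confWt x q c) :
    der F P g ∈ confWt x q (c + 1) := by
  rw [confWt_eq] at *
  exact der_mem_monSpan (fun _ h => by rw [h]) hg

lemma wtSpace_le_iff {i : ℚ} {T : Submodule F (DP F P ⊗[F] 𝔤)} : wtSpace x q i ≤ T ↔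
    ∀ j, ∀ g ∈ confWt x q (i + j), ∀ a ∈ gr (F := F) x j, g ⊗ₜ[F] a ∈ T := by
  rw [wtSpace, iSup_le_iff]
  exact forall_congr' fun j => tens_le

lemma tmul_mem_wtSpace {i j k : ℚ} (hk : k = i + j) {g : DP F P} (hg : g ∈ confWt x q k) {a : 𝔤}
    (ha : a ∈ gr (F := F) x j) : g ⊗ₜ[F] a ∈ wtSpace x q i :=
  wtSpace_le_iff.1 le_rfl j g (hk ▸ hg) a ha

lemma lie_mem_wtSpace [CharZero F] {i j k : ℚ} (hk : k = i + j) {y z : DP F P ⊗[F] 𝔤}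
    (hy : y ∈ wtSpace x q i) (hz : z ∈ wtSpace x q j) : ⁅y, z⁆ ∈ wtSpace x q k := by
  have h1 : wtSpace x q i ≤ (wtSpace x q k).comap
      ((LieModule.toEnd F (DP F P ⊗[F] 𝔤) (DP F P ⊗[F] 𝔤) :
        (DP F P ⊗[F] 𝔤) →ₗ[F] Module.End F (DP F P ⊗[F] 𝔤)).flip z) := by
    rw [wtSpace_le_iff]
    intro i' r hr a ha
    have h2 : wtSpace x q j ≤ (wtSpace x q k).comap
        (LieModule.toEnd F (DP F P ⊗[F] 𝔤) (DP F P ⊗[F] 𝔤) (r ⊗ₜ a)) := by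
      rw [wtSpace_le_iff]
      intro j' s hs b hb
      exact tmul_mem_wtSpace (j := i' + j') (by rw [hk]; ring) (mul_mem_confWt hr hs)
        (lie_mem_gr ha hb)
    exact h2 hz
  exact h1 hy

lemma tensDer_mem_wtSpace {i k : ℚ} (hk : k = i + 1) {y : DP F P ⊗[F] 𝔤}
    (hy : y ∈ wtSpace x q i) : tensDer 𝔤 (der F P) y ∈ wtSpace x q k := by
  have h1 : wtSpace x q i ≤ (wtSpace x q k).comap
      (tensDer 𝔤 (der F P)).toLinearMap := by
    rw [wtSpace_le_iff]
    intro j r hr a ha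
    change tensDer 𝔤 (der F P) (r ⊗ₜ[F] a) ∈ wtSpace x q k
    rw [tensDer_tmul]
    exact tmul_mem_wtSpace (by rw [hk]; ring) (der_mem_confWt hr) ha
  exact h1 hy

lemma lTensor_mem_wtSpace {i k : ℚ} {θ : 𝔤 →ₗ[F] 𝔤}
    (hθ : ∀ j, ∀ a ∈ gr (F := F) x j, θ a ∈ gr (F := F) x (j + 1)) (hk : i = k + 1)
    {y : DP F P ⊗[F] 𝔤} (hy : y ∈ wtSpace x q i) :
    LinearMap.lTensor (DP F P) θ y ∈ wtSpace x q k := by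
  have h1 : wtSpace x q i ≤ (wtSpace x q k).comap (LinearMap.lTensor (DP F P) θ) := by
    rw [wtSpace_le_iff]
    intro j r hr a ha
    exact tmul_mem_wtSpace (by rw [hk]; ring) hr (hθ j a ha)
  exact h1 hy

/-- The gauge transform of an element of weight `1` by an element of weight `0` has weight `1`. -/
lemma transform_mem_wtSpace [CharZero F] {S : GaugeSlice F 𝔤} (hf : S.f ∈ gr (F := F) x (-1))
    {X Q : DP F P ⊗[F] 𝔤} (hX : X ∈ wtSpace x q 0) (hQ : Q ∈ wtSpace x q 1) :
    S.transform (der F P) X Q ∈ wtSpace x q 1 := by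
  have hpow : ∀ (k : ℕ) (y : DP F P ⊗[F] 𝔤), y ∈ wtSpace x q 1 →
      ((LieAlgebra.ad F (DP F P ⊗[F] 𝔤) X) ^ k) y ∈ wtSpace x q 1 := by
    intro k
    induction k with
    | zero => exact fun y hy => hy
    | succ k ih =>
      intro y hy
      rw [pow_succ, Module.End.mul_apply]
      exact ih _ (lie_mem_wtSpace (by norm_num) hX hy)
  have hQf : Q + (1 : DP F P) ⊗ₜ S.f ∈ wtSpace x q 1 :=
    add_mem hQ (tmul_mem_wtSpace (by norm_num) one_mem_confWt hf)
  rw [GaugeSlice.transform_eq]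
  exact add_mem hQ (sum_mem fun k _ => Submodule.smul_mem _ _ (hpow k _
    (sub_mem (lie_mem_wtSpace (by norm_num) hX hQf) (tensDer_mem_wtSpace (by norm_num) hX))))

/-- The component of weight `k` of an element of weight `i` along a functional supported on `𝔤_j`. -/
lemma coord_mem_confWt {i j k : ℚ} (hk : k = i + j) {ℓ : 𝔤 →ₗ[F] F}
    (hℓ : ∀ j', j' ≠ j → ∀ a ∈ gr (F := F) x j', ℓ a = 0) {y : DP F P ⊗[F] 𝔤}
    (hy : y ∈ wtSpace x q i) : coord ℓ y ∈ confWt x q k := by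
  have h1 : wtSpace x q i ≤ (confWt x q k).comap (coord ℓ) := by
    rw [wtSpace_le_iff]
    intro j' r hr a ha
    rw [Submodule.mem_comap, coord_tmul]
    by_cases hj : j' = j
    · rw [hk, ← hj]
      exact Submodule.smul_mem _ _ hr
    · rw [hℓ j' hj a ha, zero_smul]
      exact zero_mem _
  exact h1 hy

/-! ### Linear terms -/

/-- The span of the monomials `b_1^{(m_1)} ⋯ b_s^{(m_s)}` with `s + m_1 + ⋯ + m_s ≥ 1`. -/
def augIdeal (q : Module.Basis P F p) : Submodule F (DP F P) := monSpan q (fun _ ε => ε = 0) (1 ≤ ·)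

lemma gen_mem_augIdeal (a : p) : gen q a ∈ augIdeal q :=
  gen_mem_monSpan (ε := 0) rfl (by norm_num)

lemma monSpan_le_higherTerms :
    monSpan q (fun _ ε => ε = 0) (1 < ·) ≤ higherTerms q := by
  refine Submodule.span_mono ?_
  rintro _ ⟨s, a, ε, m, h1, h2, rfl⟩
  refine ⟨s, a, m, ?_, rfl⟩
  simp only [h1, Finset.sum_const_zero, sub_zero] at h2
  exact_mod_cast h2

lemma higherTerms_le_monSpan :
    higherTerms q ≤ monSpan q (fun _ ε => ε = 0) (1 < ·) := by
  refine Submodule.span_mono ?_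
  rintro _ ⟨s, a, m, h1, rfl⟩
  refine ⟨s, a, fun _ => 0, m, fun _ => rfl, ?_, rfl⟩
  simp only [Finset.sum_const_zero, sub_zero]
  exact_mod_cast h1

lemma higherTerms_le_augIdeal : higherTerms q ≤ augIdeal q :=
  higherTerms_le_monSpan.trans (monSpan_mono fun _ h => h.le)

lemma mul_mem_higherTerms {g g' : DP F P} (hg : g ∈ augIdeal q) (hg' : g' ∈ augIdeal q) :
    g * g' ∈ higherTerms q :=
  monSpan_le_higherTerms (mul_mem_monSpan (fun c d hc hd => by linarith) hg hg')

lemma der_mem_higherTerms {g : DP F P} (hg : g ∈ augIdeal q) : der F P g ∈ higherTerms q :=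
  monSpan_le_higherTerms (der_mem_monSpan (fun c hc => by linarith) hg)

end Weights

section LinearTerms

variable {F : Type*} [Field F] {𝔤 : Type*} [LieRing 𝔤] [LieAlgebra F 𝔤] {R : Type*} [CommRing R]
  [Algebra F R] {d : Derivation F R R} {I I' : Submodule F R} {S : GaugeSlice F 𝔤}

lemma lie_tmul_one_mem {y : R ⊗[F] 𝔤} (hy : y ∈ tens I ⊤) (a : 𝔤) :
    ⁅y, (1 : R) ⊗ₜ[F] a⁆ ∈ tens I ⊤ := by
  refine lie_mem_tens (I' := Submodule.span F {1}) (U' := ⊤) (fun r hr s hs => ?_)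
    (fun _ _ _ _ => Submodule.mem_top) hy
    (tmul_mem_tens (Submodule.mem_span_singleton_self 1) Submodule.mem_top)
  obtain ⟨c, rfl⟩ := Submodule.mem_span_singleton.1 hs
  rw [mul_smul_comm, mul_one]
  exact I.smul_mem c hr

variable (hle : I' ≤ I) (hmul : ∀ r ∈ I, ∀ s ∈ I, r * s ∈ I') (hder : ∀ r ∈ I, d r ∈ I')
  {X Q : R ⊗[F] 𝔤} (hX : X ∈ tens I ⊤) (hQ : Q ∈ tens I ⊤)
include hle hmul hder hX hQ

/-- Up to higher terms, the gauge transform of `Q` is `Q + [X, f]`. -/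
lemma transform_sub_sub_mem :
    S.transform d X Q - Q - ⁅X, (1 : R) ⊗ₜ[F] S.f⁆ ∈ tens I' ⊤ := by
  have hmono : tens I' (⊤ : Submodule F 𝔤) ≤ tens I ⊤ := tens_mono hle le_rfl
  have hlie : ∀ y ∈ tens I ⊤, ⁅X, y⁆ ∈ tens I' ⊤ := fun y hy =>
    lie_mem_tens hmul (fun _ _ _ _ => Submodule.mem_top) hX hy
  have hpow : ∀ (k : ℕ) (y : R ⊗[F] 𝔤), y ∈ tens I ⊤ →
      ((LieAlgebra.ad F (R ⊗[F] 𝔤) X) ^ (k + 1)) y ∈ tens I' ⊤ := by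
    intro k
    induction k with
    | zero => exact fun y hy => by simpa using hlie y hy
    | succ k ih =>
      intro y hy
      rw [pow_succ, Module.End.mul_apply]
      exact ih _ (hmono (hlie y hy))
  have h1 : ⁅X, Q⁆ - tensDer 𝔤 d X ∈ tens I' ⊤ :=
    sub_mem (hlie Q hQ) (tensDer_mem_tens hder hX)
  have h2 : ⁅X, Q + (1 : R) ⊗ₜ S.f⁆ - tensDer 𝔤 d X =
      (⁅X, Q⁆ - tensDer 𝔤 d X) + ⁅X, (1 : R) ⊗ₜ S.f⁆ := by
    rw [lie_add]
    abel
  obtain ⟨N, hN⟩ : ∃ N, S.N = N + 1 := ⟨S.N - 1, by have := S.N_pos; omega⟩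
  rw [GaugeSlice.transform_eq, hN, Finset.sum_range_succ']
  have h3 : ∀ A B C D : R ⊗[F] 𝔤, A + (B + (C + D)) - A - D = B + C := fun A B C D => by abel
  simp only [zero_add, Nat.factorial_one, Nat.cast_one, inv_one, one_smul, pow_zero,
    Module.End.one_apply, h2, h3]
  refine add_mem (sum_mem fun k _ => Submodule.smul_mem _ _ (hpow k _ ?_)) h1
  exact add_mem (hmono h1) (lie_tmul_one_mem hX S.f)

lemma step_mem_tens : S.step d Q X ∈ tens I ⊤ := by
  have h := tens_mono hle (le_refl (⊤ : Submodule F 𝔤))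
    (transform_sub_sub_mem (S := S) hle hmul hder hX hQ)
  have h1 := add_mem (add_mem h (lie_tmul_one_mem hX S.f)) hQ
  rw [sub_add_cancel, sub_add_cancel] at h1
  exact add_mem hX (lTensor_mem_tens (fun _ _ => Submodule.mem_top) h1)

end LinearTerms


lemma coord_mem {F 𝔤 : Type*} [Field F] [LieRing 𝔤] [LieAlgebra F 𝔤] {R : Type*}
    [CommRing R] [Algebra F R] {I : Submodule F R} {U : Submodule F 𝔤} (ℓ : 𝔤 →ₗ[F] F)
    {y : R ⊗[F] 𝔤} (hy : y ∈ tens I U) : coord ℓ y ∈ I := by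
  have h : tens I U ≤ I.comap (coord ℓ) := tens_le.2 fun r hr a _ => by
    rw [Submodule.mem_comap, coord_tmul]
    exact I.smul_mem _ hr
  exact h hy

lemma coord_eq_zero {F 𝔤 : Type*} [Field F] [LieRing 𝔤] [LieAlgebra F 𝔤] {R : Type*}
    [CommRing R] [Algebra F R] {I : Submodule F R} {U : Submodule F 𝔤} {ℓ : 𝔤 →ₗ[F] F}
    (hℓ : ∀ a ∈ U, ℓ a = 0) {y : R ⊗[F] 𝔤} (hy : y ∈ tens I U) : coord ℓ y = 0 := by
  have h : tens I U ≤ LinearMap.ker (coord ℓ) := tens_le.2 fun r _ a ha => by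
    rw [LinearMap.mem_ker, coord_tmul, hℓ a ha, zero_smul]
  exact h hy

section

attribute [local instance 100] LieRing.ofAssociativeRing

lemma gaugeTransform_eq {F 𝔤 P : Type*} [Field F] [LieRing 𝔤] [LieAlgebra F 𝔤]
    {S : GaugeSlice F 𝔤} {X : DP F P ⊗[F] 𝔤} (hX : X ∈ tens ⊤ S.n) (Q : DP F P ⊗[F] 𝔤) :
    gaugeTransform S.f X Q = S.transform (der F P) X Q := by
  have h1 : derAction F 𝔤 P 1 = tensDer 𝔤 (der F P) := one_smul F (derLie F 𝔤 P)
  rw [gaugeTransform, expAd, sum_range_nilpotencyClass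
    (ad_pow_semiDirect_eq_zero (derAction F 𝔤 P) (GaugeSlice.ad_pow_eq_zero hX)),
    exp_sum_semiDirect, h1]
  rfl

end

/-! ### The gauge-fixed form of the universal element -/

section Main

variable {F : Type*} [Field F] [CharZero F] {𝔤 : Type*} [LieRing 𝔤] [LieAlgebra F 𝔤]
  [FiniteDimensional F 𝔤] {κ : LinearMap.BilinForm F 𝔤} {f x e : 𝔤} {l p : Submodule F 𝔤}
  {P : Type*} {q : Module.Basis P F p}
  (t : Setting κ f x e l) [Fintype P] [DecidableEq P] {q' : Module.Basis P F (mPerp κ x l)}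
  (hq : ∀ i j, κ (q' i : 𝔤) (q j : 𝔤) = if i = j then 1 else 0)

lemma univ_mem_augIdeal : univ q' ∈ tens (augIdeal q) ⊤ :=
  sum_mem fun i _ => tmul_mem_tens (gen_basis q i ▸ gen_mem_augIdeal (q i)) Submodule.mem_top

include t hq

/-- The universal element is homogeneous of weight `1`. -/
lemma univ_mem_wtSpace (hpg : IsGraded x p) : univ q' ∈ wtSpace x q 1 := by
  have h := t.isInternal
  obtain ⟨s, hs⟩ := exists_finset_sum_pr h
  have hp : ∀ j b, b ∈ p → pr h j b ∈ p := fun j b hb => pr_mem_of_isGraded h hpg hb j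
  -- the component of `q` in `V(p) ⊗ 𝔤_j`
  have h1 : ∀ j, ∑ i, (MvPolynomial.X (i, 0) : DP F P) ⊗ₜ[F] pr h j (q' i) =
      ∑ k, gen q ⟨pr h (-j) (q k), hp _ _ (q k).2⟩ ⊗ₜ[F] pr h j (q' k) := by
    intro j
    have h2 : ∀ i, pr h j (q' i : 𝔤) = ∑ k, κ (q' i) (pr h (-j) (q k)) • pr h j (q' k) := by
      intro i
      have h3 := sum_dual hq (t.pr_mem_mPerp (q' i).2 j)
      have h4 := congrArg (pr h j) h3
      rw [pr_of_mem h (pr_mem h j _), map_sum] at h4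
      rw [← h4]
      refine Finset.sum_congr rfl fun k _ => ?_
      rw [map_smul, t.kappa_pr j (-j) rfl]
    have h5 : ∀ i, (MvPolynomial.X (i, 0) : DP F P) ⊗ₜ[F] pr h j (q' i) =
        ∑ k, (κ (q' i) (pr h (-j) (q k)) • (MvPolynomial.X (i, 0) : DP F P)) ⊗ₜ[F]
          pr h j (q' k) := by
      intro i
      conv_lhs => rw [h2 i]
      rw [TensorProduct.tmul_sum]
      exact Finset.sum_congr rfl fun k _ => by rw [TensorProduct.smul_tmul]
    rw [Finset.sum_congr rfl fun i _ => h5 i, Finset.sum_comm]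
    refine Finset.sum_congr rfl fun k _ => ?_
    rw [gen_eq_sum_dual hq, TensorProduct.sum_tmul]
  have h6 : univ q' = ∑ j ∈ s, ∑ i, (MvPolynomial.X (i, 0) : DP F P) ⊗ₜ[F] pr h j (q' i) := by
    rw [Finset.sum_comm, univ]
    refine Finset.sum_congr rfl fun i _ => ?_
    rw [← TensorProduct.tmul_sum, hs]
  rw [h6]
  refine sum_mem fun j _ => ?_
  rw [h1]
  refine sum_mem fun k _ => tmul_mem_wtSpace (k := 1 - -j) (by ring) (gen_mem_confWt ?_)
    (pr_mem h j _)
  exact pr_mem h _ _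

/-- The vectors dual to eigenvectors are eigenvectors, with the opposite eigenvalues. -/
lemma mem_gr_of_dual (hpg : IsGraded x p) {δ : P → ℚ}
    (hδ : ∀ j, (q' j : 𝔤) ∈ gr (F := F) x (δ j)) (j : P) : (q j : 𝔤) ∈ gr (F := F) x (-δ j) := by
  have h := t.isInternal
  have hp := pr_mem_of_isGraded h hpg (q j).2 (-δ j)
  have h1 : pr h (-δ j) (q j : 𝔤) = q j := by
    refine (sum_dual' hq hp).symm.trans (Eq.trans ?_ (sum_dual' hq (q j).2))
    refine Finset.sum_congr rfl fun i _ => ?_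
    congr 1
    rw [← t.kappa_pr (δ j) (-δ j) rfl]
    by_cases hij : δ i = δ j
    · rw [pr_of_mem h (hij ▸ hδ i)]
    · rw [pr_of_mem_ne h hij (hδ i), map_zero, LinearMap.zero_apply, hq, if_neg]
      rintro rfl
      exact hij rfl
  rw [← h1]
  exact pr_mem h _ _

/-- The vectors dual to a complement of `[f, n]` form a basis of `Ker (ad f)`. -/
lemma span_dual_eq_ker (hpg : IsGraded x p) (hmp : IsCompl (subM x l) p) {J : Finset P}
    (hJ : Submodule.span F ((fun j => (q' j : 𝔤)) '' (J : Set P)ᶜ) = lieFN κ f x l) :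
    Submodule.span F ((fun j => (q j : 𝔤)) '' (J : Set P)) =
      LinearMap.ker (LieAlgebra.ad F 𝔤 f) := by
  rw [t.ker_eq_inf hpg hmp]
  refine le_antisymm ?_ ?_
  · rw [Submodule.span_le]
    rintro _ ⟨j, hj, rfl⟩
    refine ⟨(q j).2, ?_⟩
    have h1 : lieFN κ f x l ≤ LinearMap.ker (κ.flip (q j : 𝔤)) := by
      rw [← hJ, Submodule.span_le]
      rintro _ ⟨i, hi, rfl⟩
      change κ (q' i) (q j) = 0
      rw [hq, if_neg]
      rintro rfl
      exact hi hj
    exact fun b hb => h1 hb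
  · rintro a ⟨ha, ha'⟩
    rw [← sum_dual' hq ha]
    refine sum_mem fun i _ => ?_
    by_cases hi : i ∈ J
    · exact Submodule.smul_mem _ _ (Submodule.subset_span ⟨i, hi, rfl⟩)
    · have : κ (q' i) a = 0 := ha' _ (hJ ▸ Submodule.subset_span ⟨i, hi, rfl⟩)
      rw [this, zero_smul]
      exact zero_mem _

/-- The components of the gauge-fixed element in a basis of eigenvectors. -/
theorem components_homogeneous (hpg : IsGraded x p) {S : GaugeSlice F 𝔤} (hSf : S.f = f)
    (hSn : S.n = subN κ f x l) (hSM : S.M = mPerp κ x l) {X : DP F P ⊗[F] 𝔤}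
    (hX : X ∈ tens ⊤ S.n) (hXV : S.transform (der F P) X (univ q') ∈ tens ⊤ S.V)
    (hXI : X ∈ tens (augIdeal q) ⊤) (hwt : S.transform (der F P) X (univ q') ∈ wtSpace x q 1)
    {v' : Module.Basis P F (mPerp κ x l)} {v : Module.Basis P F p} {δ : P → ℚ} {J : Finset P}
    (hδ : ∀ j, (v' j : 𝔤) ∈ gr (F := F) x (δ j))
    (hJ : Submodule.span F ((fun j => (v' j : 𝔤)) '' (J : Set P)) = S.V)
    (hJ' : Submodule.span F ((fun j => (v' j : 𝔤)) '' (J : Set P)ᶜ) = lieFN κ f x l)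
    (hv : ∀ i j, κ (v' i : 𝔤) (v j : 𝔤) = if i = j then 1 else 0) :
    ∃ w : P → DP F P,
      S.transform (der F P) X (univ q') = ∑ j ∈ J, w j ⊗ₜ[F] (v' j : 𝔤) ∧
      ∀ j ∈ J, w j ∈ confWt x q (1 + δ j) ∧ ∃ g : DP F P, w j = gen q (v j) + g ∧
        g ∈ confWt x q (1 + δ j) ∧ g ∈ higherTerms q := by
  set W := S.transform (der F P) X (univ q') with hW
  have hvgr := mem_gr_of_dual t hv hpg hδ
  refine ⟨fun j => coord (κ.flip (v j)) W, ?_, fun j hj => ?_⟩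
  · have h1 := eq_sum_coord hv (hSM ▸ tens_mono le_rfl S.V_le_M hXV)
    refine h1.trans (Finset.sum_subset (Finset.subset_univ J) fun j _ hj => ?_).symm
    have h2 : ∀ a ∈ S.V, κ.flip (v j : 𝔤) a = 0 := by
      have : S.V ≤ LinearMap.ker (κ.flip (v j : 𝔤)) := by
        rw [← hJ, Submodule.span_le]
        rintro _ ⟨i, hi, rfl⟩
        change κ (v' i) (v j) = 0
        rw [hv, if_neg]
        rintro rfl
        exact hj hi
      exact fun a ha => this ha
    rw [coord_eq_zero h2 hXV, TensorProduct.zero_tmul]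
  · have hw : coord (κ.flip (v j)) W ∈ confWt x q (1 + δ j) := by
      refine coord_mem_confWt (j := δ j) rfl (fun i hi a ha => ?_) hwt
      exact t.kappa_gr (by intro h; exact hi (by linarith)) ha (hvgr j)
    have hg : gen q (v j) ∈ confWt x q (1 + δ j) := by
      have := gen_mem_confWt (q := q) (hvgr j)
      rwa [sub_neg_eq_add] at this
    refine ⟨hw, coord (κ.flip (v j)) W - gen q (v j), (add_sub_cancel _ _).symm,
      sub_mem hw hg, ?_⟩
    have h1 : coord (κ.flip (v j)) (univ q') = gen q (v j) := by
      rw [gen_eq_sum_dual hq, univ, map_sum]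
      exact Finset.sum_congr rfl fun i _ => coord_tmul _ _ _
    have h2 : coord (κ.flip (v j)) ⁅X, (1 : DP F P) ⊗ₜ[F] S.f⁆ = 0 := by
      have h3 : ⁅X, (1 : DP F P) ⊗ₜ[F] S.f⁆ ∈ tens ⊤ (lieFN κ f x l) := by
        refine lie_mem_tens (U' := Submodule.span F {f}) (fun _ _ _ _ => Submodule.mem_top)
          (fun a ha b hb => ?_) (hSn ▸ hX)
          (tmul_mem_tens Submodule.mem_top (hSf ▸ Submodule.mem_span_singleton_self S.f))
        obtain ⟨c, rfl⟩ := Submodule.mem_span_singleton.1 hb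
        rw [lie_smul, ← lie_skew]
        exact Submodule.smul_mem _ _ (neg_mem ⟨a, ha, rfl⟩)
      refine coord_eq_zero (fun a ha => ?_) h3
      have : lieFN κ f x l ≤ LinearMap.ker (κ.flip (v j : 𝔤)) := by
        rw [← hJ', Submodule.span_le]
        rintro _ ⟨i, hi, rfl⟩
        change κ (v' i) (v j) = 0
        rw [hv, if_neg]
        rintro rfl
        exact hi hj
      exact this ha
    have h4 := coord_mem (κ.flip (v j)) (transform_sub_sub_mem (S := S) (d := der F P)
      higherTerms_le_augIdeal (fun _ hr _ hs => mul_mem_higherTerms hr hs)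
      (fun _ hr => der_mem_higherTerms hr) hXI (univ_mem_augIdeal (q' := q')))
    rw [map_sub, map_sub, h1, h2, sub_zero] at h4
    exact h4

end Main

end

end ClassicalW

open ClassicalW in
theorem theorem3 {F : Type*} [Field F] [CharZero F]
    {𝔤 : Type*} [LieRing 𝔤] [LieAlgebra F 𝔤] [FiniteDimensional F 𝔤]
    [LieAlgebra.HasCentralRadical F 𝔤]
    (κ : LinearMap.BilinForm F 𝔤) (hκ_nondeg : κ.Nondegenerate) (hκ_symm : κ.IsSymm)
    (hκ_inv : κ.lieInvariant 𝔤)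
    (f x e : 𝔤) (hsl2 : IsSl2Triple ((2 : F) • x) e f)
    (l : Submodule F 𝔤) (hl : l ≤ gr x (1 / 2)) (hl_iso : ∀ a ∈ l, ∀ b ∈ l, omega κ f a b = 0)
    (p : Submodule F 𝔤) (hp : p ≤ grLeHalf x) (hmp : IsCompl (subM x l) p)
    (s : 𝔤) (hs : ∀ a ∈ subN κ f x l, ⁅a, s⁆ = 0) (z : F)
    (V : Submodule F 𝔤) (hV_graded : IsGraded x V)
    (hV_disj : Disjoint (lieFN κ f x l) V) (hV_sup : lieFN κ f x l ⊔ V = mPerp κ x l)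
    {I P : Type*} [Fintype P] [DecidableEq P]
    (u : Module.Basis I F 𝔤)
    (q : Module.Basis P F p) (q' : Module.Basis P F (mPerp κ x l))
    (hq : ∀ i j, κ (q' i : 𝔤) (q j : 𝔤) = if i = j then 1 else 0)
    (Q : DP F P ⊗[F] 𝔤) (hQ : Q = ∑ i, gen q (q i) ⊗ₜ[F] (q' i : 𝔤)) :
    ∃ X : DP F P ⊗[F] 𝔤,
      -- (a) existence and uniqueness of `X`
      (X ∈ (subN κ f x l).baseChange (DP F P) ∧ gaugeTransform f X Q ∈ V.baseChange (DP F P)) ∧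
      (∀ Y : DP F P ⊗[F] 𝔤, Y ∈ (subN κ f x l).baseChange (DP F P) →
        gaugeTransform f Y Q ∈ V.baseChange (DP F P) → Y = X) ∧
      -- (a) weights
      (IsGraded x p → X ∈ wtSpace x q 0 ∧ gaugeTransform f X Q ∈ wtSpace x q 1) ∧
      -- (b)
      (IsGraded x p →
        ∀ (v' : Module.Basis P F (mPerp κ x l)) (v : Module.Basis P F p) (δ : P → ℚ) (J : Finset P),
          (∀ j, (v' j : 𝔤) ∈ gr (F := F) x (δ j)) →
          Submodule.span F ((fun j => (v' j : 𝔤)) '' (J : Set P)) = V →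
          Submodule.span F ((fun j => (v' j : 𝔤)) '' (J : Set P)ᶜ) = lieFN κ f x l →
          (∀ i j, κ (v' i : 𝔤) (v j : 𝔤) = if i = j then 1 else 0) →
          (LinearIndependent F (fun j : J => (v j : 𝔤)) ∧
            Submodule.span F ((fun j => (v j : 𝔤)) '' (J : Set P)) =
              LinearMap.ker (LieAlgebra.ad F 𝔤 f)) ∧
          ∃ w : P → DP F P,
            gaugeTransform f X Q = ∑ j ∈ J, w j ⊗ₜ[F] (v' j : 𝔤) ∧
            ∀ j ∈ J, w j ∈ confWt x q (1 + δ j) ∧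
              ∃ g : DP F P, w j = gen q (v j) + g ∧
                g ∈ confWt x q (1 + δ j) ∧ g ∈ higherTerms q) ∧
      -- (c)
      (∀ (r : ℕ) (b : Module.Basis (Fin r) F V),
          r = Module.finrank F (LinearMap.ker (LieAlgebra.ad F 𝔤 f)) ∧
          ∃ w : Fin r → DP F P,
            gaugeTransform f X Q = ∑ j, w j ⊗ₜ[F] (b j : 𝔤) ∧
            Function.Injective (diffEval w) ∧
            Set.range (diffEval w) = walg κ f x l s z hmp u q) := by
  have t : Setting κ f x e l := ⟨hκ_nondeg, hκ_symm, hκ_inv, hsl2, hl⟩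
  obtain ⟨S, hSf, hSn, hSM, hSV, hθ⟩ := t.exists_slice hV_graded hV_disj hV_sup
  have hQu : Q = univ q' := by rw [hQ]; simp only [gen_basis, univ]
  have hQM : univ q' ∈ tens ⊤ S.M := by rw [hSM]; exact univ_mem
  have hT : ∀ Y ∈ tens ⊤ S.n, gaugeTransform f Y Q = S.transform (der F P) Y (univ q') := by
    intro Y hY
    rw [← gaugeTransform_eq hY, hSf, hQu]
  obtain ⟨X, hX, hXV, hind⟩ := GaugeSlice.exists_transform_mem (d := der F P) hQM
  have hwt : IsGraded x p → X ∈ wtSpace x q 0 ∧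
      S.transform (der F P) X (univ q') ∈ wtSpace x q 1 := by
    intro hpg
    have hQ1 := univ_mem_wtSpace t hq hpg
    have hf : S.f ∈ gr (F := F) x (-1) := hSf ▸ t.f_mem
    have h0 : X ∈ wtSpace x q 0 := hind (wtSpace x q 0 : Set (DP F P ⊗[F] 𝔤)) (zero_mem _) fun Y hY =>
      add_mem hY (lTensor_mem_wtSpace hθ (by norm_num) (transform_mem_wtSpace hf hY hQ1))
    exact ⟨h0, transform_mem_wtSpace hf h0 hQ1⟩
  refine ⟨X, ⟨?_, ?_⟩, ?_, ?_, ?_, ?_⟩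
  · rwa [mem_baseChange_iff, ← hSn]
  · rwa [mem_baseChange_iff, hT X hX, ← hSV]
  · intro Y hY hYV
    rw [mem_baseChange_iff, ← hSn] at hY
    rw [mem_baseChange_iff, hT Y hY, ← hSV] at hYV
    exact GaugeSlice.eq_of_transform_mem hY hX hQM hYV hXV
  · rw [hT X hX]
    exact hwt
  · intro hpg v' v δ J hδ hJ hJ' hv
    refine ⟨⟨?_, span_dual_eq_ker t hv hpg hmp hJ'⟩, ?_⟩
    · exact (v.linearIndependent.map' p.subtype p.ker_subtype).comp _ Subtype.val_injective
    · rw [hT X hX]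
      have hXI : X ∈ tens (augIdeal q) ⊤ := hind ((tens (augIdeal q) ⊤ :
        Submodule F (DP F P ⊗[F] 𝔤)) : Set (DP F P ⊗[F] 𝔤)) (zero_mem _)
        fun Y hY => step_mem_tens higherTerms_le_augIdeal
          (fun _ hr _ hs => mul_mem_higherTerms hr hs) (fun _ hr => der_mem_higherTerms hr) hY
          univ_mem_augIdeal
      exact components_homogeneous t hq hpg hSf hSn hSM hX hXV hXI (hwt hpg).2 hδ
        (hJ.trans hSV.symm) hJ' hv
  · intro r b
    have hr : r = Module.finrank F (LinearMap.ker (LieAlgebra.ad F 𝔤 f)) := by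
      rw [← t.finrank_eq hV_disj hV_sup, Module.finrank_eq_card_basis b, Fintype.card_fin]
    refine ⟨hr, ?_⟩
    have : Nonempty P := by
      by_contra hP
      rw [not_nonempty_iff] at hP
      have h1 : mPerp κ x l = ⊥ := by
        rw [← Submodule.finrank_eq_zero, Module.finrank_eq_card_basis q', Fintype.card_eq_zero]
      have h2 : V ≤ ⊥ := h1 ▸ hV_sup ▸ le_sup_right
      have h3 : LinearMap.ker (LieAlgebra.ad F 𝔤 f) = ⊥ := by
        rw [← Submodule.finrank_eq_zero, ← t.finrank_eq hV_disj hV_sup, le_bot_iff.1 h2,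
          finrank_bot]
      have h4 : f ∈ LinearMap.ker (LieAlgebra.ad F 𝔤 f) := lie_self f
      rw [h3, Submodule.mem_bot] at h4
      exact hsl2.f_ne_zero h4
    rw [hT X hX]
    subst hSV
    exact walg_generators t hq hSf hSn hSM hX hXV hp hs z b
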